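/- Let $k$ be a field of characteristic $0$, $S=k[x_1,\dots,x_n]$, and let $A=k\langle x_1,\dots,x_n,\partial_1,\dots,\partial_n\rangle$ be the Weyl algebra with its Bernstein filtration $F_d=\langle x^{\mathbf a}\partial^{\mathbf b} : |\mathbf a|+|\mathbf b|\le d\rangle_k$, so that $\operatorname{gr}A=k[\bar x_1,\dots,\bar x_n,\bar\partial_1,\dots,\bar\partial_n]$ is a polynomial ring. For a finitely generated left $A$-module $M$, a good filtration is an exhaustive increasing filtration $\Gamma_0\subset\Gamma_1\subset\cdots$ of $M$ by $k$-subspaces with $F_i\Gamma_j\subset\Gamma_{i+j}$ such that $\operatorname{gr}M=\bigoplus_j\Gamma_j/\Gamma_{j-1}$ (with $\Gamma_{-1}=0$) is a finitely generated $\operatorname{gr}A$-module; $\operatorname{SS}(M)$ is the set of minimal associated primes of $\operatorname{gr}M$, and $e_Q(M)$ is the length of $(\operatorname{gr}M)_Q$ over $(\operatorname{gr}A)_Q$ for a prime $Q$ (neither depends on the good filtration when $Q\in\operatorname{SS}(M)$). For $F\subset[n]=\{1,\dots,n\}$ let $Q_F=(\bar x_i : i\notin F)+(\bar\partial_j : j\in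 F)\subset\operatorname{gr}A$. Let $\Delta\subset 2^{[n]}$ be a simplicial complex (a nonempty family of subsets closed under taking subsets) with Stanley--Reisner ideal $I_\Delta=(\prod_{j\in G}x_j : G\notin\Delta)\subset S$. Regard the local cohomology module $H^i_{I_\Delta}(S)$ as a left $A$-module in the natural way: it is the $i$-th cohomology of the Čech complex on any finite system of generators of $I_\Delta$, whose terms are localizations of $S$, on which $A$ acts through the partial derivatives. Then, for every $i\ge 0$, $H^i_{I_\Delta}(S)$ is a finitely generated $A$-module and admits a good filtration; for every good filtration, each element of $\operatorname{SS}(H^i_{I_\Delta}(S))$ is of the form $Q_F$ with $F\subset[n]$, and for every $F\subset[n]$ $$e_{Q_F}\bigl(H^i_{I_\Delta}(S)\bigr)=\dim_k\tilde H_{n-i-|F|-1}(\operatorname{lk}_\Delta F;k),$$ where $\operatorname{lk}_\Delta F=\{G\subset[n] : G\cap F=\emptyset,\ F\cup G\in\Delta\}$ and $\tilde H$ is reduced simplicial homology (zero in every degree for the void complex, which is $\operatorname{lk}_\Delta F$ when $F\notin\Delta$). In other words, the characteristic cycle of $H^i_{I_\Delta}(S)$ is $\sum_{F\subset[n]}\dim_k\tilde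 H_{n-i-|F|-1}(\operatorname{lk}_\Delta F;k)\,[Q_F]$. -/

import Mathlib

noncomputable section

namespace CharCycle

open scoped IsMulCommutative

universe u v

/-! ### Simplicial complexes on `{1, …, n}`

A simplicial complex is a nonempty lower set `Δ` of finite subsets of `Fin n`; it contains the
empty face, and it need not contain every singleton. -/

section Simplicial

variable (k : Type u) [Field k] {n : ℕ}

/-- The link of `F` in `Δ`; it is void if `F ∉ Δ`. -/
def link (Δ : Set (Finset (Fin n))) (F : Finset (Fin n)) : Set (Finset (Fin n)) :=
  {G | Disjoint G F ∧ F ∪ G ∈ Δ}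

/-- The Stanley-Reisner ideal, generated by the monomials `x^G` with `G ∉ Δ`. -/
def stanleyReisnerIdeal (Δ : Set (Finset (Fin n))) : Ideal (MvPolynomial (Fin n) k) :=
  Ideal.span {p | ∃ G : Finset (Fin n), G ∉ Δ ∧ p = ∏ i ∈ G, MvPolynomial.X i}

/-- Simplicial `j`-chains of `Δ`: functions on the subsets of `Fin n` that live on the faces of `Δ`
with `j + 1` elements. The empty face spans the chains of degree `-1`. -/
def chains (Δ : Set (Finset (Fin n))) (j : ℤ) : Submodule k (Finset (Fin n) → k) where
  carrier := {c | ∀ σ, ¬ (σ ∈ Δ ∧ (σ.card : ℤ) = j + 1) → c σ = 0}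
  zero_mem' := fun _ _ => rfl
  add_mem' := fun ha hb σ hσ => by simp [ha σ hσ, hb σ hσ]
  smul_mem' := fun r a ha σ hσ => by simp [ha σ hσ]

variable (n) in
/-- The simplicial boundary. The coefficient of `τ` in the boundary of `τ ∪ {v}`, for `v ∉ τ`,
is `(-1) ^ p`, where `p` is the number of vertices of `τ` before `v`. -/
def boundary : (Finset (Fin n) → k) →ₗ[k] (Finset (Fin n) → k) where
  toFun c := fun τ => ∑ v ∈ τᶜ, (-1) ^ (τ.filter (· < v)).card * c (insert v τ)
  map_add' a b := by
    funext τ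
    simp [mul_add, Finset.sum_add_distrib]
  map_smul' r a := by
    funext τ
    simp [Finset.mul_sum, mul_left_comm]

/-- The `j`-cycles of `Δ`. -/
def cycles (Δ : Set (Finset (Fin n))) (j : ℤ) : Submodule k (Finset (Fin n) → k) :=
  chains k Δ j ⊓ LinearMap.ker (boundary k n)

/-- The `j`-boundaries of `Δ`. -/
def boundaries (Δ : Set (Finset (Fin n))) (j : ℤ) : Submodule k (Finset (Fin n) → k) :=
  (chains k Δ (j + 1)).map (boundary k n)

/-- Reduced simplicial homology of `Δ` with coefficients in `k`. -/
abbrev ReducedHomology (Δ : Set (Finset (Fin n))) (j : ℤ) : Type u :=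
  cycles k Δ j ⧸ (boundaries k Δ j).submoduleOf (cycles k Δ j)

end Simplicial

/-! ### The Weyl algebra -/

section Weyl

variable (k : Type u) [Field k] (n : ℕ)

/-- The defining relations of the Weyl algebra; `Sum.inl i` stands for `x_i` and `Sum.inr i`
for `∂_i`. -/
inductive WeylRel : FreeAlgebra k (Fin n ⊕ Fin n) → FreeAlgebra k (Fin n ⊕ Fin n) → Prop
  | x_comm (i j : Fin n) : WeylRel
      (FreeAlgebra.ι k (Sum.inl i) * FreeAlgebra.ι k (Sum.inl j))
      (FreeAlgebra.ι k (Sum.inl j) * FreeAlgebra.ι k (Sum.inl i))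
  | d_comm (i j : Fin n) : WeylRel
      (FreeAlgebra.ι k (Sum.inr i) * FreeAlgebra.ι k (Sum.inr j))
      (FreeAlgebra.ι k (Sum.inr j) * FreeAlgebra.ι k (Sum.inr i))
  | d_x (i j : Fin n) : WeylRel
      (FreeAlgebra.ι k (Sum.inr i) * FreeAlgebra.ι k (Sum.inl j))
      (FreeAlgebra.ι k (Sum.inl j) * FreeAlgebra.ι k (Sum.inr i) + if i = j then 1 else 0)

/-- The `n`-th Weyl algebra `k⟨x_1, …, x_n, ∂_1, …, ∂_n⟩`. -/
def Weyl : Type u := RingQuot (WeylRel k n)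

instance : Ring (Weyl k n) := inferInstanceAs (Ring (RingQuot (WeylRel k n)))

instance : Algebra k (Weyl k n) := inferInstanceAs (Algebra k (RingQuot (WeylRel k n)))

/-- The quotient map onto the Weyl algebra. -/
def weylMk : FreeAlgebra k (Fin n ⊕ Fin n) →ₐ[k] Weyl k n := RingQuot.mkAlgHom k (WeylRel k n)

/-- The generators `x_i` and `∂_i`. -/
def weylGen (s : Fin n ⊕ Fin n) : Weyl k n := weylMk k n (FreeAlgebra.ι k s)

/-- The Bernstein filtration: `F_d` is spanned by the `x^a ∂^b` with `|a| + |b| ≤ d`. -/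
def bernstein (d : ℕ) : Submodule k (Weyl k n) :=
  Submodule.span k {P | ∃ a b : Fin n → ℕ, (∑ i, a i) + (∑ i, b i) ≤ d ∧
    P = (List.ofFn fun i => weylGen k n (Sum.inl i) ^ a i).prod *
        (List.ofFn fun i => weylGen k n (Sum.inr i) ^ b i).prod}

variable {k n}

theorem weylMk_surjective : Function.Surjective (weylMk k n) := RingQuot.mkAlgHom_surjective k _

theorem weylGen_x_comm (i j : Fin n) : weylGen k n (Sum.inl i) * weylGen k n (Sum.inl j) =
    weylGen k n (Sum.inl j) * weylGen k n (Sum.inl i) := by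
  have h : weylMk k n _ = weylMk k n _ := RingQuot.mkAlgHom_rel k (WeylRel.x_comm (k := k) i j)
  rw [map_mul, map_mul] at h
  exact h

theorem weylGen_d_comm (i j : Fin n) : weylGen k n (Sum.inr i) * weylGen k n (Sum.inr j) =
    weylGen k n (Sum.inr j) * weylGen k n (Sum.inr i) := by
  have h : weylMk k n _ = weylMk k n _ := RingQuot.mkAlgHom_rel k (WeylRel.d_comm (k := k) i j)
  rw [map_mul, map_mul] at h
  exact h

theorem weylGen_d_x (i j : Fin n) : weylGen k n (Sum.inr i) * weylGen k n (Sum.inl j) =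
    weylGen k n (Sum.inl j) * weylGen k n (Sum.inr i) + if i = j then 1 else 0 := by
  have h : weylMk k n _ = weylMk k n _ := RingQuot.mkAlgHom_rel k (WeylRel.d_x (k := k) i j)
  rw [map_mul, map_add, map_mul] at h
  refine h.trans ?_
  congr 1
  split_ifs <;> simp

theorem weylGen_commutator (s t : Fin n ⊕ Fin n) : ∃ c : k,
    weylGen k n s * weylGen k n t = weylGen k n t * weylGen k n s + algebraMap k _ c := by
  rcases s with i | i <;> rcases t with j | j
  · exact ⟨0, by simp [weylGen_x_comm i j]⟩
  · refine ⟨-(if j = i then 1 else 0), ?_⟩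
    rw [weylGen_d_x j i]
    split_ifs <;> simp
  · refine ⟨if i = j then 1 else 0, ?_⟩
    rw [weylGen_d_x i j]
    split_ifs <;> simp
  · exact ⟨0, by simp [weylGen_d_comm i j]⟩

theorem prod_ofFn_pow_single {R : Type*} [Monoid R] {m : ℕ} (g : Fin m → R) (i : Fin m) :
    (List.ofFn fun j => g j ^ (if j = i then 1 else 0)).prod = g i := by
  induction m with
  | zero => exact i.elim0
  | succ m ih =>
    rw [List.ofFn_succ, List.prod_cons]
    refine Fin.cases ?_ (fun i' => ?_) i
    · simp [Fin.succ_ne_zero]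
    · have := ih (fun j => g j.succ) i'
      simp only [Fin.succ_inj]
      rw [this]
      simp [(Fin.succ_ne_zero i').symm]

theorem weylGen_mem_bernstein (s : Fin n ⊕ Fin n) : weylGen k n s ∈ bernstein k n 1 := by
  refine Submodule.subset_span ?_
  rcases s with i | i
  · refine ⟨fun j => if j = i then 1 else 0, 0, by simp, ?_⟩
    rw [prod_ofFn_pow_single (fun j => weylGen k n (Sum.inl j)) i]
    simp
  · refine ⟨0, fun j => if j = i then 1 else 0, by simp, ?_⟩
    rw [prod_ofFn_pow_single (fun j => weylGen k n (Sum.inr j)) i]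
    simp

/-- A representation of the Weyl algebra, from operators that satisfy its relations. -/
def weylLift {B : Type*} [Ring B] [Algebra k B] (x d : Fin n → B)
    (hx : ∀ i j, x i * x j = x j * x i) (hd : ∀ i j, d i * d j = d j * d i)
    (hdx : ∀ i j, d i * x j = x j * d i + if i = j then 1 else 0) : Weyl k n →ₐ[k] B :=
  RingQuot.liftAlgHom k ⟨FreeAlgebra.lift k (Sum.elim x d), by
    rintro _ _ (⟨i, j⟩ | ⟨i, j⟩ | ⟨i, j⟩)
    · simpa using hx i j
    · simpa using hd i j
    · rw [map_mul, map_add, map_mul]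
      simp only [FreeAlgebra.lift_ι_apply, Sum.elim_inl, Sum.elim_inr, hdx i j]
      congr 1
      split_ifs <;> simp⟩

theorem weylLift_gen {B : Type*} [Ring B] [Algebra k B] (x d : Fin n → B)
    (hx : ∀ i j, x i * x j = x j * x i) (hd : ∀ i j, d i * d j = d j * d i)
    (hdx : ∀ i j, d i * x j = x j * d i + if i = j then 1 else 0) (s : Fin n ⊕ Fin n) :
    weylLift (k := k) x d hx hd hdx (weylGen k n s) = Sum.elim x d s := by
  change RingQuot.liftAlgHom k _ (RingQuot.mkAlgHom k _ _) = _
  rw [RingQuot.liftAlgHom_mkAlgHom_apply, FreeAlgebra.lift_ι_apply]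

/-- A `k`-linear map that commutes with the generators is linear over the Weyl algebra. -/
theorem weyl_map_smul {M N : Type*} [AddCommGroup M] [Module k M] [Module (Weyl k n) M]
    [IsScalarTower k (Weyl k n) M] [AddCommGroup N] [Module k N] [Module (Weyl k n) N]
    [IsScalarTower k (Weyl k n) N] (φ : M →ₗ[k] N)
    (h : ∀ s m, φ (weylGen k n s • m) = weylGen k n s • φ m) (P : Weyl k n) (m : M) :
    φ (P • m) = P • φ m := by
  obtain ⟨p, rfl⟩ := weylMk_surjective P
  induction p using FreeAlgebra.induction generalizing m with
  | grade0 r => simp [algebraMap_smul]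
  | grade1 s => exact h s m
  | mul a b ha hb => rw [map_mul, mul_smul, mul_smul, ha, hb]
  | add a b ha hb => rw [map_add, add_smul, add_smul, map_add, ha, hb]

end Weyl

/-! ### Localizations of the polynomial ring as modules over the Weyl algebra -/

section Localization

variable {k : Type u} [Field k] {n : ℕ} (g : MvPolynomial (Fin n) k)

/-- The ring homomorphism `s ↦ s + ε ∂_i s` from `S` to the dual numbers over `S_g`. -/
def dualLift₀ (i : Fin n) : MvPolynomial (Fin n) k →+*
    TrivSqZeroExt (Localization.Away g) (Localization.Away g) where
  toFun s := TrivSqZeroExt.inl (algebraMap _ _ s) +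
    TrivSqZeroExt.inr (algebraMap _ _ (MvPolynomial.pderiv i s))
  map_one' := by simp
  map_zero' := by simp
  map_add' a b := by
    refine TrivSqZeroExt.ext ?_ ?_
    · simp only [TrivSqZeroExt.fst_add, TrivSqZeroExt.fst_inl, TrivSqZeroExt.fst_inr, map_add,
        add_zero]
    · simp only [TrivSqZeroExt.snd_add, TrivSqZeroExt.snd_inl, TrivSqZeroExt.snd_inr, map_add,
        zero_add]
  map_mul' a b := by
    refine TrivSqZeroExt.ext ?_ ?_
    · simp only [TrivSqZeroExt.fst_add, TrivSqZeroExt.fst_inl, TrivSqZeroExt.fst_inr,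
        TrivSqZeroExt.fst_mul, map_mul, add_zero]
    · simp only [TrivSqZeroExt.snd_add, TrivSqZeroExt.snd_inl, TrivSqZeroExt.snd_inr,
        TrivSqZeroExt.snd_mul, TrivSqZeroExt.fst_add, TrivSqZeroExt.fst_inl,
        TrivSqZeroExt.fst_inr, Derivation.leibniz, map_mul, map_add, zero_add, add_zero,
        smul_eq_mul, op_smul_eq_smul]

theorem isUnit_dualLift₀ (i : Fin n) (y : Submonoid.powers g) :
    IsUnit (dualLift₀ g i (y : MvPolynomial (Fin n) k)) := by
  rw [TrivSqZeroExt.isUnit_iff_isUnit_fst]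
  simpa [dualLift₀] using IsLocalization.map_units (Localization.Away g) y

/-- The extension of `dualLift₀` to the localization. -/
def dualLift (i : Fin n) : Localization.Away g →+*
    TrivSqZeroExt (Localization.Away g) (Localization.Away g) :=
  IsLocalization.lift (M := Submonoid.powers g) (isUnit_dualLift₀ g i)

theorem dualLift_algebraMap (i : Fin n) (s : MvPolynomial (Fin n) k) :
    dualLift g i (algebraMap _ _ s) = dualLift₀ g i s := IsLocalization.lift_eq _ s

theorem fst_dualLift (i : Fin n) (a : Localization.Away g) : (dualLift g i a).fst = a := by
  have : (TrivSqZeroExt.fstHom k (Localization.Away g) (Localization.Away g)).toRingHom.comp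
      (dualLift g i) = RingHom.id _ := by
    apply IsLocalization.ringHom_ext (Submonoid.powers g)
    ext s
    · simp [dualLift_algebraMap, dualLift₀]
    · simp [dualLift_algebraMap, dualLift₀]
  exact DFunLike.congr_fun this a

/-- The partial derivative `∂_i` on the localization `S_g` (the quotient rule): the unique
derivation of `S_g` that extends `∂_i`. -/
def locDeriv (i : Fin n) : Derivation k (Localization.Away g) (Localization.Away g) :=
  Derivation.mk'
    { toFun := fun a => (dualLift g i a).snd
      map_add' := fun a b => by simp
      map_smul' := fun r a => by
        have h : r • a = algebraMap (MvPolynomial (Fin n) k) (Localization.Away g)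
            (MvPolynomial.C r) * a := by
          rw [← Algebra.smul_def, ← MvPolynomial.algebraMap_eq, algebraMap_smul]
        have h2 : ∀ b : Localization.Away g, r • b =
            algebraMap (MvPolynomial (Fin n) k) (Localization.Away g) (MvPolynomial.C r) * b := by
          intro b
          rw [← Algebra.smul_def, ← MvPolynomial.algebraMap_eq, algebraMap_smul]
        rw [h, map_mul, dualLift_algebraMap, RingHom.id_apply, h2]
        simp [dualLift₀] }
    (fun a b => by simp [fst_dualLift, mul_comm])

theorem locDeriv_algebraMap (i : Fin n) (s : MvPolynomial (Fin n) k) :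
    locDeriv g i (algebraMap _ _ s) = algebraMap _ _ (MvPolynomial.pderiv i s) := by
  change (dualLift g i _).snd = _
  rw [dualLift_algebraMap]
  simp only [dualLift₀, RingHom.coe_mk, MonoidHom.coe_mk, OneHom.coe_mk, TrivSqZeroExt.snd_add,
    TrivSqZeroExt.snd_inl, TrivSqZeroExt.snd_inr, zero_add]

/-- A derivation out of `S_g` along a ring homomorphism is determined on `S`. -/
theorem eq_zero_of_leibniz {T : Type*} [CommRing T] (φ : Localization.Away g →+* T)
    (D : Localization.Away g → T) (hD : ∀ a b, D (a * b) = φ a * D b + φ b * D a)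
    (h : ∀ s, D (algebraMap (MvPolynomial (Fin n) k) _ s) = 0) (a : Localization.Away g) :
    D a = 0 := by
  obtain ⟨⟨s, y⟩, hy⟩ := IsLocalization.surj (Submonoid.powers g) a
  have h1 := hD a (algebraMap _ _ (y : MvPolynomial (Fin n) k))
  rw [hy, h, h, mul_zero, zero_add] at h1
  exact (((IsLocalization.map_units (Localization.Away g) y).map φ).mul_right_eq_zero).1 h1.symm

theorem pderiv_comm (i j : Fin n) (s : MvPolynomial (Fin n) k) :
    MvPolynomial.pderiv i (MvPolynomial.pderiv j s) =
      MvPolynomial.pderiv j (MvPolynomial.pderiv i s) := by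
  induction s using MvPolynomial.induction_on with
  | C a => simp
  | add p q hp hq => simp only [map_add, hp, hq]
  | mul_X p l hp =>
    have hX : ∀ a b : Fin n, MvPolynomial.pderiv a (MvPolynomial.pderiv b
        (MvPolynomial.X l : MvPolynomial (Fin n) k)) = 0 := by
      intro a b
      by_cases h : l = b
      · subst h
        simp
      · simp [MvPolynomial.pderiv_X_of_ne h]
    simp only [Derivation.leibniz, map_add, smul_eq_mul, hp, hX]
    ring

theorem locDeriv_comm (i j : Fin n) (a : Localization.Away g) :
    locDeriv g i (locDeriv g j a) = locDeriv g j (locDeriv g i a) := by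
  rw [← sub_eq_zero]
  refine eq_zero_of_leibniz g (RingHom.id _)
    (fun a => locDeriv g i (locDeriv g j a) - locDeriv g j (locDeriv g i a)) ?_ ?_ a
  · intro a b
    simp only [Derivation.leibniz, map_add, smul_eq_mul, RingHom.id_apply]
    ring
  · intro s
    rw [locDeriv_algebraMap, locDeriv_algebraMap, locDeriv_algebraMap, locDeriv_algebraMap,
      pderiv_comm i j, sub_self]

/-- The Weyl algebra acts on `S_g`: `x_i` by multiplication, `∂_i` by the partial derivative. -/
def weylLocRep : Weyl k n →ₐ[k] Module.End k (Localization.Away g) :=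
  weylLift
    (fun i => Algebra.lmul k (Localization.Away g)
      (algebraMap (MvPolynomial (Fin n) k) _ (MvPolynomial.X i)))
    (fun i => (locDeriv g i : Localization.Away g →ₗ[k] Localization.Away g))
    (fun i j => by rw [← map_mul, mul_comm, map_mul])
    (fun i j => by
      ext a
      exact locDeriv_comm g i j a)
    (fun i j => by
      refine LinearMap.ext fun a => ?_
      simp only [Module.End.mul_apply, LinearMap.add_apply, Algebra.coe_lmul_eq_mul,
        LinearMap.mul_apply_apply, Derivation.coeFn_coe, Derivation.leibniz, smul_eq_mul,
        locDeriv_algebraMap, MvPolynomial.pderiv_X]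
      split_ifs with h
      · subst h
        simp
      · simp [Ne.symm h])

instance : Module (Weyl k n) (Localization.Away g) :=
  Module.compHom (Localization.Away g) (weylLocRep g).toRingHom

theorem weyl_smul_def (P : Weyl k n) (a : Localization.Away g) : P • a = weylLocRep g P a := rfl

instance : IsScalarTower k (Weyl k n) (Localization.Away g) :=
  ⟨fun r P a => by simp [weyl_smul_def]⟩

theorem weylGen_inl_smul (i : Fin n) (a : Localization.Away g) :
    weylGen k n (Sum.inl i) • a =
      algebraMap (MvPolynomial (Fin n) k) _ (MvPolynomial.X i) * a := by
  rw [weyl_smul_def, weylLocRep, weylLift_gen]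
  rfl

theorem weylGen_inr_smul (i : Fin n) (a : Localization.Away g) :
    weylGen k n (Sum.inr i) • a = locDeriv g i a := by
  rw [weyl_smul_def, weylLocRep, weylLift_gen]
  rfl

variable {g} {h : MvPolynomial (Fin n) k}

theorem isUnit_of_dvd (hgh : g ∣ h) :
    IsUnit (algebraMap (MvPolynomial (Fin n) k) (Localization.Away h) g) :=
  isUnit_of_dvd_unit (map_dvd _ hgh) (IsLocalization.Away.algebraMap_isUnit h)

/-- The canonical map `S_g → S_h` of localizations, for `g ∣ h`. -/
def locRes (hgh : g ∣ h) : Localization.Away g →+* Localization.Away h :=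
  IsLocalization.Away.lift g (isUnit_of_dvd hgh)

theorem locRes_algebraMap (hgh : g ∣ h) (s : MvPolynomial (Fin n) k) :
    locRes hgh (algebraMap _ _ s) = algebraMap _ _ s := IsLocalization.Away.lift_eq g _ s

theorem locRes_locDeriv (hgh : g ∣ h) (i : Fin n) (a : Localization.Away g) :
    locRes hgh (locDeriv g i a) = locDeriv h i (locRes hgh a) := by
  rw [← sub_eq_zero]
  refine eq_zero_of_leibniz g (locRes hgh)
    (fun a => locRes hgh (locDeriv g i a) - locDeriv h i (locRes hgh a)) ?_ ?_ a
  · intro a b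
    simp only [Derivation.leibniz, map_add, map_mul, smul_eq_mul]
    ring
  · intro s
    simp [locDeriv_algebraMap, locRes_algebraMap]

theorem locRes_smul (hgh : g ∣ h) (r : k) (a : Localization.Away g) :
    locRes hgh (r • a) = r • locRes hgh a := by
  rw [← algebraMap_smul (MvPolynomial (Fin n) k) r a,
    ← algebraMap_smul (MvPolynomial (Fin n) k) r (locRes hgh a), Algebra.smul_def,
    Algebra.smul_def, map_mul, locRes_algebraMap]

/-- The canonical map `S_g → S_h` is linear over the Weyl algebra. -/
def locResLinear (hgh : g ∣ h) : Localization.Away g →ₗ[Weyl k n] Localization.Away h where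
  toFun := locRes hgh
  map_add' := map_add _
  map_smul' := by
    refine weyl_map_smul
      (⟨⟨locRes hgh, map_add _⟩, locRes_smul hgh⟩ : Localization.Away g →ₗ[k] Localization.Away h)
      ?_
    rintro (i | i) a
    · simp [weylGen_inl_smul, locRes_algebraMap]
    · simp [weylGen_inr_smul, locRes_locDeriv]

end Localization

/-! ### Local cohomology of the polynomial ring as a module over the Weyl algebra

For an ideal `I = (f_1, …, f_r)` of `S`, the module `H^i_I(S)` with its natural structure of a
module over the Weyl algebra is the cohomology of the Čech complex on `f_1, …, f_r`. -/

section Cech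

variable {k : Type u} [Field k] {n r : ℕ} (f : Fin r → MvPolynomial (Fin n) k)

/-- The direct sum of all terms of the Čech complex; the component at `σ` is the localization
of `S` at the product of the `f_j` with `j ∈ σ`. -/
abbrev CechTotal : Type u :=
  (σ : Finset (Fin r)) → Localization.Away (∏ j ∈ σ, f j)

/-- The term of the Čech complex in degree `p`. -/
def cechTerm (p : ℕ) : Submodule (Weyl k n) (CechTotal f) where
  carrier := {m | ∀ σ, σ.card ≠ p → m σ = 0}
  zero_mem' := fun _ _ => rfl
  add_mem' := fun ha hb σ hσ => by simp [ha σ hσ, hb σ hσ]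
  smul_mem' := fun P a ha σ hσ => by simp [ha σ hσ]

/-- The Čech differential: the component at `τ` of `d m` is the alternating sum over `v ∈ τ` of
the images of the components of `m` at `τ \ {v}`. -/
def cechD : CechTotal f →ₗ[Weyl k n] CechTotal f :=
  LinearMap.pi fun τ => ∑ v ∈ τ, ((-1 : ℤ) ^ (τ.filter (· < v)).card) •
    (locResLinear (Finset.prod_dvd_prod_of_subset (τ.erase v) τ f (τ.erase_subset v))).comp
      (LinearMap.proj (τ.erase v))

/-- The Čech cocycles of degree `i`. -/
def cechCocycles (i : ℕ) : Submodule (Weyl k n) (CechTotal f) :=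
  cechTerm f i ⊓ LinearMap.ker (cechD f)

/-- The Čech coboundaries of degree `i`; there are none but zero for `i = 0`. -/
def cechCoboundaries : ℕ → Submodule (Weyl k n) (CechTotal f)
  | 0 => ⊥
  | i + 1 => (cechTerm f i).map (cechD f)

/-- The local cohomology module `H^i_I(S)` of `S` at the ideal `I = (f_1, …, f_r)`, as a left
module over the Weyl algebra. -/
abbrev LocalCohomology (i : ℕ) : Type u :=
  cechCocycles f i ⧸ (cechCoboundaries f i).submoduleOf (cechCocycles f i)

end Cech

/-! ### Filtrations, associated graded modules and multiplicities -/

section Graded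

variable (k : Type u) [Field k] (n : ℕ) (M : Type v) [AddCommGroup M] [Module k M]
  [Module (Weyl k n) M]

/-- An exhaustive increasing filtration `Γ_0 ⊆ Γ_1 ⊆ …` of a left module over the Weyl algebra by
`k`-subspaces, compatible with the Bernstein filtration: `F_i Γ_j ⊆ Γ_{i+j}`. -/
structure WeylFiltration where
  /-- the subspaces `Γ_j` -/
  part : ℕ → Submodule k M
  mono : Monotone part
  exhaustive : ∀ m, ∃ j, m ∈ part j
  smul_mem : ∀ i j P m, P ∈ bernstein k n i → m ∈ part j → P • m ∈ part (i + j)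

namespace WeylFiltration

variable {k n M} (Γ : WeylFiltration k n M)

/-- `Γ_{j-1}`, where `Γ_{-1} = 0`. -/
def prev : ℕ → Submodule k M
  | 0 => ⊥
  | j + 1 => Γ.part j

/-- The quotient `Γ_j / Γ_{j-1}`. -/
abbrev Piece (j : ℕ) : Type v := Γ.part j ⧸ (Γ.prev j).submoduleOf (Γ.part j)

/-- The associated graded module `gr M = ⨁ Γ_j / Γ_{j-1}`. -/
def Gr : Type v := DirectSum ℕ Γ.Piece

instance : AddCommGroup Γ.Gr := inferInstanceAs (AddCommGroup (DirectSum ℕ Γ.Piece))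

instance : Module k Γ.Gr := inferInstanceAs (Module k (DirectSum ℕ Γ.Piece))

/-- The inclusion of `Γ_j / Γ_{j-1}` into `gr M`. -/
def lof (j : ℕ) : Γ.Piece j →ₗ[k] Γ.Gr := DirectSum.lof k ℕ Γ.Piece j

theorem gen_smul_mem (s : Fin n ⊕ Fin n) (j : ℕ) {m : M} (hm : m ∈ Γ.part j) :
    weylGen k n s • m ∈ Γ.part (j + 1) := by
  rw [add_comm]
  exact Γ.smul_mem 1 j _ _ (weylGen_mem_bernstein s) hm

theorem gen_smul_mem_prev (s : Fin n ⊕ Fin n) (j : ℕ) {m : M} (hm : m ∈ Γ.prev j) :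
    weylGen k n s • m ∈ Γ.prev (j + 1) := by
  cases j with
  | zero =>
    rw [(Submodule.mem_bot k).1 hm, smul_zero]
    exact Submodule.zero_mem _
  | succ j => exact Γ.gen_smul_mem s j hm

variable [IsScalarTower k (Weyl k n) M]

/-- Multiplication by a generator, from `Γ_j` to `Γ_{j+1}`. -/
def genMap (s : Fin n ⊕ Fin n) (j : ℕ) : Γ.part j →ₗ[k] Γ.part (j + 1) :=
  (Algebra.lsmul k k M (weylGen k n s)).restrict fun _ hm => Γ.gen_smul_mem s j hm

/-- The action of the class of a generator, from `Γ_j / Γ_{j-1}` to `Γ_{j+1} / Γ_j`. -/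
def symbolPiece (s : Fin n ⊕ Fin n) (j : ℕ) : Γ.Piece j →ₗ[k] Γ.Piece (j + 1) :=
  Submodule.mapQ _ _ (Γ.genMap s j) fun _ hm => Γ.gen_smul_mem_prev s j hm

/-- The action of the class of a generator on `gr M`. -/
def symbol (s : Fin n ⊕ Fin n) : Module.End k Γ.Gr :=
  DirectSum.toModule k ℕ Γ.Gr fun j => (Γ.lof (j + 1)).comp (Γ.symbolPiece s j)

theorem symbol_lof (s : Fin n ⊕ Fin n) (j : ℕ) (y : Γ.Piece j) :
    Γ.symbol s (Γ.lof j y) = Γ.lof (j + 1) (Γ.symbolPiece s j y) :=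
  DirectSum.toModule_lof k j y

theorem symbol_comm (s t : Fin n ⊕ Fin n) : Γ.symbol s * Γ.symbol t = Γ.symbol t * Γ.symbol s := by
  refine DirectSum.linearMap_ext k fun j => ?_
  refine LinearMap.ext fun y => ?_
  obtain ⟨m, rfl⟩ := Submodule.Quotient.mk_surjective _ y
  change Γ.symbol s (Γ.symbol t (Γ.lof j _)) = Γ.symbol t (Γ.symbol s (Γ.lof j _))
  rw [symbol_lof, symbol_lof, symbol_lof, symbol_lof]
  congr 1
  refine (Submodule.Quotient.eq _).2 ?_
  change weylGen k n s • weylGen k n t • (m : M) - weylGen k n t • weylGen k n s • (m : M)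
    ∈ Γ.part (j + 1)
  obtain ⟨c, hc⟩ := weylGen_commutator (k := k) s t
  rw [← mul_smul, ← mul_smul, hc, add_smul, add_sub_cancel_left, algebraMap_smul]
  exact Submodule.smul_mem _ c (Γ.mono (Nat.le_succ j) m.2)

/-- The action on `gr M` of the associated graded ring `gr A` of the Weyl algebra `A` for the
Bernstein filtration. This is the polynomial ring in the classes of the `x_i` (`Sum.inl i`) and
of the `∂_i` (`Sum.inr i`), and each of these acts by `symbol`. -/
def symbolHom : MvPolynomial (Fin n ⊕ Fin n) k →ₐ[k] Module.End k Γ.Gr :=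
  have : IsMulCommutative (Algebra.adjoin k (Set.range Γ.symbol)) :=
    Algebra.isMulCommutative_adjoin k (by
      rintro _ ⟨s, rfl⟩ _ ⟨t, rfl⟩
      exact Γ.symbol_comm s t)
  (Algebra.adjoin k (Set.range Γ.symbol)).val.comp
    (MvPolynomial.aeval fun s => ⟨Γ.symbol s, Algebra.subset_adjoin ⟨s, rfl⟩⟩)

theorem symbolHom_X (s : Fin n ⊕ Fin n) : Γ.symbolHom (MvPolynomial.X s) = Γ.symbol s := by
  simp [symbolHom]

instance : Module (MvPolynomial (Fin n ⊕ Fin n) k) Γ.Gr :=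
  Module.compHom Γ.Gr Γ.symbolHom.toRingHom

/-- A filtration is good if `gr M` is finitely generated over `gr A`. -/
def IsGood : Prop := Module.Finite (MvPolynomial (Fin n ⊕ Fin n) k) Γ.Gr

/-- The minimal associated primes of the `gr A`-module `gr M`. -/
def SS : Set (Ideal (MvPolynomial (Fin n ⊕ Fin n) k)) :=
  {Q | Minimal (· ∈ associatedPrimes (MvPolynomial (Fin n ⊕ Fin n) k) Γ.Gr) Q}

/-- The multiplicity of `gr M` at a prime `Q` of `gr A`: the length of the localization of `gr M`
at `Q` over the localization of `gr A` at `Q`. -/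
def multiplicity (Q : Ideal (MvPolynomial (Fin n ⊕ Fin n) k)) [Q.IsPrime] : ℕ∞ :=
  Module.length (Localization.AtPrime Q) (LocalizedModule.AtPrime Q Γ.Gr)

end WeylFiltration

end Graded

/-! ### The monomial primes `Q_F` -/

section Primes

variable (k : Type u) [Field k] {n : ℕ}

/-- The variables that generate `Q_F`: the `x_i` with `i ∉ F` and the `∂_j` with `j ∈ F`. -/
def qVars (F : Finset (Fin n)) : Set (Fin n ⊕ Fin n) :=
  {s | (∃ i, i ∉ F ∧ s = Sum.inl i) ∨ ∃ j, j ∈ F ∧ s = Sum.inr j}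

/-- The ideal `Q_F` of `gr A`, generated by the classes of the `x_i` with `i ∉ F` and of the `∂_j`
with `j ∈ F`. -/
def qIdeal (F : Finset (Fin n)) : Ideal (MvPolynomial (Fin n ⊕ Fin n) k) :=
  Ideal.span (MvPolynomial.X '' qVars F)

open Classical in
instance qIdeal_isPrime (F : Finset (Fin n)) : (qIdeal k F).IsPrime := by
  let φ : MvPolynomial (Fin n ⊕ Fin n) k →ₐ[k] MvPolynomial (Fin n ⊕ Fin n) k :=
    MvPolynomial.aeval fun s => if s ∈ qVars F then 0 else MvPolynomial.X s
  have h1 : ∀ p, p - φ p ∈ qIdeal k F := by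
    intro p
    induction p using MvPolynomial.induction_on with
    | C a => simp [φ]
    | add p q hp hq =>
      rw [map_add, add_sub_add_comm]
      exact Ideal.add_mem _ hp hq
    | mul_X p s hp =>
      have e : p * MvPolynomial.X s - φ (p * MvPolynomial.X s) =
          (p - φ p) * MvPolynomial.X s +
            φ p * (MvPolynomial.X s - φ (MvPolynomial.X s)) := by
        rw [map_mul]
        ring
      rw [e]
      refine Ideal.add_mem _ (Ideal.mul_mem_right _ _ hp) (Ideal.mul_mem_left _ _ ?_)
      by_cases hs : s ∈ qVars F
      · have hX : (MvPolynomial.X s : MvPolynomial (Fin n ⊕ Fin n) k) ∈ qIdeal k F :=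
          Ideal.subset_span (Set.mem_image_of_mem _ hs)
        simpa [φ, hs] using hX
      · simp [φ, hs]
  have h2 : qIdeal k F = RingHom.ker φ := by
    apply le_antisymm
    · rw [qIdeal, Ideal.span_le]
      rintro _ ⟨s, hs, rfl⟩
      simp [φ, hs]
    · intro p hp
      have := h1 p
      rwa [RingHom.mem_ker.1 hp, sub_zero] at this
  rw [h2]
  exact RingHom.ker_isPrime _

end Primes

end CharCycle

end

noncomputable section

set_option linter.unusedSectionVars false

namespace CharCycle

universe u v w

/-! ### Associated graded modules: functoriality -/

namespace WeylFiltration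

section Basic

variable {k : Type u} [Field k] {n : ℕ} {M : Type v} [AddCommGroup M] [Module k M]
  [Module (Weyl k n) M]

/-! The commuting operators x_i ∂_i act diagonalizably, with integer eigenvalues, on every
localization of S at a monomial, hence on local cohomology at a monomial ideal. For such a weight
module only 2^n weights matter: the weights `eps F`, equal to 0 on F and to -1 off F. Indeed x_i or
∂_i moves a nonzero weight vector into the window {-1, 0} in direction i without killing it, so a
nonzero weight module contains, for some F, a nonzero m of weight `eps F` annihilated by all
variables of Q_F (`IsWeight.exists_extremal`). In characteristic 0 the submodule A m is free of rank
one over the polynomials in the n other variables (`wMap_injective`). Filtered by degree it has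
associated graded module gr A / Q_F (`ker_toSpanSingleton_genCls`), and its part of weight `eps G`
is a line if G = F and zero otherwise (`wMap_mem_wt`).

Dividing by A m lowers the sum over G of the dimensions of the weight spaces `eps G` by one.
Multiplicities are additive in short exact sequences and independent of the good filtration
(`IsGood.multiplicity_eq`), so induction on that sum gives finite generation and the formula: the
multiplicity at Q is the sum over F of dim M_{eps F} times the length of (gr A / Q_F)_Q
(`weight_multiplicity_aux`). The Q_F are pairwise incomparable, so at Q = Q_F the formula returns
dim M_{eps F}, and no other minimal associated primes can occur.

It remains to compute these weight spaces. Čech cohomology depends only on the ideal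
(`nonempty_localCohomology_of_span_eq`), so the generators may be the monomials x^{G_j}, with G_j
running through all nonfaces. Localized at the product of the x^{G_j} with j ∈ σ, S has weight `eps
F` part spanned by the inverse of the product of the variables off F if the G_j with j ∈ σ cover the
complement of F, and zero otherwise. Taking weight spaces is exact, so the weight space of
cohomology is the cohomology, with constant coefficients, of the family of covering σ
(`cohCoverWtEquiv`).

Covers are exchanged for transversals, the subsets of the complement of F that meet every nonface,
by embedding both families in the independent sets of a bipartite incidence graph; the remaining
independent sets cancel by adding or removing a suitable vertex (`cohCoverEquiv`). The complements
of the transversals within the complement of F are the faces of the link of F, and complementation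
turns the coboundary in degree i into the boundary in degree n - i - |F| - 1 (`homologyDualEquiv`).
-/

theorem prev_le_part (Γ : WeylFiltration k n M) (j : ℕ) : Γ.prev j ≤ Γ.part j := by
  cases j with
  | zero => exact bot_le
  | succ j => exact Γ.mono (Nat.le_succ j)

theorem ext_part {Γ Γ' : WeylFiltration k n M} (h : Γ.part = Γ'.part) : Γ = Γ' := by
  cases Γ
  cases Γ'
  congr

/-- A product of powers of commuting letters is a word in these letters. -/
theorem exists_list_prod_pow (m : ℕ) (g : Fin m → Fin n ⊕ Fin n) (a : Fin m → ℕ) :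
    ∃ l : List (Fin n ⊕ Fin n), l.length = ∑ i, a i ∧
      (List.ofFn fun i => weylGen k n (g i) ^ a i).prod = (l.map (weylGen k n)).prod := by
  induction m with
  | zero => exact ⟨[], by simp⟩
  | succ m ih =>
    obtain ⟨l, hl, h⟩ := ih (fun i => g i.succ) (fun i => a i.succ)
    refine ⟨List.replicate (a 0) (g 0) ++ l, ?_, ?_⟩
    · simp [hl, Fin.sum_univ_succ]
    · rw [List.ofFn_succ, List.prod_cons, h]
      simp

/-- A filtration from subspaces that are compatible with the generators. -/
def ofGen [IsScalarTower k (Weyl k n) M] (part : ℕ → Submodule k M) (mono : Monotone part)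
    (exhaustive : ∀ m, ∃ j, m ∈ part j)
    (hgen : ∀ s j m, m ∈ part j → weylGen k n s • m ∈ part (j + 1)) : WeylFiltration k n M where
  part := part
  mono := mono
  exhaustive := exhaustive
  smul_mem := by
    -- A spanning monomial of the Bernstein filtration is a word in the generators, and each letter
    -- raises the index by one.
    have hword : ∀ (l : List (Fin n ⊕ Fin n)) (j : ℕ) (m : M), m ∈ part j →
        (l.map (weylGen k n)).prod • m ∈ part (l.length + j) := by
      intro l j m hm
      induction l with
      | nil => simpa using hm
      | cons s l ih =>
        rw [List.map_cons, List.prod_cons, mul_smul, List.length_cons, add_right_comm]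
        exact hgen _ _ _ ih
    intro i j P m hP hm
    induction hP using Submodule.span_induction with
    | mem P hP =>
      obtain ⟨a, b, hab, rfl⟩ := hP
      obtain ⟨l, hl, h⟩ := exists_list_prod_pow (k := k) n (fun i => Sum.inl i) a
      obtain ⟨l', hl', h'⟩ := exists_list_prod_pow (k := k) n (fun i => Sum.inr i) b
      rw [h, h', ← List.prod_append, ← List.map_append]
      refine mono ?_ (hword (l ++ l') j m hm)
      rw [List.length_append]
      omega
    | zero => simp
    | add P Q _ _ hP hQ =>
      rw [add_smul]
      exact Submodule.add_mem _ hP hQ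
    | smul c P _ hP =>
      rw [smul_assoc]
      exact Submodule.smul_mem _ c hP

end Basic

section Gr

variable {k : Type u} [Field k] {n : ℕ} {M : Type v} [AddCommGroup M] [Module k M]
  [Module (Weyl k n) M] [IsScalarTower k (Weyl k n) M] (Γ : WeylFiltration k n M)

/-- The class in `gr M` of an element of `Γ_j`. -/
def cls (j : ℕ) : Γ.part j →ₗ[k] Γ.Gr := (Γ.lof j).comp (Submodule.mkQ _)

theorem X_smul (s : Fin n ⊕ Fin n) (y : Γ.Gr) :
    (MvPolynomial.X s : MvPolynomial (Fin n ⊕ Fin n) k) • y = Γ.symbol s y := by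
  change Γ.symbolHom (MvPolynomial.X s) y = _
  rw [symbolHom_X]

theorem C_smul (c : k) (y : Γ.Gr) :
    (MvPolynomial.C c : MvPolynomial (Fin n ⊕ Fin n) k) • y = c • y := by
  change Γ.symbolHom (MvPolynomial.C c) y = _
  rw [← MvPolynomial.algebraMap_eq, AlgHom.commutes]
  rfl

instance : IsScalarTower k (MvPolynomial (Fin n ⊕ Fin n) k) Γ.Gr :=
  IsScalarTower.of_algebraMap_smul fun c y => Γ.C_smul c y

theorem X_smul_cls (s : Fin n ⊕ Fin n) (j : ℕ) (m : Γ.part j) :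
    (MvPolynomial.X s : MvPolynomial (Fin n ⊕ Fin n) k) • Γ.cls j m =
      Γ.cls (j + 1) ⟨weylGen k n s • (m : M), Γ.gen_smul_mem s j m.2⟩ := by
  rw [X_smul]
  exact Γ.symbol_lof s j _

theorem cls_eq_zero_iff (j : ℕ) (m : Γ.part j) : Γ.cls j m = 0 ↔ (m : M) ∈ Γ.prev j := by
  rw [cls, LinearMap.comp_apply]
  have : Function.Injective (Γ.lof j) := DirectSum.of_injective (β := Γ.Piece) j
  rw [map_eq_zero_iff _ this, Submodule.mkQ_apply, Submodule.Quotient.mk_eq_zero]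
  rfl

@[elab_as_elim]
theorem gr_induction {p : Γ.Gr → Prop} (h0 : p 0) (hcls : ∀ j m, p (Γ.cls j m))
    (hadd : ∀ y z, p y → p z → p (y + z)) (y : Γ.Gr) : p y := by
  refine DirectSum.induction_on (motive := p) y h0 ?_ hadd
  intro j z
  obtain ⟨m, rfl⟩ := Submodule.Quotient.mk_surjective _ z
  exact hcls j m

/-- A `k`-subspace that is stable under the variables is a submodule. -/
theorem smul_mem_of_X (P : Submodule k Γ.Gr)
    (hP : ∀ (s : Fin n ⊕ Fin n), ∀ y ∈ P,
      (MvPolynomial.X s : MvPolynomial (Fin n ⊕ Fin n) k) • y ∈ P)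
    (r : MvPolynomial (Fin n ⊕ Fin n) k) (y : Γ.Gr) (hy : y ∈ P) : r • y ∈ P := by
  induction r using MvPolynomial.induction_on generalizing y with
  | C a =>
    rw [C_smul]
    exact P.smul_mem a hy
  | add p q hp hq =>
    rw [add_smul]
    exact P.add_mem (hp y hy) (hq y hy)
  | mul_X p s hp =>
    rw [mul_smul]
    exact hp _ (hP s y hy)

end Gr

section Functor

variable {k : Type u} [Field k] {n : ℕ} {M : Type v} [AddCommGroup M] [Module k M]
  [Module (Weyl k n) M] [IsScalarTower k (Weyl k n) M] {M' : Type w} [AddCommGroup M']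
  [Module k M'] [Module (Weyl k n) M'] [IsScalarTower k (Weyl k n) M']
  (Γ : WeylFiltration k n M) (Γ' : WeylFiltration k n M')
  (φ : M →ₗ[Weyl k n] M') (c : ℕ)

/-- The map `φ` sends `Γ_j` to `Γ'_{j+c}`. -/
def Shifts : Prop := ∀ j, ∀ m ∈ Γ.part j, φ m ∈ Γ'.part (j + c)

variable {Γ Γ' φ c}

theorem Shifts.prev (h : Shifts Γ Γ' φ c) (j : ℕ) (m : M) (hm : m ∈ Γ.prev j) :
    φ m ∈ Γ'.prev (j + c) := by
  cases j with
  | zero =>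
    rw [(Submodule.mem_bot k).1 hm, map_zero]
    exact Submodule.zero_mem _
  | succ j =>
    rw [add_right_comm]
    exact h j m hm

/-- The map induced on `Γ_j / Γ_{j-1}`. -/
def pieceMap (h : Shifts Γ Γ' φ c) (j : ℕ) : Γ.Piece j →ₗ[k] Γ'.Piece (j + c) :=
  Submodule.mapQ _ _ ((φ.restrictScalars k).restrict fun m hm => h j m hm)
    fun m hm => h.prev j m hm

/-- The `k`-linear map induced on associated graded modules. -/
def grMapAux (h : Shifts Γ Γ' φ c) : Γ.Gr →ₗ[k] Γ'.Gr :=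
  DirectSum.toModule k ℕ Γ'.Gr fun j => (Γ'.lof (j + c)).comp (pieceMap h j)

theorem grMapAux_cls (h : Shifts Γ Γ' φ c) (j : ℕ) (m : Γ.part j) :
    grMapAux h (Γ.cls j m) = Γ'.cls (j + c) ⟨φ m, h j m m.2⟩ :=
  DirectSum.toModule_lof k j _

theorem cls_congr (Γ : WeylFiltration k n M) {i j : ℕ} (hij : i = j) {m m' : M}
    (hm : m ∈ Γ.part i) (hm' : m' ∈ Γ.part j) (h : m = m') :
    Γ.cls i ⟨m, hm⟩ = Γ.cls j ⟨m', hm'⟩ := by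
  subst hij
  subst h
  rfl

/-- The map induced on associated graded modules. -/
def grMap (h : Shifts Γ Γ' φ c) : Γ.Gr →ₗ[MvPolynomial (Fin n ⊕ Fin n) k] Γ'.Gr where
  toFun := grMapAux h
  map_add' := map_add _
  map_smul' := by
    intro r y
    rw [RingHom.id_apply]
    induction r using MvPolynomial.induction_on generalizing y with
    | C a => rw [C_smul, C_smul, map_smul]
    | add p q hp hq => rw [add_smul, add_smul, map_add, hp, hq]
    | mul_X p s hp =>
      rw [mul_smul, hp, mul_smul]
      congr 1
      induction y using Γ.gr_induction with
      | h0 => simp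
      | hcls j m =>
        rw [X_smul_cls, grMapAux_cls, grMapAux_cls, X_smul_cls]
        exact cls_congr _ (by omega) _ _ (φ.map_smul _ _)
      | hadd y z hy hz => rw [smul_add, map_add, map_add, smul_add, hy, hz]

theorem grMap_cls (h : Shifts Γ Γ' φ c) (j : ℕ) (m : Γ.part j) :
    grMap h (Γ.cls j m) = Γ'.cls (j + c) ⟨φ m, h j m m.2⟩ := grMapAux_cls h j m

/-- The component of degree `j` of an element of `gr M`. -/
def comp (Γ : WeylFiltration k n M) (j : ℕ) : Γ.Gr →ₗ[k] Γ.Piece j :=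
  DirectSum.component k ℕ Γ.Piece j

theorem comp_lof (Γ : WeylFiltration k n M) (j : ℕ) (z : Γ.Piece j) : Γ.comp j (Γ.lof j z) = z :=
  DirectSum.component.lof_self k j z

theorem comp_lof_of_ne (Γ : WeylFiltration k n M) {i j : ℕ} (h : i ≠ j) (z : Γ.Piece i) :
    Γ.comp j (Γ.lof i z) = 0 := by
  change DirectSum.component k ℕ Γ.Piece j (DirectSum.lof k ℕ Γ.Piece i z) = 0
  rw [DirectSum.component.of, dif_neg h]

theorem gr_ext (Γ : WeylFiltration k n M) {y z : Γ.Gr} (h : ∀ j, Γ.comp j y = Γ.comp j z) :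
    y = z := DirectSum.ext_component k h

theorem comp_grMap (h : Shifts Γ Γ' φ c) (j : ℕ) (y : Γ.Gr) :
    Γ'.comp (j + c) (grMap h y) = pieceMap h j (Γ.comp j y) := by
  induction y using Γ.gr_induction with
  | h0 => simp
  | hcls i m =>
    rw [grMap_cls]
    by_cases hij : i = j
    · subst hij
      rw [cls, cls, LinearMap.comp_apply, LinearMap.comp_apply, comp_lof, comp_lof]
      rfl
    · rw [cls, cls, LinearMap.comp_apply, LinearMap.comp_apply, comp_lof_of_ne _ hij,
        comp_lof_of_ne _ (by omega), map_zero]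
  | hadd y z hy hz => rw [map_add, map_add, hy, hz, map_add, map_add]

theorem mem_of_lof_comp_mem (Γ : WeylFiltration k n M)
    (P : Submodule (MvPolynomial (Fin n ⊕ Fin n) k) Γ.Gr) (y : Γ.Gr)
    (h : ∀ j, Γ.lof j (Γ.comp j y) ∈ P) : y ∈ P := by
  classical
  have : y = ∑ j ∈ DFinsupp.support (β := Γ.Piece) y, Γ.lof j (Γ.comp j y) :=
    (DFinsupp.sum_single (β := Γ.Piece) (f := y)).symm
  rw [this]
  exact Submodule.sum_mem _ fun j _ => h j

variable {M'' : Type*} [AddCommGroup M''] [Module k M''] [Module (Weyl k n) M'']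
  [IsScalarTower k (Weyl k n) M''] {Γ'' : WeylFiltration k n M''} {ψ : M' →ₗ[Weyl k n] M''}
  {c' : ℕ}

theorem pieceMap_mk_eq_zero (h : Shifts Γ Γ' φ c) (j : ℕ) (m : Γ.part j) :
    pieceMap h j (Submodule.Quotient.mk m) = 0 ↔ φ m ∈ Γ'.prev (j + c) :=
  (Submodule.Quotient.mk_eq_zero _)

/-- Injectivity is tested on homogeneous components, where it amounts to strictness of `φ`: a symbol
may die only if it was already zero. -/
theorem grMap_injective (h : Shifts Γ Γ' φ c)
    (H : ∀ j, ∀ m ∈ Γ.part j, φ m ∈ Γ'.prev (j + c) → m ∈ Γ.prev j) :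
    Function.Injective (grMap h) := by
  rw [injective_iff_map_eq_zero]
  intro y hy
  refine Γ.gr_ext fun j => ?_
  have h1 := comp_grMap h j y
  rw [hy, map_zero] at h1
  obtain ⟨m, hm⟩ := Submodule.Quotient.mk_surjective _ (Γ.comp j y)
  rw [← hm, eq_comm, pieceMap_mk_eq_zero] at h1
  rw [← hm, map_zero, Submodule.Quotient.mk_eq_zero]
  exact H j m m.2 h1

/-- Kernels and images of graded maps are graded, so exactness reduces to symbols. The alternative
`m ∈ Γ'.prev j` in `H'` serves the degrees below `c`, which no symbol of `Γ` can reach. -/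
theorem grMap_exact (h : Shifts Γ Γ' φ c) (h' : Shifts Γ' Γ'' ψ c')
    (H : ∀ j, ∀ m ∈ Γ.part j, ψ (φ m) ∈ Γ''.prev (j + c + c'))
    (H' : ∀ j, ∀ m ∈ Γ'.part j, ψ m ∈ Γ''.prev (j + c') →
      m ∈ Γ'.prev j ∨ ∃ i, i + c = j ∧ ∃ m₀ ∈ Γ.part i, m - φ m₀ ∈ Γ'.prev j) :
    Function.Exact (grMap h) (grMap h') := by
  rw [LinearMap.exact_iff]
  refine le_antisymm ?_ ?_
  · intro y hy
    refine Γ'.mem_of_lof_comp_mem _ y fun j => ?_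
    have h1 := comp_grMap h' j y
    rw [LinearMap.mem_ker.1 hy, map_zero] at h1
    obtain ⟨m, hm⟩ := Submodule.Quotient.mk_surjective _ (Γ'.comp j y)
    rw [← hm, eq_comm, pieceMap_mk_eq_zero] at h1
    rw [← hm]
    change Γ'.cls j m ∈ _
    rcases H' j m m.2 h1 with h2 | ⟨i, rfl, m₀, hm₀, h2⟩
    · rw [(Γ'.cls_eq_zero_iff j m).2 h2]
      exact Submodule.zero_mem _
    · refine ⟨Γ.cls i ⟨m₀, hm₀⟩, ?_⟩
      rw [grMap_cls, eq_comm, ← sub_eq_zero, ← map_sub, cls_eq_zero_iff]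
      exact h2
  · rintro _ ⟨y, rfl⟩
    rw [LinearMap.mem_ker]
    induction y using Γ.gr_induction with
    | h0 => simp
    | hcls j m =>
      rw [grMap_cls, grMap_cls, cls_eq_zero_iff]
      exact H j m m.2
    | hadd y z hy hz => rw [map_add, map_add, hy, hz, add_zero]

theorem grMap_surjective (h : Shifts Γ Γ' φ c)
    (H : ∀ j, ∀ m ∈ Γ'.part j,
      m ∈ Γ'.prev j ∨ ∃ i, i + c = j ∧ ∃ m₀ ∈ Γ.part i, m - φ m₀ ∈ Γ'.prev j) :
    Function.Surjective (grMap h) := by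
  rw [← LinearMap.range_eq_top, eq_top_iff]
  intro y _
  refine Γ'.mem_of_lof_comp_mem _ y fun j => ?_
  obtain ⟨m, hm⟩ := Submodule.Quotient.mk_surjective _ (Γ'.comp j y)
  rw [← hm]
  change Γ'.cls j m ∈ _
  rcases H j m m.2 with h2 | ⟨i, rfl, m₀, hm₀, h2⟩
  · rw [(Γ'.cls_eq_zero_iff j m).2 h2]
    exact Submodule.zero_mem _
  · refine ⟨Γ.cls i ⟨m₀, hm₀⟩, ?_⟩
    rw [grMap_cls, eq_comm, ← sub_eq_zero, ← map_sub, cls_eq_zero_iff]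
    exact h2

end Functor

end WeylFiltration

end CharCycle

namespace CharCycle

universe u v w

/-! ### Lengths of localizations -/

section Length

/-- Each length is that of a kernel plus that of an image, and the two exactness conditions
interchange kernels and images. No finiteness is needed. -/
theorem length_eq_of_exact_exact {R : Type*} [Ring R] {X Y : Type*} [AddCommGroup X] [Module R X]
    [AddCommGroup Y] [Module R Y] (f : X →ₗ[R] Y) (g : Y →ₗ[R] X) (hfg : Function.Exact f g)
    (hgf : Function.Exact g f) : Module.length R X = Module.length R Y := by
  have h1 := Module.length_eq_add_of_exact (LinearMap.ker f).subtype f.rangeRestrict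
    (Submodule.subtype_injective _) f.surjective_rangeRestrict
    (by
      rw [LinearMap.exact_iff]
      simp)
  have h2 := Module.length_eq_add_of_exact (LinearMap.ker g).subtype g.rangeRestrict
    (Submodule.subtype_injective _) g.surjective_rangeRestrict
    (by
      rw [LinearMap.exact_iff]
      simp)
  rw [h1, h2, LinearMap.exact_iff.1 hfg, LinearMap.exact_iff.1 hgf, add_comm]

variable {R : Type*} [CommRing R] (Q : Ideal R) [Q.IsPrime]

theorem length_localized_eq_of_exact_exact {X Y : Type*} [AddCommGroup X] [Module R X]
    [AddCommGroup Y] [Module R Y] (f : X →ₗ[R] Y) (g : Y →ₗ[R] X) (hfg : Function.Exact f g)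
    (hgf : Function.Exact g f) :
    Module.length (Localization.AtPrime Q) (LocalizedModule.AtPrime Q X) =
      Module.length (Localization.AtPrime Q) (LocalizedModule.AtPrime Q Y) :=
  length_eq_of_exact_exact (LocalizedModule.map Q.primeCompl f) (LocalizedModule.map Q.primeCompl g)
    (LocalizedModule.map_exact _ f g hfg) (LocalizedModule.map_exact _ g f hgf)

theorem length_localized_of_exact {X Y Z : Type*} [AddCommGroup X] [Module R X]
    [AddCommGroup Y] [Module R Y] [AddCommGroup Z] [Module R Z] (f : X →ₗ[R] Y) (g : Y →ₗ[R] Z)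
    (hf : Function.Injective f) (hfg : Function.Exact f g) (hg : Function.Surjective g) :
    Module.length (Localization.AtPrime Q) (LocalizedModule.AtPrime Q Y) =
      Module.length (Localization.AtPrime Q) (LocalizedModule.AtPrime Q X) +
      Module.length (Localization.AtPrime Q) (LocalizedModule.AtPrime Q Z) :=
  Module.length_eq_add_of_exact (LocalizedModule.map Q.primeCompl f)
    (LocalizedModule.map Q.primeCompl g) (LocalizedModule.map_injective _ f hf)
    (LocalizedModule.map_surjective _ g hg) (LocalizedModule.map_exact _ f g hfg)

theorem length_localized_congr {X Y : Type*} [AddCommGroup X] [Module R X]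
    [AddCommGroup Y] [Module R Y] (e : X ≃ₗ[R] Y) :
    Module.length (Localization.AtPrime Q) (LocalizedModule.AtPrime Q X) =
      Module.length (Localization.AtPrime Q) (LocalizedModule.AtPrime Q Y) := by
  have h := length_localized_of_exact (Z := PUnit) Q e.toLinearMap 0 e.injective
    (by
      rw [LinearMap.exact_iff]
      simp) (fun _ => ⟨0, Subsingleton.elim _ _⟩)
  rw [h, eq_comm]
  convert add_zero _
  exact Module.length_eq_zero_iff.2 inferInstance

theorem length_localized_ne_zero_iff {X : Type*} [AddCommGroup X] [Module R X] :
    Module.length (Localization.AtPrime Q) (LocalizedModule.AtPrime Q X) ≠ 0 ↔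
      (⟨Q, inferInstance⟩ : PrimeSpectrum R) ∈ Module.support R X := by
  rw [Ne, Module.length_eq_zero_iff, Module.mem_support_iff, not_subsingleton_iff_nontrivial]

theorem length_localized_quotient_ne_zero_iff (I : Ideal R) :
    Module.length (Localization.AtPrime Q) (LocalizedModule.AtPrime Q (R ⧸ I)) ≠ 0 ↔ I ≤ Q := by
  rw [length_localized_ne_zero_iff, Module.support_of_algebra, PrimeSpectrum.mem_zeroLocus,
    Ideal.Quotient.algebraMap_eq, Ideal.mk_ker]
  rfl

/-- The localization is the residue field of Q: a nonzero fraction a/s is carried to any b/t by the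
scalar (b s)/(a t). -/
theorem length_localized_quotient_self :
    Module.length (Localization.AtPrime Q) (LocalizedModule.AtPrime Q (R ⧸ Q)) = 1 := by
  rw [Module.length_eq_one_iff, isSimpleModule_iff_toSpanSingleton_surjective]
  refine ⟨?_, ?_⟩
  · have h := (length_localized_quotient_ne_zero_iff Q Q).2 le_rfl
    rwa [Ne, Module.length_eq_zero_iff, not_subsingleton_iff_nontrivial] at h
  · intro y hy z
    induction y using LocalizedModule.induction_on with
    | h a s =>
    induction z using LocalizedModule.induction_on with
    | h b t =>
    obtain ⟨a, rfl⟩ := Ideal.Quotient.mk_surjective a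
    obtain ⟨b, rfl⟩ := Ideal.Quotient.mk_surjective b
    have ha : a ∉ Q := by
      intro h
      apply hy
      rw [Ideal.Quotient.eq_zero_iff_mem.2 h, LocalizedModule.zero_mk]
    refine ⟨Localization.mk (b * s) (⟨a, ha⟩ * t), ?_⟩
    rw [LinearMap.toSpanSingleton_apply, LocalizedModule.mk_smul_mk, LocalizedModule.mk_eq]
    refine ⟨1, ?_⟩
    simp only [Submonoid.smul_def, one_smul, Submonoid.coe_mul, ← map_mul,
      Algebra.smul_def, Ideal.Quotient.algebraMap_eq]
    congr 1
    ring

end Length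

namespace WeylFiltration

/-! ### Comparison of good filtrations -/

section Compare

variable {k : Type u} [Field k] {n : ℕ} {M : Type v} [AddCommGroup M] [Module k M]
  [Module (Weyl k n) M] [IsScalarTower k (Weyl k n) M]

/-- The inclusions induce gr Γ → gr Γ' and, in degree one, gr Γ' → gr Γ. Their images are made of
the quotients Γ_j / Γ'_{j-1} and Γ'_j / Γ_j, and the kernel of each map is the image of the other.
-/
theorem multiplicity_eq_of_neighbor {Γ Γ' : WeylFiltration k n M}
    (h1 : ∀ j, Γ.part j ≤ Γ'.part j) (h2 : ∀ j, Γ'.part j ≤ Γ.part (j + 1))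
    (Q : Ideal (MvPolynomial (Fin n ⊕ Fin n) k)) [Q.IsPrime] :
    Γ.multiplicity Q = Γ'.multiplicity Q := by
  have a : Shifts Γ Γ' LinearMap.id 0 := fun j m hm => h1 j hm
  have b : Shifts Γ' Γ LinearMap.id 1 := fun j m hm => h2 j hm
  refine length_localized_eq_of_exact_exact Q (grMap a) (grMap b) ?_ ?_
  · refine grMap_exact a b (fun j m hm => hm) fun j m hm hm' => Or.inr ⟨j, rfl, m, hm', ?_⟩
    simp
  · refine grMap_exact b a (fun j m hm => hm) fun j m hm hm' => ?_
    cases j with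
    | zero => exact Or.inl hm'
    | succ j => exact Or.inr ⟨j, rfl, m, hm', by simp⟩

/-- The filtration `Γ_{j+c}`. -/
def shift (Γ : WeylFiltration k n M) (c : ℕ) : WeylFiltration k n M where
  part j := Γ.part (j + c)
  mono i j h := Γ.mono (Nat.add_le_add_right h c)
  exhaustive m := by
    obtain ⟨j, hj⟩ := Γ.exhaustive m
    exact ⟨j, Γ.mono (Nat.le_add_right j c) hj⟩
  smul_mem i j P m hP hm := by
    rw [add_assoc]
    exact Γ.smul_mem i (j + c) P m hP hm

theorem multiplicity_shift (Γ : WeylFiltration k n M) (c : ℕ)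
    (Q : Ideal (MvPolynomial (Fin n ⊕ Fin n) k)) [Q.IsPrime] :
    (Γ.shift c).multiplicity Q = Γ.multiplicity Q := by
  induction c with
  | zero => rfl
  | succ c ih =>
    rw [← ih, eq_comm]
    refine multiplicity_eq_of_neighbor (Γ := Γ.shift c) (Γ' := Γ.shift (c + 1))
      (fun j => Γ.mono (by omega)) (fun j => ?_) Q
    exact (Γ.mono (by omega) : Γ.part (j + (c + 1)) ≤ Γ.part (j + 1 + c))

/-- The intersection of two filtrations. -/
def inf (Γ Γ' : WeylFiltration k n M) : WeylFiltration k n M where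
  part j := Γ.part j ⊓ Γ'.part j
  mono i j h := inf_le_inf (Γ.mono h) (Γ'.mono h)
  exhaustive m := by
    obtain ⟨i, hi⟩ := Γ.exhaustive m
    obtain ⟨j, hj⟩ := Γ'.exhaustive m
    exact ⟨max i j, Γ.mono (le_max_left i j) hi, Γ'.mono (le_max_right i j) hj⟩
  smul_mem i j P m hP hm := ⟨Γ.smul_mem i j P m hP hm.1, Γ'.smul_mem i j P m hP hm.2⟩

/-- Interpolation by Γ'_j ∩ Γ_{j+1}: this filtration is a neighbour of Γ, and its distance to Γ' is
one less. -/
theorem multiplicity_eq_of_le_shift (e : ℕ) {Γ Γ' : WeylFiltration k n M}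
    (h1 : ∀ j, Γ.part j ≤ Γ'.part j) (h2 : ∀ j, Γ'.part j ≤ Γ.part (j + e))
    (Q : Ideal (MvPolynomial (Fin n ⊕ Fin n) k)) [Q.IsPrime] :
    Γ.multiplicity Q = Γ'.multiplicity Q := by
  induction e generalizing Γ with
  | zero =>
    rw [ext_part (funext fun j => le_antisymm (h1 j) (h2 j))]
  | succ e ih =>
    have h : Γ.multiplicity Q = (Γ'.inf (Γ.shift 1)).multiplicity Q :=
      multiplicity_eq_of_neighbor (fun j => le_inf (h1 j) (Γ.mono (Nat.le_succ j)))
        (fun j => inf_le_right) Q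
    rw [h]
    refine ih (fun j => inf_le_left) fun j => le_inf (Γ'.mono (Nat.le_add_right j e)) ?_
    exact (h2 j).trans (Γ.mono (by omega))

variable (Γ Γ' : WeylFiltration k n M)

/-- The part of `gr M` that comes from the intersections of `Γ_j` with `Γ'_{j+c}`. -/
def interPart (c : ℕ) : Submodule k Γ.Gr :=
  ⨅ j, ((((Γ'.part (j + c)).submoduleOf (Γ.part j)).map (Submodule.mkQ _)).comap (Γ.comp j))

theorem mem_interPart {c : ℕ} {y : Γ.Gr} : y ∈ interPart Γ Γ' c ↔
    ∀ j, ∃ m : Γ.part j, (m : M) ∈ Γ'.part (j + c) ∧ Submodule.Quotient.mk m = Γ.comp j y := by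
  simp only [interPart, Submodule.mem_iInf, Submodule.mem_comap, Submodule.mem_map]
  rfl

theorem comp_symbol_succ (s : Fin n ⊕ Fin n) (j : ℕ) (y : Γ.Gr) :
    Γ.comp (j + 1) (Γ.symbol s y) = Γ.symbolPiece s j (Γ.comp j y) := by
  induction y using Γ.gr_induction with
  | h0 => simp
  | hcls i m =>
    rw [cls, LinearMap.comp_apply, symbol_lof]
    by_cases hij : i = j
    · subst hij
      rw [comp_lof, comp_lof]
    · rw [comp_lof_of_ne _ hij, comp_lof_of_ne _ (by omega), map_zero]
  | hadd y z hy hz => simp only [map_add, hy, hz]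

theorem comp_symbol_zero (s : Fin n ⊕ Fin n) (y : Γ.Gr) : Γ.comp 0 (Γ.symbol s y) = 0 := by
  induction y using Γ.gr_induction with
  | h0 => simp
  | hcls i m =>
    rw [cls, LinearMap.comp_apply, symbol_lof, comp_lof_of_ne _ (by omega)]
  | hadd y z hy hz => simp only [map_add, hy, hz, add_zero]

theorem interPart_stable (c : ℕ) (s : Fin n ⊕ Fin n) (y : Γ.Gr) (hy : y ∈ interPart Γ Γ' c) :
    (MvPolynomial.X s : MvPolynomial (Fin n ⊕ Fin n) k) • y ∈ interPart Γ Γ' c := by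
  rw [mem_interPart] at hy ⊢
  intro j
  rw [X_smul]
  cases j with
  | zero => exact ⟨0, Submodule.zero_mem _, by rw [comp_symbol_zero]; rfl⟩
  | succ j =>
    obtain ⟨m, hm, h⟩ := hy j
    refine ⟨Γ.genMap s j m, ?_, ?_⟩
    · rw [add_right_comm]
      exact Γ'.gen_smul_mem s _ hm
    · rw [comp_symbol_succ, ← h]
      rfl

theorem interPart_mono {c d : ℕ} (h : c ≤ d) : interPart Γ Γ' c ≤ interPart Γ Γ' d := by
  intro y hy
  rw [mem_interPart] at hy ⊢
  intro j
  obtain ⟨m, hm, h'⟩ := hy j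
  exact ⟨m, Γ'.mono (by omega) hm, h'⟩

theorem exists_mem_interPart (y : Γ.Gr) : ∃ c, y ∈ interPart Γ Γ' c := by
  induction y using Γ.gr_induction with
  | h0 => exact ⟨0, Submodule.zero_mem _⟩
  | hcls i m =>
    obtain ⟨c, hc⟩ := Γ'.exhaustive (m : M)
    refine ⟨c, (mem_interPart Γ Γ').2 fun j => ?_⟩
    rw [cls, LinearMap.comp_apply]
    by_cases hij : i = j
    · subst hij
      rw [comp_lof]
      exact ⟨m, Γ'.mono (by omega) hc, rfl⟩
    · rw [comp_lof_of_ne _ hij]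
      exact ⟨0, Submodule.zero_mem _, rfl⟩
  | hadd y z hy hz =>
    obtain ⟨c, hc⟩ := hy
    obtain ⟨d, hd⟩ := hz
    exact ⟨max c d, Submodule.add_mem _ (interPart_mono Γ Γ' (le_max_left c d) hc)
      (interPart_mono Γ Γ' (le_max_right c d) hd)⟩

/-- A good filtration is contained in a shift of any other filtration. -/
theorem IsGood.exists_le_shift {Γ : WeylFiltration k n M} (h : Γ.IsGood)
    (Γ' : WeylFiltration k n M) : ∃ c, ∀ j, Γ.part j ≤ Γ'.part (j + c) := by
  obtain ⟨S, hS⟩ := h.fg_top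
  choose c hc using exists_mem_interPart Γ Γ'
  let d := S.sup c
  -- Finitely many generators of gr M lie in one `interPart`, which is a submodule and therefore
  -- everything.
  have hd : ∀ y, y ∈ interPart Γ Γ' d := by
    intro y
    have hy : y ∈ Submodule.span (MvPolynomial (Fin n ⊕ Fin n) k) (S : Set Γ.Gr) := by
      rw [hS]
      trivial
    induction hy using Submodule.span_induction with
    | mem y hy => exact interPart_mono Γ Γ' (Finset.le_sup (f := c) hy) (hc y)
    | zero => exact Submodule.zero_mem _
    | add y z _ _ hy hz => exact Submodule.add_mem _ hy hz
    | smul r y _ hy => exact Γ.smul_mem_of_X _ (interPart_stable Γ Γ' d) r y hy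
  refine ⟨d, fun j => ?_⟩
  -- Now every symbol in degree j has a representative in Γ'_{j+d}. It differs from the given
  -- element by an element of Γ_{j-1}, which is covered by the induction hypothesis.
  induction j with
  | zero =>
    intro m hm
    obtain ⟨m', hm', h'⟩ := (mem_interPart Γ Γ').1 (hd (Γ.cls 0 ⟨m, hm⟩)) 0
    rw [cls, LinearMap.comp_apply, comp_lof] at h'
    have h2 : (m' : M) - m ∈ Γ.prev 0 :=
      (Submodule.Quotient.eq ((Γ.prev 0).submoduleOf (Γ.part 0))).1 h'
    rwa [← sub_eq_zero.1 ((Submodule.mem_bot k).1 h2)]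
  | succ j ih =>
    intro m hm
    obtain ⟨m', hm', h'⟩ := (mem_interPart Γ Γ').1 (hd (Γ.cls (j + 1) ⟨m, hm⟩)) (j + 1)
    rw [cls, LinearMap.comp_apply, comp_lof] at h'
    have h2 : (m' : M) - m ∈ Γ.prev (j + 1) :=
      (Submodule.Quotient.eq ((Γ.prev (j + 1)).submoduleOf (Γ.part (j + 1)))).1 h'
    have h3 : (m' : M) - m ∈ Γ'.part (j + 1 + d) := Γ'.mono (by omega) (ih h2)
    simpa using Submodule.sub_mem _ hm' h3

/-- Multiplicities do not depend on the good filtration. -/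
theorem IsGood.multiplicity_eq {Γ Γ' : WeylFiltration k n M} (h : Γ.IsGood) (h' : Γ'.IsGood)
    (Q : Ideal (MvPolynomial (Fin n ⊕ Fin n) k)) [Q.IsPrime] :
    Γ.multiplicity Q = Γ'.multiplicity Q := by
  obtain ⟨c, hc⟩ := h.exists_le_shift Γ'
  obtain ⟨d, hd⟩ := h'.exists_le_shift Γ
  -- Shifting Γ' by `c` turns mutual inclusion up to shifts into a chain starting with an honest
  -- inclusion.
  rw [← Γ'.multiplicity_shift c Q]
  refine multiplicity_eq_of_le_shift (c + d) hc (fun j => ?_) Q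
  rw [← add_assoc]
  exact hd (j + c)

end Compare

/-! ### Induced filtrations and additivity of multiplicities -/

section SubQuot

variable {k : Type u} [Field k] {n : ℕ} {M : Type v} [AddCommGroup M] [Module k M]
  [Module (Weyl k n) M] [IsScalarTower k (Weyl k n) M] (Γ : WeylFiltration k n M)
  (N : Submodule (Weyl k n) M)

/-- The filtration induced on a submodule. -/
def sub : WeylFiltration k n N where
  part j := (Γ.part j).comap (N.subtype.restrictScalars k)
  mono _ _ h := Submodule.comap_mono (Γ.mono h)
  exhaustive m := Γ.exhaustive (m : M)
  smul_mem i j P m hP hm := Γ.smul_mem i j P m hP hm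

/-- The filtration induced on a quotient. -/
def quot : WeylFiltration k n (M ⧸ N) where
  part j := (Γ.part j).map (N.mkQ.restrictScalars k)
  mono _ _ h := Submodule.map_mono (Γ.mono h)
  exhaustive m := by
    obtain ⟨m, rfl⟩ := N.mkQ_surjective m
    obtain ⟨j, hj⟩ := Γ.exhaustive m
    exact ⟨j, m, hj, rfl⟩
  smul_mem i j P m hP hm := by
    obtain ⟨m, hm, rfl⟩ := hm
    exact ⟨P • m, Γ.smul_mem i j P m hP hm, by simp⟩

theorem shifts_sub : Shifts (Γ.sub N) Γ N.subtype 0 := fun _ _ hm => hm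

theorem shifts_quot : Shifts Γ (Γ.quot N) N.mkQ 0 := fun _ m hm => ⟨m, hm, rfl⟩

theorem mem_sub_prev {j : ℕ} {m : N} : m ∈ (Γ.sub N).prev j ↔ (m : M) ∈ Γ.prev j := by
  cases j with
  | zero =>
    change m ∈ (⊥ : Submodule k N) ↔ (m : M) ∈ (⊥ : Submodule k M)
    simp
  | succ j => rfl

theorem mem_quot_prev {j : ℕ} {m : M ⧸ N} :
    m ∈ (Γ.quot N).prev j ↔ ∃ m₀ ∈ Γ.prev j, N.mkQ m₀ = m := by
  cases j with
  | zero =>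
    change m ∈ (⊥ : Submodule k (M ⧸ N)) ↔ ∃ m₀ ∈ (⊥ : Submodule k M), _
    simp [eq_comm]
  | succ j => rfl

theorem grMap_sub_injective : Function.Injective (grMap (Γ.shifts_sub N)) :=
  grMap_injective _ fun _ _ _ h => (Γ.mem_sub_prev N).2 h

theorem grMap_quot_surjective : Function.Surjective (grMap (Γ.shifts_quot N)) := by
  refine grMap_surjective _ ?_
  rintro j _ ⟨m, hm, rfl⟩
  refine Or.inr ⟨j, rfl, m, hm, ?_⟩
  rw [LinearMap.restrictScalars_apply, sub_self]
  exact Submodule.zero_mem _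

/-- If the symbol of m dies in the quotient, then m is congruent modulo N to some m₀ one step lower,
so m - m₀ lies in N and has the same symbol as m. -/
theorem grMap_sub_quot_exact :
    Function.Exact (grMap (Γ.shifts_sub N)) (grMap (Γ.shifts_quot N)) := by
  refine grMap_exact _ _ (fun j m _ => ?_) fun j m hm h => ?_
  · have : N.mkQ (N.subtype m) = 0 := by simp
    rw [this]
    exact Submodule.zero_mem _
  · obtain ⟨m₀, hm₀, h⟩ := (Γ.mem_quot_prev N).1 h
    have hN : m - m₀ ∈ N := (Submodule.Quotient.eq N).1 h.symm
    refine Or.inr ⟨j, rfl, ⟨m - m₀, hN⟩, ?_, ?_⟩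
    · exact Submodule.sub_mem _ hm (Γ.prev_le_part j hm₀)
    · simpa using hm₀

variable {Γ}

theorem IsGood.sub (h : Γ.IsGood) : (Γ.sub N).IsGood := by
  have : Module.Finite (MvPolynomial (Fin n ⊕ Fin n) k) Γ.Gr := h
  exact Module.Finite.of_injective _ (Γ.grMap_sub_injective N)

theorem IsGood.quot (h : Γ.IsGood) : (Γ.quot N).IsGood := by
  have : Module.Finite (MvPolynomial (Fin n ⊕ Fin n) k) Γ.Gr := h
  exact Module.Finite.of_surjective _ (Γ.grMap_quot_surjective N)

theorem multiplicity_eq_add (Γ : WeylFiltration k n M)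
    (Q : Ideal (MvPolynomial (Fin n ⊕ Fin n) k)) [Q.IsPrime] :
    Γ.multiplicity Q = (Γ.sub N).multiplicity Q + (Γ.quot N).multiplicity Q :=
  length_localized_of_exact Q _ _ (Γ.grMap_sub_injective N) (Γ.grMap_sub_quot_exact N)
    (Γ.grMap_quot_surjective N)

end SubQuot

/-! ### Existence of good filtrations -/

section Exists

variable {k : Type u} [Field k] {n : ℕ} {M : Type v} [AddCommGroup M] [Module k M]
  [Module (Weyl k n) M] [IsScalarTower k (Weyl k n) M]

/-- The subspaces generated in steps by the generators of the Weyl algebra from a subspace. -/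
def genPart (P : Submodule k M) : ℕ → Submodule k M
  | 0 => P
  | j + 1 => genPart P j ⊔ ⨆ s : Fin n ⊕ Fin n,
      (genPart P j).map (Algebra.lsmul k k M (weylGen k n s))

theorem genPart_mono (P : Submodule k M) : Monotone (genPart (n := n) P) :=
  monotone_nat_of_le_succ fun _ => le_sup_left

theorem gen_smul_mem_genPart (P : Submodule k M) (s : Fin n ⊕ Fin n) (j : ℕ) (m : M)
    (hm : m ∈ genPart (n := n) P j) : weylGen k n s • m ∈ genPart (n := n) P (j + 1) :=
  (le_sup_right : _ ≤ genPart (n := n) P (j + 1))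
    (Submodule.mem_iSup_of_mem s ⟨m, hm, rfl⟩)

/-- A subspace stable under the generators is stable under the Weyl algebra. -/
theorem smul_mem_of_gen (P : Submodule k M)
    (hP : ∀ (s : Fin n ⊕ Fin n), ∀ m ∈ P, weylGen k n s • m ∈ P) (a : Weyl k n) (m : M)
    (hm : m ∈ P) : a • m ∈ P := by
  obtain ⟨p, rfl⟩ := weylMk_surjective a
  induction p using FreeAlgebra.induction generalizing m with
  | grade0 r =>
    rw [AlgHom.commutes, algebraMap_smul]
    exact P.smul_mem r hm
  | grade1 s => exact hP s m hm
  | mul a b ha hb =>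
    rw [map_mul, mul_smul]
    exact ha _ (hb m hm)
  | add a b ha hb =>
    rw [map_add, add_smul]
    exact P.add_mem (ha m hm) (hb m hm)

theorem exists_mem_genPart (P : Submodule k M)
    (hP : Submodule.span (Weyl k n) (P : Set M) = ⊤) (m : M) : ∃ j, m ∈ genPart (n := n) P j := by
  let N : Submodule k M := ⨆ j, genPart (n := n) P j
  have hN : ∀ m, m ∈ N ↔ ∃ j, m ∈ genPart (n := n) P j := fun m =>
    Submodule.mem_iSup_of_directed _ (genPart_mono P).directed_le
  rw [← hN]
  have hm : m ∈ Submodule.span (Weyl k n) (P : Set M) := by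
    rw [hP]
    trivial
  induction hm using Submodule.span_induction with
  | mem m hm => exact (hN m).2 ⟨0, hm⟩
  | zero => exact N.zero_mem
  | add a b _ _ ha hb => exact N.add_mem ha hb
  | smul a m _ hm =>
    refine smul_mem_of_gen N (fun s m hm => ?_) a m hm
    obtain ⟨j, hj⟩ := (hN m).1 hm
    exact (hN _).2 ⟨j + 1, gen_smul_mem_genPart P s j m hj⟩

/-- Γ_0 is the span of a finite generating set and Γ_{j+1} is Γ_j together with its images under the
generators of A. Each symbol in degree j + 1 is thus a combination of variables times symbols in
degree j, and the symbols of the generating set generate gr M. -/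
theorem exists_isGood [Module.Finite (Weyl k n) M] : ∃ Γ : WeylFiltration k n M, Γ.IsGood := by
  obtain ⟨S, hS⟩ := Module.Finite.fg_top (R := Weyl k n) (M := M)
  let P : Submodule k M := Submodule.span k (S : Set M)
  have hP : Submodule.span (Weyl k n) (P : Set M) = ⊤ := by
    rw [eq_top_iff, ← hS]
    exact Submodule.span_mono Submodule.subset_span
  let Γ : WeylFiltration k n M := ofGen (genPart (n := n) P) (genPart_mono P)
    (exists_mem_genPart P hP) (gen_smul_mem_genPart P)
  refine ⟨Γ, ?_⟩
  let N : Submodule (MvPolynomial (Fin n ⊕ Fin n) k) Γ.Gr :=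
    Submodule.span _ (Set.range fun m : S => Γ.cls 0 ⟨m, Submodule.subset_span m.2⟩)
  have hN : ∀ j, ∀ m : Γ.part j, Γ.cls j m ∈ N := by
    intro j
    induction j with
    | zero =>
      rintro ⟨m, hm⟩
      change m ∈ Submodule.span k (S : Set M) at hm
      have hle : Submodule.span k (S : Set M) ≤
          ((N.restrictScalars k).comap (Γ.cls 0)).map (Γ.part 0).subtype := by
        rw [Submodule.span_le]
        intro m hm
        exact ⟨⟨m, Submodule.subset_span hm⟩, Submodule.subset_span ⟨⟨m, hm⟩, rfl⟩, rfl⟩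
      obtain ⟨m', hm', rfl⟩ := hle hm
      exact hm'
    | succ j ih =>
      rintro ⟨m, hm⟩
      have hle : Γ.part (j + 1) ≤
          ((N.restrictScalars k).comap (Γ.cls (j + 1))).map (Γ.part (j + 1)).subtype := by
        refine sup_le (fun m hm => ?_) (iSup_le fun s => ?_)
        · have hm' : m ∈ Γ.part (j + 1) := Γ.mono (Nat.le_succ j) hm
          refine ⟨⟨m, hm'⟩, ?_, rfl⟩
          change Γ.cls (j + 1) ⟨m, hm'⟩ ∈ N
          rw [(Γ.cls_eq_zero_iff (j + 1) ⟨m, hm'⟩).2 hm]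
          exact N.zero_mem
        · rintro _ ⟨m, hm, rfl⟩
          refine ⟨⟨weylGen k n s • m, Γ.gen_smul_mem s j hm⟩, ?_, rfl⟩
          change Γ.cls (j + 1) _ ∈ N
          rw [← Γ.X_smul_cls s j ⟨m, hm⟩]
          exact N.smul_mem _ (ih ⟨m, hm⟩)
      obtain ⟨m', hm', rfl⟩ := hle hm
      exact hm'
  refine ⟨?_⟩
  have htop : N = ⊤ := by
    rw [eq_top_iff]
    intro y _
    induction y using Γ.gr_induction with
    | h0 => exact N.zero_mem
    | hcls j m => exact hN j m
    | hadd y z hy hz => exact N.add_mem (hy trivial) (hz trivial)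
  rw [← htop]
  exact Submodule.fg_span (Set.finite_range _)

end Exists

end WeylFiltration

end CharCycle

namespace CharCycle

universe u v w

/-! ### Weight modules -/

section Weight

variable {k : Type u} [Field k] {n : ℕ} (M : Type v) [AddCommGroup M] [Module k M]
  [Module (Weyl k n) M] [IsScalarTower k (Weyl k n) M]

theorem weyl_smul_comm {M : Type v} [AddCommGroup M] [Module k M]
    [Module (Weyl k n) M] [IsScalarTower k (Weyl k n) M] (P : Weyl k n) (c : k) (m : M) :
    P • c • m = c • P • m := by
  rw [← algebraMap_smul (Weyl k n) c m, ← algebraMap_smul (Weyl k n) c (P • m), ← mul_smul,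
    ← mul_smul, Algebra.commutes]

variable (k n) in
/-- The weight space of weight `a`: the elements `m` with `x_i ∂_i m = a_i m` for all `i`. -/
def wt (a : Fin n → ℤ) : Submodule k M where
  carrier := {m | ∀ i, weylGen k n (Sum.inl i) • weylGen k n (Sum.inr i) • m = (a i : k) • m}
  zero_mem' := fun _ => by simp
  add_mem' := fun ha hb i => by simp only [smul_add, ha i, hb i]
  smul_mem' := fun c m hm i => by
    rw [weyl_smul_comm, weyl_smul_comm, hm i, smul_comm]

variable (k n) in
/-- A weight module is spanned by its weight vectors. -/
def IsWeight : Prop := ⨆ a, wt k n M a = ⊤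

variable {M} {M' : Type w} [AddCommGroup M'] [Module k M']
  [Module (Weyl k n) M'] [IsScalarTower k (Weyl k n) M']

theorem mem_wt {a : Fin n → ℤ} {m : M} : m ∈ wt k n M a ↔
    ∀ i, weylGen k n (Sum.inl i) • weylGen k n (Sum.inr i) • m = (a i : k) • m := Iff.rfl

theorem map_mem_wt (φ : M →ₗ[Weyl k n] M') {a : Fin n → ℤ} {m : M} (hm : m ∈ wt k n M a) :
    φ m ∈ wt k n M' a := fun i => by
  rw [← map_smul, ← map_smul, hm i]
  exact (φ.restrictScalars k).map_smul _ _

theorem mem_wt_of_injective (φ : M →ₗ[Weyl k n] M') (hφ : Function.Injective φ) {a : Fin n → ℤ}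
    {m : M} (hm : φ m ∈ wt k n M' a) : m ∈ wt k n M a := fun i => by
  apply hφ
  rw [map_smul, map_smul, hm i]
  exact ((φ.restrictScalars k).map_smul _ _).symm

/-- Simultaneous eigenvectors are independent: if two weights differ at i, then x_i ∂_i minus the
eigenvalue of one removes it from a relation and only rescales the others. Characteristic 0 keeps
distinct integers distinct in k. -/
theorem wt_sum_eq_zero [CharZero k] (s : Finset (Fin n → ℤ)) (m : (Fin n → ℤ) → M)
    (hm : ∀ a, m a ∈ wt k n M a) (h : ∑ a ∈ s, m a = 0) : ∀ a ∈ s, m a = 0 := by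
  classical
  induction s using Finset.induction_on generalizing m with
  | empty => simp
  | insert b s hb ih =>
    have hs : ∀ a ∈ s, m a = 0 := by
      intro a ha
      obtain ⟨i, hi⟩ : ∃ i, a i ≠ b i := by
        by_contra! hab
        exact hb (funext hab ▸ ha)
      have h0 : ∀ c, weylGen k n (Sum.inl i) • weylGen k n (Sum.inr i) • m c - (b i : k) • m c =
          (c i - b i : k) • m c := fun c => by rw [hm c i, sub_smul]
      have h1 : ∑ c ∈ s, (c i - b i : k) • m c = 0 := by
        have h2 := congrArg (fun y => weylGen k n (Sum.inl i) • weylGen k n (Sum.inr i) • y -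
          (b i : k) • y) h
        simp only [Finset.smul_sum, smul_zero, sub_zero, ← Finset.sum_sub_distrib, h0] at h2
        rwa [Finset.sum_insert hb, sub_self, zero_smul, zero_add] at h2
      have h2 := ih (fun c => (c i - b i : k) • m c) (fun c => Submodule.smul_mem _ _ (hm c)) h1 a ha
      refine (smul_eq_zero.1 h2).resolve_left ?_
      rw [sub_eq_zero]
      exact_mod_cast hi
    rw [Finset.sum_insert hb, Finset.sum_eq_zero hs, add_zero] at h
    intro a ha
    rcases Finset.mem_insert.1 ha with rfl | ha
    · exact h
    · exact hs a ha

theorem IsWeight.exists_finsupp (h : IsWeight k n M) (m : M) :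
    ∃ f : (Fin n → ℤ) →₀ M, (∀ a, f a ∈ wt k n M a) ∧ (f.sum fun _ x => x) = m := by
  rw [← Submodule.mem_iSup_iff_exists_finsupp]
  rw [IsWeight] at h
  rw [h]
  trivial

/-- Weight components are unique, so a vector of weight `a` is its own component of weight `a`, and
`φ` respects components. -/
theorem map_weight_component [CharZero k] (φ : M →ₗ[Weyl k n] M') (f : (Fin n → ℤ) →₀ M)
    (hf : ∀ a, f a ∈ wt k n M a) (a : Fin n → ℤ) (h : φ (f.sum fun _ x => x) ∈ wt k n M' a) :
    φ (f a) = φ (f.sum fun _ x => x) := by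
  classical
  set y := φ (f.sum fun _ x => x) with hy
  have h1 : ∑ b ∈ insert a f.support, (φ (f b) - if b = a then y else 0) = 0 := by
    rw [Finset.sum_sub_distrib, Finset.sum_ite_eq', if_pos (Finset.mem_insert_self _ _),
      sub_eq_zero, hy, Finsupp.sum, map_sum]
    refine (Finset.sum_subset (Finset.subset_insert _ _) fun b _ hb => ?_).symm
    rw [Finsupp.notMem_support_iff.1 hb, map_zero]
  have h2 := wt_sum_eq_zero (k := k) (n := n) _ (fun b => φ (f b) - if b = a then y else 0)
    (fun b => by
      refine Submodule.sub_mem _ (map_mem_wt φ (hf b)) ?_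
      split_ifs with hb
      · subst hb
        exact h
      · exact Submodule.zero_mem _) h1 a (Finset.mem_insert_self _ _)
  simpa [sub_eq_zero] using h2

/-- This is the exactness of taking weight spaces: a preimage is replaced by its component of the
right weight. -/
theorem IsWeight.exists_wt_map_eq [CharZero k] (hM : IsWeight k n M) (φ : M →ₗ[Weyl k n] M')
    {a : Fin n → ℤ} {m : M} (h : φ m ∈ wt k n M' a) : ∃ m₀ ∈ wt k n M a, φ m₀ = φ m := by
  obtain ⟨f, hf, rfl⟩ := hM.exists_finsupp m
  exact ⟨f a, hf a, map_weight_component φ f hf a h⟩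

theorem isWeight_of_forall (H : ∀ m : M, m ∈ ⨆ a, wt k n M a) : IsWeight k n M := by
  rw [IsWeight, eq_top_iff]
  exact fun m _ => H m

theorem IsWeight.of_surjective (hM : IsWeight k n M) (φ : M →ₗ[Weyl k n] M')
    (hφ : Function.Surjective φ) : IsWeight k n M' := by
  refine isWeight_of_forall fun m' => ?_
  obtain ⟨m, rfl⟩ := hφ m'
  obtain ⟨f, hf, rfl⟩ := hM.exists_finsupp m
  rw [Finsupp.sum, map_sum]
  exact Submodule.sum_mem _ fun a _ => Submodule.mem_iSup_of_mem a (map_mem_wt φ (hf a))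

/-- The quotient map sends an element of N to 0, which has every weight, so it kills each weight
component of that element. -/
theorem IsWeight.submodule [CharZero k] (hM : IsWeight k n M) (N : Submodule (Weyl k n) M) :
    IsWeight k n N := by
  refine isWeight_of_forall fun m => ?_
  obtain ⟨f, hf, hm⟩ := hM.exists_finsupp (m : M)
  have hN : ∀ a, f a ∈ N := by
    intro a
    have h0 : N.mkQ (f.sum fun _ x => x) = 0 := by simp [hm]
    have h1 := map_weight_component N.mkQ f hf a (by rw [h0]; exact Submodule.zero_mem _)
    rw [h0] at h1
    simpa using h1
  have h2 : m = ∑ a ∈ f.support, (⟨f a, hN a⟩ : N) := by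
    apply Subtype.ext
    rw [← hm, Finsupp.sum]
    simp
  rw [h2]
  exact Submodule.sum_mem _ fun a _ => Submodule.mem_iSup_of_mem a
    (mem_wt_of_injective N.subtype N.subtype_injective (hf a))

theorem IsWeight.wt_eq_map [CharZero k] (hM : IsWeight k n M) (φ : M →ₗ[Weyl k n] M')
    (hφ : Function.Surjective φ) (a : Fin n → ℤ) :
    wt k n M' a = (wt k n M a).map (φ.restrictScalars k) := by
  refine le_antisymm ?_ ?_
  · intro m' hm'
    obtain ⟨m, rfl⟩ := hφ m'
    obtain ⟨m₀, h0, h1⟩ := hM.exists_wt_map_eq φ hm'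
    exact ⟨m₀, h0, h1⟩
  · rintro _ ⟨m, hm, rfl⟩
    exact map_mem_wt φ hm

/-- The weight with entries `0` on `F` and `-1` off `F`. -/
def eps (F : Finset (Fin n)) (i : Fin n) : ℤ := if i ∈ F then 0 else -1

theorem gen_smul_comm_of_ne {i j : Fin n} (h : i ≠ j) (m : M) :
    weylGen k n (Sum.inr i) • weylGen k n (Sum.inl j) • m =
      weylGen k n (Sum.inl j) • weylGen k n (Sum.inr i) • m := by
  rw [← mul_smul, ← mul_smul, weylGen_d_x, if_neg h, add_zero]

theorem d_x_smul (i : Fin n) (m : M) :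
    weylGen k n (Sum.inr i) • weylGen k n (Sum.inl i) • m =
      weylGen k n (Sum.inl i) • weylGen k n (Sum.inr i) • m + m := by
  rw [← mul_smul, ← mul_smul, weylGen_d_x, if_pos rfl, add_smul, one_smul]

theorem x_x_smul (i j : Fin n) (m : M) :
    weylGen k n (Sum.inl i) • weylGen k n (Sum.inl j) • m =
      weylGen k n (Sum.inl j) • weylGen k n (Sum.inl i) • m := by
  rw [← mul_smul, ← mul_smul, weylGen_x_comm]

theorem d_d_smul (i j : Fin n) (m : M) :
    weylGen k n (Sum.inr i) • weylGen k n (Sum.inr j) • m =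
      weylGen k n (Sum.inr j) • weylGen k n (Sum.inr i) • m := by
  rw [← mul_smul, ← mul_smul, weylGen_d_comm]

theorem x_smul_mem_wt {a : Fin n → ℤ} {m : M} (hm : m ∈ wt k n M a) (i : Fin n) :
    weylGen k n (Sum.inl i) • m ∈ wt k n M (Function.update a i (a i + 1)) := by
  intro j
  by_cases h : j = i
  · subst h
    rw [d_x_smul, hm j, Function.update_self, smul_add, weyl_smul_comm]
    push_cast
    rw [add_smul, one_smul]
  · rw [gen_smul_comm_of_ne h, x_x_smul, hm j, Function.update_of_ne h, weyl_smul_comm]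

theorem d_smul_mem_wt {a : Fin n → ℤ} {m : M} (hm : m ∈ wt k n M a) (i : Fin n) :
    weylGen k n (Sum.inr i) • m ∈ wt k n M (Function.update a i (a i - 1)) := by
  intro j
  by_cases h : j = i
  · subst h
    have h1 := d_x_smul (k := k) j (weylGen k n (Sum.inr j) • m)
    rw [hm j, weyl_smul_comm, ← sub_eq_iff_eq_add] at h1
    rw [← h1, Function.update_self]
    push_cast
    rw [sub_smul, one_smul]
  · rw [d_d_smul, ← gen_smul_comm_of_ne (Ne.symm h), hm j, Function.update_of_ne h, weyl_smul_comm]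

/-- The vector `m` is extremal in the direction `i`. -/
def Extremal (a : Fin n → ℤ) (m : M) (i : Fin n) : Prop :=
  (a i = 0 ∧ weylGen k n (Sum.inr i) • m = 0) ∨ (a i = -1 ∧ weylGen k n (Sum.inl i) • m = 0)

theorem Extremal.x_smul {a : Fin n → ℤ} {m : M} {i j : Fin n} (hj : j ≠ i)
    (h : Extremal (k := k) a m j) :
    Extremal (k := k) (Function.update a i (a i + 1)) (weylGen k n (Sum.inl i) • m) j := by
  rcases h with ⟨h1, h2⟩ | ⟨h1, h2⟩
  · refine Or.inl ⟨by rw [Function.update_of_ne hj, h1], ?_⟩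
    rw [gen_smul_comm_of_ne hj, h2, smul_zero]
  · refine Or.inr ⟨by rw [Function.update_of_ne hj, h1], ?_⟩
    rw [x_x_smul, h2, smul_zero]

theorem Extremal.d_smul {a : Fin n → ℤ} {m : M} {i j : Fin n} (hj : j ≠ i)
    (h : Extremal (k := k) a m j) :
    Extremal (k := k) (Function.update a i (a i - 1)) (weylGen k n (Sum.inr i) • m) j := by
  rcases h with ⟨h1, h2⟩ | ⟨h1, h2⟩
  · refine Or.inl ⟨by rw [Function.update_of_ne hj, h1], ?_⟩
    rw [d_d_smul, h2, smul_zero]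
  · refine Or.inr ⟨by rw [Function.update_of_ne hj, h1], ?_⟩
    rw [← gen_smul_comm_of_ne (Ne.symm hj), h2, smul_zero]

/-- Outside the window {-1, 0} a step towards it is injective on the weight space, because stepping
back yields the scalar a_i or a_i + 1, which is nonzero in characteristic 0. Inside the window one
further step either vanishes, so that the vector is extremal already, or reaches the other end,
where the step back vanishes. -/
theorem exists_extremal_step [CharZero k] (i : Fin n) (N : ℕ) (a : Fin n → ℤ) (m : M)
    (hN : (a i).natAbs ≤ N) (hm : m ∈ wt k n M a) (h0 : m ≠ 0) :
    ∃ a' m', m' ∈ wt k n M a' ∧ m' ≠ 0 ∧ Extremal (k := k) a' m' i ∧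
      ∀ j, j ≠ i → Extremal (k := k) a m j → Extremal (k := k) a' m' j := by
  induction N generalizing a m with
  | zero =>
    have ha : a i = 0 := by omega
    by_cases h1 : weylGen k n (Sum.inr i) • m = 0
    · exact ⟨a, m, hm, h0, Or.inl ⟨ha, h1⟩, fun _ _ h => h⟩
    · refine ⟨_, _, d_smul_mem_wt hm i, h1, Or.inr ⟨by simp [ha], ?_⟩, fun j hj h => h.d_smul hj⟩
      rw [hm i, ha, Int.cast_zero, zero_smul]
  | succ N ih =>
    rcases lt_trichotomy (a i) 0 with hlt | ha | hgt
    · by_cases h1 : a i = -1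
      · by_cases h2 : weylGen k n (Sum.inl i) • m = 0
        · exact ⟨a, m, hm, h0, Or.inr ⟨h1, h2⟩, fun _ _ h => h⟩
        · refine ⟨_, _, x_smul_mem_wt hm i, h2, Or.inl ⟨by simp [h1], ?_⟩,
            fun j hj h => h.x_smul hj⟩
          rw [d_x_smul, hm i, h1]
          simp
      · have h2 : weylGen k n (Sum.inl i) • m ≠ 0 := by
          intro h2
          have h3 := d_x_smul (k := k) i m
          rw [h2, smul_zero, hm i] at h3
          have h4 : ((a i + 1 : ℤ) : k) • m = 0 := by
            push_cast
            rw [add_smul, one_smul, ← h3]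
          rcases smul_eq_zero.1 h4 with h5 | h5
          · rw [Int.cast_eq_zero] at h5
            omega
          · exact h0 h5
        obtain ⟨a', m', h3, h4, h5, h6⟩ := ih (Function.update a i (a i + 1)) _
          (by rw [Function.update_self]; omega) (x_smul_mem_wt hm i) h2
        exact ⟨a', m', h3, h4, h5, fun j hj h => h6 j hj (h.x_smul hj)⟩
    · exact ih a m (by omega) hm h0
    · have h2 : weylGen k n (Sum.inr i) • m ≠ 0 := by
        intro h2
        have h3 := hm i
        rw [h2, smul_zero, eq_comm] at h3
        rcases smul_eq_zero.1 h3 with h5 | h5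
        · rw [Int.cast_eq_zero] at h5
          omega
        · exact h0 h5
      obtain ⟨a', m', h3, h4, h5, h6⟩ := ih (Function.update a i (a i - 1)) _
        (by rw [Function.update_self]; omega) (d_smul_mem_wt hm i) h2
      exact ⟨a', m', h3, h4, h5, fun j hj h => h6 j hj (h.d_smul hj)⟩

/-- A nonzero weight module contains a nonzero vector of weight `eps F` that is killed by the
variables in `Q_F`, for some `F`. -/
theorem IsWeight.exists_extremal [CharZero k] [Nontrivial M] (h : IsWeight k n M) :
    ∃ (F : Finset (Fin n)) (m : M), m ≠ 0 ∧ m ∈ wt k n M (eps F) ∧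
      ∀ s ∈ qVars F, weylGen k n s • m = 0 := by
  classical
  have hex : ∃ a, ∃ m ∈ wt k n M a, m ≠ 0 := by
    by_contra! hz
    obtain ⟨m, hm⟩ := exists_ne (0 : M)
    obtain ⟨f, hf, rfl⟩ := h.exists_finsupp m
    exact hm (Finset.sum_eq_zero fun a _ => hz a _ (hf a))
  -- The directions are treated one at a time; operators in a new direction commute with those of
  -- the earlier ones and so preserve extremality there.
  have key : ∀ P : Finset (Fin n), ∃ a, ∃ m ∈ wt k n M a, m ≠ 0 ∧
      ∀ i ∈ P, Extremal (k := k) a m i := by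
    intro P
    induction P using Finset.induction_on with
    | empty =>
      obtain ⟨a, m, hm, h0⟩ := hex
      exact ⟨a, m, hm, h0, by simp⟩
    | insert i P hi ih =>
      obtain ⟨a, m, hm, h0, hP⟩ := ih
      obtain ⟨a', m', hm', h0', h1, h2⟩ := exists_extremal_step i _ a m le_rfl hm h0
      refine ⟨a', m', hm', h0', fun j hj => ?_⟩
      rcases Finset.mem_insert.1 hj with rfl | hj
      · exact h1
      · exact h2 j (fun hji => hi (hji ▸ hj)) (hP j hj)
  obtain ⟨a, m, hm, h0, hE⟩ := key Finset.univ
  let F : Finset (Fin n) := Finset.univ.filter fun i => a i = 0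
  have ha : a = eps F := by
    funext i
    rcases hE i (Finset.mem_univ i) with h | h <;> simp [eps, F, h.1]
  refine ⟨F, m, h0, ha ▸ hm, ?_⟩
  rintro s (⟨i, hi, rfl⟩ | ⟨i, hi, rfl⟩)
  · rcases hE i (Finset.mem_univ i) with h | h
    · exact absurd h.1 (by simpa [F] using hi)
    · exact h.2
  · rcases hE i (Finset.mem_univ i) with h | h
    · exact h.2
    · have h3 : a i = 0 := by simpa [F] using hi
      omega

end Weight

end CharCycle

namespace CharCycle

open scoped IsMulCommutative

universe u v w

/-! ### Cyclic modules generated by extremal weight vectors -/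

section Cyclic

variable (k : Type u) [Field k] {n : ℕ} (F : Finset (Fin n))

/-- The variables outside `Q_F`: `x_i` for `i ∈ F` and `∂_i` for `i ∉ F`. -/
def yVar (i : Fin n) : Fin n ⊕ Fin n := if i ∈ F then Sum.inl i else Sum.inr i

/-- The variables in `Q_F`: `∂_i` for `i ∈ F` and `x_i` for `i ∉ F`. -/
def zVar (i : Fin n) : Fin n ⊕ Fin n := if i ∈ F then Sum.inr i else Sum.inl i

/-- The commutator of `zVar F i` and `yVar F i`. -/
def ySign (i : Fin n) : k := if i ∈ F then 1 else -1

theorem zVar_mem_qVars (i : Fin n) : zVar F i ∈ qVars F := by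
  by_cases h : i ∈ F
  · exact Or.inr ⟨i, h, by simp [zVar, h]⟩
  · exact Or.inl ⟨i, h, by simp [zVar, h]⟩

theorem exists_eq_zVar_of_mem_qVars {s : Fin n ⊕ Fin n} (h : s ∈ qVars F) : ∃ i, s = zVar F i := by
  rcases h with ⟨i, h, rfl⟩ | ⟨i, h, rfl⟩ <;> exact ⟨i, by simp [zVar, h]⟩

theorem eq_yVar_or_zVar (s : Fin n ⊕ Fin n) : (∃ i, s = yVar F i) ∨ ∃ i, s = zVar F i := by
  rcases s with i | i <;> by_cases h : i ∈ F
  · exact Or.inl ⟨i, by simp [yVar, h]⟩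
  · exact Or.inr ⟨i, by simp [zVar, h]⟩
  · exact Or.inr ⟨i, by simp [zVar, h]⟩
  · exact Or.inl ⟨i, by simp [yVar, h]⟩

theorem yVar_comm (i j : Fin n) : weylGen k n (yVar F i) * weylGen k n (yVar F j) =
    weylGen k n (yVar F j) * weylGen k n (yVar F i) := by
  by_cases hi : i ∈ F <;> by_cases hj : j ∈ F <;> simp only [yVar, hi, hj, if_true, if_false]
  · exact weylGen_x_comm i j
  · rw [weylGen_d_x, if_neg (by rintro rfl; exact hj hi), add_zero]
  · rw [weylGen_d_x, if_neg (by rintro rfl; exact hi hj), add_zero]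
  · exact weylGen_d_comm i j

theorem zVar_yVar (i j : Fin n) : weylGen k n (zVar F i) * weylGen k n (yVar F j) =
    weylGen k n (yVar F j) * weylGen k n (zVar F i) +
      algebraMap k _ (if i = j then ySign k F i else 0) := by
  by_cases hij : i = j
  · subst hij
    by_cases hi : i ∈ F <;> simp [yVar, zVar, ySign, hi, weylGen_d_x]
  · rw [if_neg hij]
    by_cases hi : i ∈ F <;> by_cases hj : j ∈ F <;>
      simp [yVar, zVar, hi, hj, weylGen_d_x, hij, Ne.symm hij, weylGen_x_comm i j,
        weylGen_d_comm i j]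

/-- The polynomials in the variables outside `Q_F`, in the Weyl algebra. -/
def yHom : MvPolynomial (Fin n) k →ₐ[k] Weyl k n :=
  have : IsMulCommutative (Algebra.adjoin k (Set.range fun i => weylGen k n (yVar F i))) :=
    Algebra.isMulCommutative_adjoin k (by
      rintro _ ⟨s, rfl⟩ _ ⟨t, rfl⟩
      exact yVar_comm k F s t)
  (Algebra.adjoin k (Set.range fun i => weylGen k n (yVar F i))).val.comp
    (MvPolynomial.aeval fun i => ⟨weylGen k n (yVar F i), Algebra.subset_adjoin ⟨i, rfl⟩⟩)

theorem yHom_X (i : Fin n) : yHom k F (MvPolynomial.X i) = weylGen k n (yVar F i) := by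
  simp [yHom]

/-- The pairs y_i, z_i again satisfy Weyl relations, so the commutator with z_i is differentiation
in y_i; the sign appears where x_i and ∂_i have changed roles. -/
theorem zVar_mul_yHom (i : Fin n) (p : MvPolynomial (Fin n) k) :
    weylGen k n (zVar F i) * yHom k F p =
      yHom k F p * weylGen k n (zVar F i) + ySign k F i • yHom k F (MvPolynomial.pderiv i p) := by
  induction p using MvPolynomial.induction_on with
  | C a =>
    rw [← MvPolynomial.algebraMap_eq, AlgHom.commutes, Derivation.map_algebraMap, map_zero,
      smul_zero, add_zero, Algebra.commutes]
  | add p q hp hq =>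
    simp only [map_add, mul_add, add_mul, hp, hq, smul_add]
    abel
  | mul_X p j hp =>
    rw [map_mul, ← mul_assoc, hp, add_mul, mul_assoc, yHom_X, zVar_yVar, Derivation.leibniz,
      map_add, smul_eq_mul, smul_eq_mul, map_mul, map_mul, yHom_X, mul_add, mul_assoc]
    rw [add_assoc, smul_add]
    congr 2
    · by_cases hij : i = j
      · subst hij
        rw [if_pos rfl, MvPolynomial.pderiv_X_self, map_one, mul_one, ← Algebra.commutes,
          ← Algebra.smul_def]
      · rw [if_neg hij, MvPolynomial.pderiv_X_of_ne (Ne.symm hij)]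
        simp
    · rw [← yHom_X, ← map_mul, mul_comm, map_mul, Algebra.smul_mul_assoc]

/-- The polynomials of degree at most `j`. -/
def degLE (n : ℕ) (j : ℕ) : Submodule k (MvPolynomial (Fin n) k) where
  carrier := {p | ∀ α : Fin n →₀ ℕ, j < α.degree → MvPolynomial.coeff α p = 0}
  zero_mem' := fun _ _ => by simp
  add_mem' := fun ha hb α hα => by rw [MvPolynomial.coeff_add, ha α hα, hb α hα, add_zero]
  smul_mem' := fun c p hp α hα => by rw [MvPolynomial.coeff_smul, hp α hα, smul_zero]

variable {k}

theorem X_mul_mem_degLE {j : ℕ} {p : MvPolynomial (Fin n) k} (hp : p ∈ degLE k n j) (i : Fin n) :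
    MvPolynomial.X i * p ∈ degLE k n (j + 1) := by
  intro α hα
  rw [mul_comm, MvPolynomial.coeff_mul_X']
  split_ifs with hi
  · refine hp _ ?_
    have h1 : Finsupp.single i 1 ≤ α := by
      rw [Finsupp.single_le_iff]
      exact Nat.one_le_iff_ne_zero.2 (Finsupp.mem_support_iff.1 hi)
    have h2 : (α - Finsupp.single i 1).degree + 1 = α.degree := by
      conv_rhs => rw [← tsub_add_cancel_of_le h1]
      rw [map_add, Finsupp.degree_single]
    omega
  · rfl

theorem pderiv_mem_degLE {j : ℕ} {p : MvPolynomial (Fin n) k} (hp : p ∈ degLE k n (j + 1))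
    (i : Fin n) : MvPolynomial.pderiv i p ∈ degLE k n j := by
  intro α hα
  rw [MvPolynomial.coeff_pderiv, hp, zero_mul]
  rw [map_add, Finsupp.degree_single]
  omega

theorem degLE_mono : Monotone (degLE k n) := fun _ _ h _ hp α hα => hp α (h.trans_lt hα)

theorem exists_mem_degLE (p : MvPolynomial (Fin n) k) : ∃ j, p ∈ degLE k n j := by
  refine ⟨p.support.sup Finsupp.degree, fun α hα => ?_⟩
  by_contra h
  exact absurd (Finset.le_sup (f := Finsupp.degree) (MvPolynomial.mem_support_iff.2 h))
    (not_le.2 hα)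

variable {M : Type v} [AddCommGroup M] [Module k M] [Module (Weyl k n) M]
  [IsScalarTower k (Weyl k n) M] (m : M)

/-- The map `p ↦ p m` from polynomials in the variables outside `Q_F`. -/
def wMap : MvPolynomial (Fin n) k →ₗ[k] M :=
  ((LinearMap.toSpanSingleton (Weyl k n) M m).restrictScalars k).comp (yHom k F).toLinearMap

theorem wMap_apply (p : MvPolynomial (Fin n) k) : wMap F m p = yHom k F p • m := rfl

theorem yVar_smul_wMap (i : Fin n) (p : MvPolynomial (Fin n) k) :
    weylGen k n (yVar F i) • wMap F m p = wMap F m (MvPolynomial.X i * p) := by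
  rw [wMap_apply, wMap_apply, map_mul, yHom_X, mul_smul]

variable {F m} (hz : ∀ s ∈ qVars F, weylGen k n s • m = 0)

include hz in
theorem zVar_smul_wMap (i : Fin n) (p : MvPolynomial (Fin n) k) :
    weylGen k n (zVar F i) • wMap F m p = ySign k F i • wMap F m (MvPolynomial.pderiv i p) := by
  rw [wMap_apply, wMap_apply, ← mul_smul, zVar_mul_yHom, add_smul, mul_smul,
    hz _ (zVar_mem_qVars F i), smul_zero, zero_add, smul_assoc]

theorem ySign_ne_zero (i : Fin n) : ySign k F i ≠ 0 := by
  rw [ySign]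
  split_ifs <;> simp

-- If p m = 0, applying z_i gives (∂p/∂y_i) m = 0, so by induction on the degree all partial
-- derivatives of p vanish. In characteristic 0 this leaves only a constant, and a nonzero constant
-- does not kill m.
include hz in
theorem wMap_eq_zero [CharZero k] (h0 : m ≠ 0) (j : ℕ) (p : MvPolynomial (Fin n) k)
    (hp : p ∈ degLE k n j) (h : wMap F m p = 0) : p = 0 := by
  induction j generalizing p with
  | zero =>
    have hC : p = MvPolynomial.C (MvPolynomial.coeff 0 p) := by
      ext α
      rw [MvPolynomial.coeff_C]
      split_ifs with hα
      · rw [hα]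
      · refine hp α (Nat.pos_of_ne_zero fun h => hα ?_)
        exact ((Finsupp.degree_eq_zero_iff α).1 h).symm
    rw [hC, wMap_apply, ← MvPolynomial.algebraMap_eq, AlgHom.commutes, algebraMap_smul] at h
    rw [hC, (smul_eq_zero.1 h).resolve_right h0, map_zero]
  | succ j ih =>
    have hd : ∀ i, MvPolynomial.pderiv i p = 0 := by
      intro i
      refine ih _ (pderiv_mem_degLE hp i) ?_
      have h1 := zVar_smul_wMap hz i p
      rw [h, smul_zero, eq_comm] at h1
      exact (smul_eq_zero.1 h1).resolve_left (ySign_ne_zero i)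
    refine ih p (fun α hα => ?_) h
    obtain ⟨i, hi⟩ : ∃ i, α i ≠ 0 := by
      by_contra! hα'
      have : α = 0 := Finsupp.ext hα'
      simp [this] at hα
    have h1 : Finsupp.single i 1 ≤ α := by
      rw [Finsupp.single_le_iff]
      exact Nat.one_le_iff_ne_zero.2 hi
    have h2 := MvPolynomial.coeff_pderiv (i := i) p (α - Finsupp.single i 1)
    rw [hd i, MvPolynomial.coeff_zero, tsub_add_cancel_of_le h1, eq_comm, mul_eq_zero] at h2
    refine h2.resolve_right ?_
    exact Nat.cast_add_one_ne_zero _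

include hz in
theorem wMap_injective [CharZero k] (h0 : m ≠ 0) : Function.Injective (wMap (k := k) F m) := by
  rw [injective_iff_map_eq_zero]
  intro p hp
  obtain ⟨j, hj⟩ := exists_mem_degLE p
  exact wMap_eq_zero hz h0 j p hj hp

-- The multiples p m form a subspace stable under the y_i, which multiply p, and under the z_i,
-- which differentiate it.
include hz in
theorem mem_range_wMap {m' : M} (hm' : m' ∈ Submodule.span (Weyl k n) {m}) :
    ∃ p, wMap (k := k) F m p = m' := by
  obtain ⟨a, rfl⟩ := Submodule.mem_span_singleton.1 hm'
  have := WeylFiltration.smul_mem_of_gen (LinearMap.range (wMap (k := k) F m)) (fun s m' hm' => by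
    obtain ⟨p, rfl⟩ := hm'
    rcases eq_yVar_or_zVar F s with ⟨i, rfl⟩ | ⟨i, rfl⟩
    · rw [yVar_smul_wMap]
      exact ⟨_, rfl⟩
    · rw [zVar_smul_wMap hz, ← map_smul]
      exact ⟨_, rfl⟩) a m ⟨1, by rw [wMap_apply, map_one, one_smul]⟩
  exact this

include hz in
/-- The only weight of the form `eps G` in the cyclic module is `eps F`. -/
theorem wMap_mem_wt [CharZero k] (h0 : m ≠ 0) (G : Finset (Fin n)) (p : MvPolynomial (Fin n) k)
    (h : wMap F m p ∈ wt k n M (eps G)) (α : Fin n →₀ ℕ) (hα : MvPolynomial.coeff α p ≠ 0) :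
    F = G ∧ α = 0 := by
  have key : ∀ i, (i ∈ F ↔ i ∈ G) ∧ α i = 0 := by
    intro i
    have hi := h i
    rw [← (wMap F m).map_smul] at hi
    have hder : MvPolynomial.coeff α (MvPolynomial.X i * MvPolynomial.pderiv i p) =
        (α i : k) * MvPolynomial.coeff α p := by
      rw [mul_comm, MvPolynomial.coeff_mul_X']
      split_ifs with h1
      · have h2 : Finsupp.single i 1 ≤ α := by
          rw [Finsupp.single_le_iff]
          exact Nat.one_le_iff_ne_zero.2 (Finsupp.mem_support_iff.1 h1)
        have h3 : α i ≠ 0 := Finsupp.mem_support_iff.1 h1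
        rw [MvPolynomial.coeff_pderiv, tsub_add_cancel_of_le h2, mul_comm]
        congr 1
        rw [Finsupp.tsub_apply, Finsupp.single_eq_same]
        exact_mod_cast Nat.succ_pred_eq_of_pos (Nat.pos_of_ne_zero h3)
      · rw [Finsupp.notMem_support_iff.1 h1]
        simp
    -- On y^α m the operator x_i ∂_i has eigenvalue α_i if i ∈ F and -(α_i + 1) if i ∉ F. The first
    -- is never -1 and the second never 0, so equality with the entry of `eps G` forces α_i = 0 and
    -- agreement of F and G at i.
    by_cases hF : i ∈ F
    · have hy : Sum.inl i = yVar F i := by simp [yVar, hF]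
      have hz' : Sum.inr i = zVar F i := by simp [zVar, hF]
      rw [hy, hz', zVar_smul_wMap hz, ySign, if_pos hF, one_smul, yVar_smul_wMap] at hi
      have h1 := congrArg (MvPolynomial.coeff α) (wMap_injective hz h0 hi)
      rw [hder, MvPolynomial.coeff_smul, smul_eq_mul] at h1
      have h2 := mul_right_cancel₀ hα h1
      have h3 : (α i : ℤ) = eps G i := by exact_mod_cast h2
      by_cases hG : i ∈ G <;> simp only [eps, hG, if_true, if_false] at h3
      · exact ⟨iff_of_true hF hG, by omega⟩
      · omega
    · have hy : Sum.inr i = yVar F i := by simp [yVar, hF]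
      have hz' : Sum.inl i = zVar F i := by simp [zVar, hF]
      rw [hy, hz', yVar_smul_wMap, zVar_smul_wMap hz, ySign, if_neg hF, ← map_smul] at hi
      have h1 := congrArg (MvPolynomial.coeff α) (wMap_injective hz h0 hi)
      rw [Derivation.leibniz, MvPolynomial.pderiv_X_self, smul_eq_mul, smul_eq_mul, mul_one,
        MvPolynomial.coeff_smul, MvPolynomial.coeff_add, hder, MvPolynomial.coeff_smul,
        smul_eq_mul, smul_eq_mul] at h1
      have h2 : (-((α i : k) + 1)) * MvPolynomial.coeff α p =
          (eps G i : k) * MvPolynomial.coeff α p := by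
        rw [← h1]
        ring
      have h3 : -((α i : ℤ) + 1) = eps G i := by exact_mod_cast mul_right_cancel₀ hα h2
      by_cases hG : i ∈ G <;> simp only [eps, hG, if_true, if_false] at h3
      · omega
      · exact ⟨iff_of_false hF hG, by omega⟩
  exact ⟨Finset.ext fun i => (key i).1, Finsupp.ext fun i => (key i).2⟩

end Cyclic

end CharCycle

namespace CharCycle

universe u v w

open WeylFiltration

/-! ### The associated graded module of a cyclic module with extremal generator -/

section CyclicGr

variable {k : Type u} [Field k] {n : ℕ} {F : Finset (Fin n)}
  {M : Type v} [AddCommGroup M] [Module k M] [Module (Weyl k n) M]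
  [IsScalarTower k (Weyl k n) M] {m : M} (hz : ∀ s ∈ qVars F, weylGen k n s • m = 0)
  (hspan : Submodule.span (Weyl k n) {m} = ⊤)

/-- The filtration of a cyclic module with an extremal generator by the degree of polynomials. -/
def cyclicFiltration : WeylFiltration k n M :=
  WeylFiltration.ofGen (fun j => (degLE k n j).map (wMap F m))
    (fun _ _ h => Submodule.map_mono (degLE_mono h))
    (fun m' => by
      obtain ⟨p, rfl⟩ := mem_range_wMap hz (m' := m') (by rw [hspan]; trivial)
      obtain ⟨j, hj⟩ := exists_mem_degLE p
      exact ⟨j, p, hj, rfl⟩)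
    (by
      rintro s j _ ⟨p, hp, rfl⟩
      rcases eq_yVar_or_zVar F s with ⟨i, rfl⟩ | ⟨i, rfl⟩
      · rw [yVar_smul_wMap]
        exact ⟨_, X_mul_mem_degLE hp i, rfl⟩
      · rw [zVar_smul_wMap hz]
        refine Submodule.smul_mem _ _ ⟨_, degLE_mono (Nat.le_succ j) ?_, rfl⟩
        exact pderiv_mem_degLE (degLE_mono (Nat.le_succ j) hp) i)

theorem homogeneousComponent_mem_degLE (j : ℕ) (p : MvPolynomial (Fin n) k) :
    MvPolynomial.homogeneousComponent j p ∈ degLE k n j := by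
  intro α hα
  rw [MvPolynomial.coeff_homogeneousComponent, if_neg (by omega)]

/-- The homogeneous component of degree `j`, applied to the generator. -/
def wPart (j : ℕ) : MvPolynomial (Fin n) k →ₗ[k] (cyclicFiltration hz hspan).part j :=
  ((wMap F m).comp (MvPolynomial.homogeneousComponent j)).codRestrict _
    fun p => ⟨_, homogeneousComponent_mem_degLE j p, rfl⟩

/-- The class of the generator. -/
def genCls : (cyclicFiltration hz hspan).Gr :=
  (cyclicFiltration hz hspan).cls 0 (wPart hz hspan 0 1)

theorem wPart_zero_one : (wPart hz hspan 0 1 : M) = m := by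
  change wMap F m (MvPolynomial.homogeneousComponent 0 1) = m
  rw [MvPolynomial.homogeneousComponent_zero, MvPolynomial.coeff_zero_one, map_one, wMap_apply,
    map_one, one_smul]

theorem rename_smul_genCls_monomial (α : Fin n →₀ ℕ) (c : k) :
    ∃ d, (MvPolynomial.monomial α c).IsHomogeneous d ∧
      MvPolynomial.rename (yVar F) (MvPolynomial.monomial α c) • genCls hz hspan =
        (cyclicFiltration hz hspan).cls d (wPart hz hspan d (MvPolynomial.monomial α c)) := by
  refine MvPolynomial.induction_on_monomial (motive := fun p => ∃ d, p.IsHomogeneous d ∧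
    MvPolynomial.rename (yVar F) p • genCls hz hspan =
      (cyclicFiltration hz hspan).cls d (wPart hz hspan d p)) ?_ ?_ α c
  · intro a
    refine ⟨0, MvPolynomial.isHomogeneous_C _ _, ?_⟩
    rw [MvPolynomial.rename_C, C_smul, genCls, ← map_smul, ← map_smul, MvPolynomial.smul_eq_C_mul,
      mul_one]
  · rintro p i ⟨d, hd, h⟩
    refine ⟨d + 1, hd.mul (MvPolynomial.isHomogeneous_X _ i), ?_⟩
    rw [map_mul, mul_comm, MvPolynomial.rename_X, mul_smul, h, X_smul_cls]
    refine cls_congr _ rfl _ _ ?_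
    change weylGen k n (yVar F i) • wMap F m (MvPolynomial.homogeneousComponent d p) =
      wMap F m (MvPolynomial.homogeneousComponent (d + 1) (p * MvPolynomial.X i))
    rw [yVar_smul_wMap, MvPolynomial.homogeneousComponent_eq_self hd,
      MvPolynomial.homogeneousComponent_eq_self (hd.mul (MvPolynomial.isHomogeneous_X _ i)),
      mul_comm]

theorem comp_rename_smul_genCls (d : ℕ) (p : MvPolynomial (Fin n) k) :
    (cyclicFiltration hz hspan).comp d (MvPolynomial.rename (yVar F) p • genCls hz hspan) =
      Submodule.Quotient.mk (wPart hz hspan d p) := by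
  induction p using MvPolynomial.induction_on' with
  | monomial α c =>
    obtain ⟨e, he, h⟩ := rename_smul_genCls_monomial hz hspan α c
    rw [h, cls, LinearMap.comp_apply]
    by_cases hde : e = d
    · subst hde
      rw [comp_lof]
      rfl
    · rw [comp_lof_of_ne _ hde]
      have h0 : wPart hz hspan d (MvPolynomial.monomial α c) = 0 := by
        apply Subtype.ext
        change wMap F m (MvPolynomial.homogeneousComponent d (MvPolynomial.monomial α c)) = 0
        rw [MvPolynomial.homogeneousComponent_of_mem he, if_neg (Ne.symm hde), map_zero]
      rw [h0]
      rfl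
  | add p q hp hq => simp only [map_add, add_smul, hp, hq, Submodule.Quotient.mk_add]

theorem rename_smul_genCls (d : ℕ) (p : MvPolynomial (Fin n) k) (hp : p.IsHomogeneous d) :
    MvPolynomial.rename (yVar F) p • genCls hz hspan =
      (cyclicFiltration hz hspan).cls d (wPart hz hspan d p) := by
  refine gr_ext _ fun j => ?_
  rw [comp_rename_smul_genCls, cls, LinearMap.comp_apply]
  by_cases hde : d = j
  · subst hde
    rw [comp_lof]
    rfl
  · rw [comp_lof_of_ne _ hde]
    have h0 : wPart hz hspan j p = 0 := by
      apply Subtype.ext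
      change wMap F m (MvPolynomial.homogeneousComponent j p) = 0
      rw [MvPolynomial.homogeneousComponent_of_mem hp, if_neg (Ne.symm hde), map_zero]
    rw [h0]
    rfl

/-- If the component of degree d vanishes, then p_d m, with p_d the homogeneous part of p, equals q
m for some q of degree below d. Injectivity of p ↦ p m gives p_d = q, and both are zero for reasons
of degree. -/
theorem rename_smul_genCls_eq_zero [CharZero k] (h0 : m ≠ 0) (p : MvPolynomial (Fin n) k)
    (h : MvPolynomial.rename (yVar F) p • genCls hz hspan = 0) : p = 0 := by
  have hcomp : ∀ d, MvPolynomial.homogeneousComponent d p = 0 := by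
    intro d
    have h1 := comp_rename_smul_genCls hz hspan d p
    rw [h, map_zero, eq_comm, Submodule.Quotient.mk_eq_zero] at h1
    have h2 : wMap F m (MvPolynomial.homogeneousComponent d p) ∈
      (cyclicFiltration hz hspan).prev d := h1
    cases d with
    | zero => exact wMap_injective hz h0 (((Submodule.mem_bot k).1 h2).trans (map_zero _).symm)
    | succ d =>
      obtain ⟨q, hq, hq'⟩ := h2
      have hq'' := wMap_injective hz h0 hq'
      ext α
      rw [MvPolynomial.coeff_zero]
      by_cases hα : α.degree = d + 1
      · rw [← hq'']
        exact hq α (by omega)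
      · rw [MvPolynomial.coeff_homogeneousComponent, if_neg hα]
  ext α
  have h1 := congrArg (MvPolynomial.coeff α) (hcomp α.degree)
  rwa [MvPolynomial.coeff_homogeneousComponent, if_pos rfl] at h1

theorem exists_rename_sub_mem (F : Finset (Fin n)) (r : MvPolynomial (Fin n ⊕ Fin n) k) :
    ∃ p, r - MvPolynomial.rename (yVar F) p ∈ qIdeal k F := by
  induction r using MvPolynomial.induction_on with
  | C a => exact ⟨MvPolynomial.C a, by simp⟩
  | add r s hr hs =>
    obtain ⟨p, hp⟩ := hr
    obtain ⟨q, hq⟩ := hs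
    refine ⟨p + q, ?_⟩
    rw [map_add, add_sub_add_comm]
    exact Ideal.add_mem _ hp hq
  | mul_X r s hr =>
    obtain ⟨p, hp⟩ := hr
    rcases eq_yVar_or_zVar F s with ⟨i, rfl⟩ | ⟨i, rfl⟩
    · refine ⟨p * MvPolynomial.X i, ?_⟩
      rw [map_mul, MvPolynomial.rename_X, ← sub_mul]
      exact Ideal.mul_mem_right _ _ hp
    · refine ⟨0, ?_⟩
      rw [map_zero, sub_zero]
      exact Ideal.mul_mem_left _ _ (Ideal.subset_span ⟨_, zVar_mem_qVars F i, rfl⟩)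

theorem qIdeal_smul_genCls (r : MvPolynomial (Fin n ⊕ Fin n) k) (hr : r ∈ qIdeal k F) :
    r • genCls hz hspan = 0 := by
  suffices h : qIdeal k F ≤
      LinearMap.ker (LinearMap.toSpanSingleton (MvPolynomial (Fin n ⊕ Fin n) k) _
        (genCls hz hspan)) from h hr
  rw [qIdeal, Ideal.span_le]
  rintro _ ⟨s, hs, rfl⟩
  rw [SetLike.mem_coe, LinearMap.mem_ker, LinearMap.toSpanSingleton_apply, genCls, X_smul_cls,
    cls_eq_zero_iff]
  change weylGen k n s • (wPart hz hspan 0 1 : M) ∈ _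
  rw [wPart_zero_one, hz s hs]
  exact Submodule.zero_mem _

/-- Modulo Q_F every element of gr A is a polynomial in the y-variables, and no nonzero such
polynomial kills the class of the generator. -/
theorem ker_toSpanSingleton_genCls [CharZero k] (h0 : m ≠ 0) :
    LinearMap.ker (LinearMap.toSpanSingleton (MvPolynomial (Fin n ⊕ Fin n) k) _
      (genCls hz hspan)) = qIdeal k F := by
  refine le_antisymm (fun r hr => ?_) fun r hr => qIdeal_smul_genCls hz hspan r hr
  obtain ⟨p, hp⟩ := exists_rename_sub_mem F r
  have h1 : r • genCls hz hspan = 0 := hr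
  have h2 := qIdeal_smul_genCls hz hspan _ hp
  rw [sub_smul, h1, zero_sub, neg_eq_zero] at h2
  rw [rename_smul_genCls_eq_zero hz hspan h0 p h2, map_zero, sub_zero] at hp
  exact hp

/-- In degree j only the homogeneous part of degree j of a polynomial contributes to the symbol of p
m. -/
theorem toSpanSingleton_genCls_surjective :
    Function.Surjective (LinearMap.toSpanSingleton (MvPolynomial (Fin n ⊕ Fin n) k) _
      (genCls hz hspan)) := by
  rw [← LinearMap.range_eq_top, eq_top_iff]
  intro y _
  induction y using (cyclicFiltration hz hspan).gr_induction with
  | h0 => exact Submodule.zero_mem _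
  | hcls j m' =>
    obtain ⟨m', p, hp, rfl⟩ := m'
    refine ⟨MvPolynomial.rename (yVar F) (MvPolynomial.homogeneousComponent j p), ?_⟩
    rw [LinearMap.toSpanSingleton_apply, rename_smul_genCls hz hspan j _
      (MvPolynomial.homogeneousComponent_isHomogeneous j p), ← sub_eq_zero, ← map_sub,
      cls_eq_zero_iff]
    change wMap F m (MvPolynomial.homogeneousComponent j (MvPolynomial.homogeneousComponent j p)) -
      wMap F m p ∈ _
    rw [MvPolynomial.homogeneousComponent_eq_self
      (MvPolynomial.homogeneousComponent_isHomogeneous j p), ← map_sub]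
    cases j with
    | zero =>
      have h1 : MvPolynomial.homogeneousComponent 0 p - p = 0 := by
        ext α
        rw [MvPolynomial.coeff_sub, MvPolynomial.coeff_homogeneousComponent,
          MvPolynomial.coeff_zero]
        split_ifs with hα
        · exact sub_self _
        · rw [hp α (Nat.pos_of_ne_zero hα), sub_zero]
      rw [h1, map_zero]
      exact Submodule.zero_mem _
    | succ j =>
      refine ⟨_, fun α hα => ?_, rfl⟩
      rw [MvPolynomial.coeff_sub, MvPolynomial.coeff_homogeneousComponent]
      split_ifs with hα'
      · exact sub_self _
      · rw [hp α (by omega), sub_zero]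
  | hadd y z hy hz => exact Submodule.add_mem _ (hy trivial) (hz trivial)

theorem cyclicFiltration_isGood : (cyclicFiltration hz hspan).IsGood :=
  Module.Finite.of_surjective _ (toSpanSingleton_genCls_surjective hz hspan)

theorem cyclicFiltration_multiplicity [CharZero k] (h0 : m ≠ 0)
    (Q : Ideal (MvPolynomial (Fin n ⊕ Fin n) k)) [Q.IsPrime] :
    (cyclicFiltration hz hspan).multiplicity Q = Module.length (Localization.AtPrime Q)
      (LocalizedModule.AtPrime Q (MvPolynomial (Fin n ⊕ Fin n) k ⧸ qIdeal k F)) := by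
  refine (length_localized_congr Q ?_).symm
  exact (Submodule.quotEquivOfEq _ _ (ker_toSpanSingleton_genCls hz hspan h0).symm).trans
    ((LinearMap.toSpanSingleton (MvPolynomial (Fin n ⊕ Fin n) k) _
      (genCls hz hspan)).quotKerEquivOfSurjective (toSpanSingleton_genCls_surjective hz hspan))

end CyclicGr

/-! ### Multiplicities of weight modules -/

section WeightMultiplicity

variable {k : Type u} [Field k] [CharZero k] {n : ℕ}

/-- By rank-nullity and exactness of weight spaces, the loss of dimension is that of the part of A m
of weight `eps G`, which is k m or zero. -/
theorem finrank_wt_quotient {M : Type v} [AddCommGroup M] [Module k M] [Module (Weyl k n) M]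
    [IsScalarTower k (Weyl k n) M] (hM : IsWeight k n M) {F : Finset (Fin n)} {m : M} (h0 : m ≠ 0)
    (hm : m ∈ wt k n M (eps F)) (hz : ∀ s ∈ qVars F, weylGen k n s • m = 0) (G : Finset (Fin n))
    [Module.Finite k (wt k n M (eps G))] :
    Module.finrank k (wt k n M (eps G)) =
      Module.finrank k (wt k n (M ⧸ Submodule.span (Weyl k n) {m}) (eps G)) +
        if F = G then 1 else 0 := by
  set N := Submodule.span (Weyl k n) {m} with hN
  have h1 := LinearMap.finrank_range_add_finrank_ker
    ((N.mkQ.restrictScalars k).comp (wt k n M (eps G)).subtype)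
  rw [LinearMap.range_comp, Submodule.range_subtype,
    ← hM.wt_eq_map N.mkQ N.mkQ_surjective] at h1
  rw [← h1]
  congr 1
  have hker : ∀ y : wt k n M (eps G),
      y ∈ LinearMap.ker ((N.mkQ.restrictScalars k).comp (wt k n M (eps G)).subtype) ↔
        (y : M) ∈ N := by
    intro y
    rw [LinearMap.mem_ker, LinearMap.comp_apply, LinearMap.restrictScalars_apply,
      Submodule.mkQ_apply, Submodule.Quotient.mk_eq_zero]
    rfl
  split_ifs with hFG
  · subst hFG
    rw [finrank_eq_one_iff']
    refine ⟨⟨⟨m, hm⟩, (hker _).2 (Submodule.mem_span_singleton_self m)⟩, ?_, ?_⟩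
    · intro h
      exact h0 (congrArg Subtype.val (congrArg Subtype.val h))
    · rintro ⟨⟨y, hy⟩, hy'⟩
      rw [hker] at hy'
      obtain ⟨p, hp⟩ := mem_range_wMap hz hy'
      refine ⟨MvPolynomial.coeff 0 p, ?_⟩
      apply Subtype.ext
      apply Subtype.ext
      change MvPolynomial.coeff 0 p • m = y
      have hC : p = MvPolynomial.C (MvPolynomial.coeff 0 p) := by
        ext α
        rw [MvPolynomial.coeff_C]
        split_ifs with hα
        · rw [hα]
        · by_contra hne
          exact hα (wMap_mem_wt hz h0 F p (by rw [hp]; exact hy) α hne).2.symm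
      change wMap F m p = y at hp
      rw [← hp]
      conv_rhs => rw [hC]
      rw [wMap_apply, ← MvPolynomial.algebraMap_eq, AlgHom.commutes, algebraMap_smul]
  · rw [finrank_zero_iff_forall_zero]
    rintro ⟨⟨y, hy⟩, hy'⟩
    rw [hker] at hy'
    obtain ⟨p, hp⟩ := mem_range_wMap hz hy'
    have hp0 : p = 0 := by
      ext α
      rw [MvPolynomial.coeff_zero]
      by_contra hne
      exact hFG (wMap_mem_wt hz h0 G p (by rw [hp]; exact hy) α hne).1
    apply Subtype.ext
    apply Subtype.ext
    change y = 0
    rw [hp0, map_zero] at hp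
    exact hp.symm

/-- Induction on the total dimension of the weight spaces `eps F`, with the module quantified inside
because the step passes from M to M / A m for an extremal m. Finite generation comes along for free:
A m is cyclic and the quotient is covered by the induction hypothesis. -/
theorem weight_multiplicity_aux (d : ℕ) : ∀ (M : Type v) [AddCommGroup M] [Module k M]
    [Module (Weyl k n) M] [IsScalarTower k (Weyl k n) M], IsWeight k n M →
    (∀ F : Finset (Fin n), Module.Finite k (wt k n M (eps F))) →
    ∑ F : Finset (Fin n), Module.finrank k (wt k n M (eps F)) = d →
    Module.Finite (Weyl k n) M ∧ ∀ Γ : WeylFiltration k n M, Γ.IsGood →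
      ∀ (Q : Ideal (MvPolynomial (Fin n ⊕ Fin n) k)) [Q.IsPrime], Γ.multiplicity Q =
        ∑ F : Finset (Fin n), (Module.finrank k (wt k n M (eps F)) : ℕ∞) *
          Module.length (Localization.AtPrime Q)
            (LocalizedModule.AtPrime Q (MvPolynomial (Fin n ⊕ Fin n) k ⧸ qIdeal k F)) := by
  induction d with
  | zero =>
    intro M _ _ _ _ hM hfin hd
    -- A nonzero module would contain an extremal vector, and hence a nonzero weight space of some
    -- weight `eps F`.
    have hsub : Subsingleton M := by
      by_contra hne
      rw [not_subsingleton_iff_nontrivial] at hne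
      obtain ⟨F, m, h0, hm, -⟩ := hM.exists_extremal
      have h1 := (Finset.sum_eq_zero_iff.1 hd) F (Finset.mem_univ F)
      have := hfin F
      rw [finrank_zero_iff_forall_zero] at h1
      exact h0 (congrArg Subtype.val (h1 ⟨m, hm⟩))
    refine ⟨inferInstance, fun Γ _ Q _ => ?_⟩
    have h1 : ∀ F : Finset (Fin n), Module.finrank k (wt k n M (eps F)) = 0 := fun F =>
      (Finset.sum_eq_zero_iff.1 hd) F (Finset.mem_univ F)
    rw [Finset.sum_eq_zero fun F _ => by rw [h1 F, Nat.cast_zero, zero_mul]]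
    have h2 : Subsingleton Γ.Gr := by
      refine subsingleton_of_forall_eq 0 fun y => ?_
      induction y using Γ.gr_induction with
      | h0 => rfl
      | hcls j m => rw [Subsingleton.elim m 0, map_zero]
      | hadd y z hy hz => rw [hy, hz, add_zero]
    rw [WeylFiltration.multiplicity, Module.length_eq_zero_iff]
    infer_instance
  | succ d ih =>
    intro M _ _ _ _ hM hfin hd
    have hnt : Nontrivial M := by
      by_contra hne
      rw [not_nontrivial_iff_subsingleton] at hne
      rw [Finset.sum_eq_zero fun F _ => Module.finrank_zero_of_subsingleton] at hd
      omega
    obtain ⟨F, m, h0, hm, hz⟩ := hM.exists_extremal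
    have hq := fun G => finrank_wt_quotient hM h0 hm hz G
    set N := Submodule.span (Weyl k n) {m} with hN
    have hfin' : ∀ G : Finset (Fin n), Module.Finite k (wt k n (M ⧸ N) (eps G)) := by
      intro G
      rw [hM.wt_eq_map N.mkQ N.mkQ_surjective]
      have := hfin G
      infer_instance
    obtain ⟨h1, h2⟩ := ih (M ⧸ N) (hM.of_surjective N.mkQ N.mkQ_surjective) hfin' (by
      rw [Finset.sum_congr rfl fun G _ => hq G, Finset.sum_add_distrib, Finset.sum_ite_eq,
        if_pos (Finset.mem_univ F)] at hd
      omega)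
    have hNfin : Module.Finite (Weyl k n) N := by
      rw [Module.Finite.iff_fg]
      exact Submodule.fg_span_singleton m
    refine ⟨Module.Finite.of_submodule_quotient N, fun Γ hΓ Q _ => ?_⟩
    let m₀ : N := ⟨m, Submodule.mem_span_singleton_self m⟩
    have hz₀ : ∀ s ∈ qVars F, weylGen k n s • m₀ = 0 := fun s hs => Subtype.ext (hz s hs)
    have hspan₀ : Submodule.span (Weyl k n) {m₀} = ⊤ := by
      rw [eq_top_iff]
      rintro ⟨y, hy⟩ -
      obtain ⟨a, rfl⟩ := Submodule.mem_span_singleton.1 hy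
      exact Submodule.mem_span_singleton.2 ⟨a, rfl⟩
    have h0₀ : m₀ ≠ 0 := fun h => h0 (congrArg Subtype.val h)
    -- The filtration that Γ induces on A m need not be the one by degree; independence of the good
    -- filtration permits the exchange.
    rw [Γ.multiplicity_eq_add N Q, h2 _ (hΓ.quot N) Q,
      (hΓ.sub N).multiplicity_eq (cyclicFiltration_isGood hz₀ hspan₀) Q,
      cyclicFiltration_multiplicity hz₀ hspan₀ h0₀ Q]
    simp_rw [hq, Nat.cast_add, add_mul, Finset.sum_add_distrib]
    rw [add_comm]
    congr 1
    simp

/-- A weight module with finite-dimensional weight spaces of the weights `eps F` is finitely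
generated, and its multiplicities are determined by the dimensions of these weight spaces. -/
theorem IsWeight.finite {M : Type v} [AddCommGroup M] [Module k M]
    [Module (Weyl k n) M] [IsScalarTower k (Weyl k n) M] (hM : IsWeight k n M)
    (hfin : ∀ F : Finset (Fin n), Module.Finite k (wt k n M (eps F))) :
    Module.Finite (Weyl k n) M :=
  (weight_multiplicity_aux _ M hM hfin rfl).1

theorem IsWeight.multiplicity_eq {M : Type v} [AddCommGroup M] [Module k M]
    [Module (Weyl k n) M] [IsScalarTower k (Weyl k n) M] (hM : IsWeight k n M)
    (hfin : ∀ F : Finset (Fin n), Module.Finite k (wt k n M (eps F)))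
    {Γ : WeylFiltration k n M} (hΓ : Γ.IsGood) (Q : Ideal (MvPolynomial (Fin n ⊕ Fin n) k))
    [Q.IsPrime] : Γ.multiplicity Q =
      ∑ F : Finset (Fin n), (Module.finrank k (wt k n M (eps F)) : ℕ∞) *
        Module.length (Localization.AtPrime Q)
          (LocalizedModule.AtPrime Q (MvPolynomial (Fin n ⊕ Fin n) k ⧸ qIdeal k F)) :=
  (weight_multiplicity_aux _ M hM hfin rfl).2 Γ hΓ Q

/-- The only variables in Q_G are its generators, and each Q_F contains exactly one of x_i, ∂_i for
every i, so no inclusion is proper. -/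
theorem qIdeal_le_iff {F G : Finset (Fin n)} : qIdeal k F ≤ qIdeal k G ↔ F = G := by
  refine ⟨fun h => ?_, fun h => h ▸ le_rfl⟩
  have key : ∀ s, (MvPolynomial.X s : MvPolynomial (Fin n ⊕ Fin n) k) ∈ qIdeal k G →
      s ∈ qVars G := by
    intro s hs
    rw [qIdeal, MvPolynomial.mem_ideal_span_X_image] at hs
    obtain ⟨i, hi, h1⟩ := hs (Finsupp.single s 1) (by simp [MvPolynomial.support_X])
    by_cases his : s = i
    · rwa [his]
    · exact absurd (Finsupp.single_eq_of_ne (Ne.symm his)) h1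
  ext i
  have h1 := key (zVar F i) (h (Ideal.subset_span ⟨_, zVar_mem_qVars F i, rfl⟩))
  obtain ⟨j, hj⟩ := exists_eq_zVar_of_mem_qVars G h1
  by_cases hF : i ∈ F <;> by_cases hG : j ∈ G <;> simp [zVar, hF, hG] at hj <;> subst hj <;>
    simp [hF, hG]

/-- By incomparability only the summand of F survives localization at Q_F, and it has length one. -/
theorem IsWeight.multiplicity_qIdeal {M : Type v} [AddCommGroup M] [Module k M]
    [Module (Weyl k n) M] [IsScalarTower k (Weyl k n) M] (hM : IsWeight k n M)
    (hfin : ∀ F : Finset (Fin n), Module.Finite k (wt k n M (eps F)))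
    {Γ : WeylFiltration k n M} (hΓ : Γ.IsGood) (F : Finset (Fin n)) :
    Γ.multiplicity (qIdeal k F) = Module.finrank k (wt k n M (eps F)) := by
  rw [hM.multiplicity_eq hfin hΓ, Finset.sum_eq_single F]
  · rw [length_localized_quotient_self, mul_one]
  · intro G _ hG
    have h1 := mt (length_localized_quotient_ne_zero_iff (qIdeal k F) (qIdeal k G)).1
      (fun h => hG (qIdeal_le_iff.1 h))
    rw [not_not.1 h1, mul_zero]
  · intro h
    exact absurd (Finset.mem_univ F) h

/-- Since Q is associated it lies in the support, so some summand of the multiplicity formula is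
nonzero: Q_F ≤ Q with M_{eps F} ≠ 0. Then Q_F is itself in the support and contains a minimal prime
of the annihilator, which is associated; minimality of Q makes all three primes equal. -/
theorem IsWeight.exists_eq_qIdeal {M : Type v} [AddCommGroup M] [Module k M]
    [Module (Weyl k n) M] [IsScalarTower k (Weyl k n) M] (hM : IsWeight k n M)
    (hfin : ∀ F : Finset (Fin n), Module.Finite k (wt k n M (eps F)))
    {Γ : WeylFiltration k n M} (hΓ : Γ.IsGood) {Q : Ideal (MvPolynomial (Fin n ⊕ Fin n) k)}
    (hQ : Q ∈ Γ.SS) : ∃ F : Finset (Fin n), Q = qIdeal k F := by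
  have hGr : Module.Finite (MvPolynomial (Fin n ⊕ Fin n) k) Γ.Gr := hΓ
  have hass : IsAssociatedPrime Q Γ.Gr := hQ.prop
  have hprime : Q.IsPrime := hass.isPrime
  have hmult : Γ.multiplicity Q ≠ 0 := by
    rw [WeylFiltration.multiplicity, length_localized_ne_zero_iff]
    rw [Module.support_eq_zeroLocus, PrimeSpectrum.mem_zeroLocus]
    have h := hass.annihilator_le
    rwa [Submodule.annihilator_top] at h
  rw [hM.multiplicity_eq hfin hΓ Q] at hmult
  obtain ⟨F, -, hF⟩ := Finset.exists_ne_zero_of_sum_ne_zero hmult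
  have hle : qIdeal k F ≤ Q := (length_localized_quotient_ne_zero_iff Q _).1
    (right_ne_zero_of_mul hF)
  have hF' : Γ.multiplicity (qIdeal k F) ≠ 0 := by
    rw [hM.multiplicity_qIdeal hfin hΓ F]
    exact left_ne_zero_of_mul hF
  rw [WeylFiltration.multiplicity, length_localized_ne_zero_iff, Module.support_eq_zeroLocus,
    PrimeSpectrum.mem_zeroLocus] at hF'
  obtain ⟨P, hP, hPF⟩ := Ideal.exists_minimalPrimes_le
    (show Module.annihilator (MvPolynomial (Fin n ⊕ Fin n) k) Γ.Gr ≤ qIdeal k F from hF')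
  have hPass := Module.associatedPrimes.minimalPrimes_annihilator_subset_associatedPrimes
    (MvPolynomial (Fin n ⊕ Fin n) k) Γ.Gr hP
  exact ⟨F, le_antisymm ((hQ.le_of_le hPass (hPF.trans hle)).trans hPF) hle⟩

end WeightMultiplicity

end CharCycle

namespace CharCycle

universe u v w

/-! ### Cochain complexes on families of finite sets -/

theorem submoduleOf_le_comap_restrict {A T T' : Type*} [Ring A] [AddCommGroup T] [Module A T]
    [AddCommGroup T'] [Module A T'] {Z B : Submodule A T} {Z' B' : Submodule A T'}
    (φ : T →ₗ[A] T') (hZ : ∀ z ∈ Z, φ z ∈ Z') (hB : ∀ z ∈ Z, z ∈ B → φ z ∈ B') :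
    B.submoduleOf Z ≤ (B'.submoduleOf Z').comap (φ.restrict hZ) :=
  fun z hz => hB z z.2 hz

/-- An isomorphism of subquotients that is induced by a linear map. -/
def subquotEquiv {A T T' : Type*} [Ring A] [AddCommGroup T] [Module A T] [AddCommGroup T']
    [Module A T'] {Z B : Submodule A T} {Z' B' : Submodule A T'} (φ : T →ₗ[A] T')
    (hZ : ∀ z ∈ Z, φ z ∈ Z') (hB : ∀ z ∈ Z, φ z ∈ B' ↔ z ∈ B)
    (hsurj : ∀ z' ∈ Z', ∃ z ∈ Z, z' - φ z ∈ B') :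
    (Z ⧸ B.submoduleOf Z) ≃ₗ[A] (Z' ⧸ B'.submoduleOf Z') :=
  LinearEquiv.ofBijective
    (Submodule.mapQ (B.submoduleOf Z) (B'.submoduleOf Z') (φ.restrict hZ)
      (submoduleOf_le_comap_restrict φ hZ fun z hz => (hB z hz).2)) (by
      refine ⟨?_, ?_⟩
      · rw [injective_iff_map_eq_zero]
        intro y hy
        obtain ⟨z, rfl⟩ := Submodule.Quotient.mk_surjective _ y
        rw [Submodule.mapQ_apply, Submodule.Quotient.mk_eq_zero] at hy
        rw [Submodule.Quotient.mk_eq_zero]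
        exact (hB z z.2).1 hy
      · intro y
        obtain ⟨z', rfl⟩ := Submodule.Quotient.mk_surjective _ y
        obtain ⟨z, hz, h⟩ := hsurj z' z'.2
        refine ⟨Submodule.Quotient.mk ⟨z, hz⟩, ?_⟩
        rw [Submodule.mapQ_apply, eq_comm]
        exact (Submodule.Quotient.eq _).2 h)

/-! ### Signs of removals from a finite ordered set -/

section Sign

variable {V : Type*} [LinearOrder V]

/-- The sign of `v` in `τ`, from the number of elements of `τ` before `v`. -/
def sgn (τ : Finset V) (v : V) : ℤ := (-1) ^ (τ.filter (· < v)).card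

theorem sgn_mul_self (τ : Finset V) (v : V) : sgn τ v * sgn τ v = 1 := by
  rw [sgn, ← pow_add, ← two_mul, pow_mul]
  simp

theorem sgn_erase_of_le {τ : Finset V} {v w : V} (h : w ≤ v) : sgn (τ.erase v) w = sgn τ w := by
  rw [sgn, sgn]
  congr 2
  ext a
  simp only [Finset.mem_filter, Finset.mem_erase]
  exact ⟨fun h' => ⟨h'.1.2, h'.2⟩, fun h' => ⟨⟨(h'.2.trans_le h).ne, h'.1⟩, h'.2⟩⟩

theorem sgn_erase_of_lt {τ : Finset V} {v w : V} (hv : v ∈ τ) (h : v < w) :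
    sgn (τ.erase v) w = - sgn τ w := by
  rw [sgn, sgn]
  have h1 : τ.filter (· < w) = insert v ((τ.erase v).filter (· < w)) := by
    ext a
    simp only [Finset.mem_filter, Finset.mem_erase, Finset.mem_insert]
    by_cases ha : a = v
    · subst ha
      simp [hv, h]
    · simp [ha]
  rw [h1, Finset.card_insert_of_notMem (by simp), pow_succ]
  ring

/-- Removing the smaller element lowers the position of the larger one, but not conversely; this
single change of parity makes two removals anticommute. -/
theorem sgn_mul_sgn_erase {τ : Finset V} {v w : V} (hv : v ∈ τ) (hw : w ∈ τ) (h : v ≠ w) :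
    sgn τ v * sgn (τ.erase v) w = -(sgn τ w * sgn (τ.erase w) v) := by
  rcases lt_or_gt_of_ne h with h | h
  · rw [sgn_erase_of_lt hv h, sgn_erase_of_le h.le]
    ring
  · rw [sgn_erase_of_lt hw h, sgn_erase_of_le h.le]
    ring

theorem sgn_map {V' : Type*} [LinearOrder V'] (e : V' ↪o V) (τ : Finset V') (v : V') :
    sgn (τ.map e.toEmbedding) (e v) = sgn τ v := by
  rw [sgn, sgn, Finset.filter_map, Finset.card_map]
  congr 3
  ext a
  simp

end Sign

/-- A covariant system of modules on the finite subsets of `V`. -/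
structure CoeffSystem (A : Type*) [Ring A] {V : Type*} (C : Finset V → Type*)
    [∀ σ, AddCommGroup (C σ)] [∀ σ, Module A (C σ)] where
  /-- the transition maps -/
  res : ∀ {σ τ : Finset V}, σ ⊆ τ → C σ →ₗ[A] C τ
  res_self : ∀ {σ : Finset V} (h : σ ⊆ σ) (x : C σ), res h x = x
  res_res : ∀ {σ τ υ : Finset V} (h : σ ⊆ τ) (h' : τ ⊆ υ) (x : C σ),
    res h' (res h x) = res (h.trans h') x

namespace CoeffSystem

variable {A : Type*} [Ring A] {V : Type*} [LinearOrder V] {C : Finset V → Type*}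
  [∀ σ, AddCommGroup (C σ)] [∀ σ, Module A (C σ)] (D : CoeffSystem A C)
  (𝒳 𝒴 𝒵 : Set (Finset V))

theorem res_congr {σ σ' τ : Finset V} (e : σ = σ') (h : σ ⊆ τ) (h' : σ' ⊆ τ) (m : ∀ σ, C σ) :
    D.res h (m σ) = D.res h' (m σ') := by
  subst e
  rfl

open Classical in
/-- The differential of the cochain complex on the family `𝒳`. -/
def diff : (∀ σ, C σ) →ₗ[A] ∀ σ, C σ :=
  LinearMap.pi fun τ => if τ ∈ 𝒳 then ∑ v ∈ τ, sgn τ v •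
    (D.res (τ.erase_subset v)).comp (LinearMap.proj (τ.erase v)) else 0

variable {𝒳}

theorem diff_apply {τ : Finset V} (h : τ ∈ 𝒳) (m : ∀ σ, C σ) :
    D.diff 𝒳 m τ = ∑ v ∈ τ, sgn τ v • D.res (τ.erase_subset v) (m (τ.erase v)) := by
  simp [diff, h, LinearMap.sum_apply]

theorem diff_apply_of_notMem {τ : Finset V} (h : τ ∉ 𝒳) (m : ∀ σ, C σ) : D.diff 𝒳 m τ = 0 := by
  simp [diff, h]

variable (𝒳)

/-- The cochains of degree `p` on `𝒳`, which live on the sets with `p` elements. -/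
def term (p : ℤ) : Submodule A (∀ σ, C σ) where
  carrier := {m | ∀ σ, ¬(σ ∈ 𝒳 ∧ (σ.card : ℤ) = p) → m σ = 0}
  zero_mem' := fun _ _ => rfl
  add_mem' := fun ha hb σ hσ => by simp [ha σ hσ, hb σ hσ]
  smul_mem' := fun P a ha σ hσ => by simp [ha σ hσ]

/-- The cocycles of degree `p`. -/
def cocyc (p : ℤ) : Submodule A (∀ σ, C σ) := term 𝒳 p ⊓ LinearMap.ker (D.diff 𝒳)

/-- The coboundaries of degree `p`. -/
def cobd (p : ℤ) : Submodule A (∀ σ, C σ) := (term 𝒳 (p - 1)).map (D.diff 𝒳)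

/-- The cohomology of the cochain complex on `𝒳`. -/
abbrev Coh (p : ℤ) : Type _ := D.cocyc 𝒳 p ⧸ (D.cobd 𝒳 p).submoduleOf (D.cocyc 𝒳 p)

/-- The complex on `𝒳` is exact. -/
def Acyclic : Prop := ∀ p, D.cocyc 𝒳 p ≤ D.cobd 𝒳 p

variable {𝒳 𝒴}

theorem eq_zero_of_mem_term {p : ℤ} {m : ∀ σ, C σ} (hm : m ∈ term (A := A) 𝒳 p) {σ : Finset V}
    (hσ : σ ∉ 𝒳) : m σ = 0 := hm σ fun h => hσ h.1

theorem diff_mem_term {p : ℤ} {m : ∀ σ, C σ} (hm : ∀ σ, (σ.card : ℤ) ≠ p → m σ = 0) :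
    D.diff 𝒳 m ∈ term (A := A) 𝒳 (p + 1) := by
  intro τ hτ
  by_cases h : τ ∈ 𝒳
  · rw [D.diff_apply h]
    refine Finset.sum_eq_zero fun v hv => ?_
    rw [hm, map_zero, smul_zero]
    have h1 := Finset.card_erase_add_one hv
    have h2 : (τ.card : ℤ) ≠ p + 1 := fun h' => hτ ⟨h, h'⟩
    omega
  · exact D.diff_apply_of_notMem h m

theorem diff_mem_term' {p : ℤ} {m : ∀ σ, C σ} (hm : m ∈ term (A := A) 𝒴 p) :
    D.diff 𝒳 m ∈ term (A := A) 𝒳 (p + 1) :=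
  D.diff_mem_term fun σ h => hm σ fun h' => h h'.2

/-- Removing v and then w cancels against removing w and then v. If an intermediate set is missing
from 𝒳, order convexity shows that the smallest set is missing too, and m vanishes there. -/
theorem diff_diff (h𝒳 : 𝒳.OrdConnected) (m : ∀ σ, C σ) (hm : ∀ σ, σ ∉ 𝒳 → m σ = 0) :
    D.diff 𝒳 (D.diff 𝒳 m) = 0 := by
  classical
  funext τ
  by_cases hτ : τ ∈ 𝒳
  swap
  · exact D.diff_apply_of_notMem hτ _
  -- Extension by zero of the transition maps into the fixed module C τ, so that values on equal
  -- sets can be compared without transport.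
  let g : Finset V → C τ := fun σ => if h : σ ⊆ τ then D.res h (m σ) else 0
  have h1 : ∀ v ∈ τ, sgn τ v • D.res (τ.erase_subset v) (D.diff 𝒳 m (τ.erase v)) =
      ∑ w ∈ τ.erase v, (sgn τ v * sgn (τ.erase v) w) • g ((τ.erase v).erase w) := by
    intro v _
    have hg : ∀ w, g ((τ.erase v).erase w) = D.res (τ.erase_subset v)
        (D.res ((τ.erase v).erase_subset w) (m ((τ.erase v).erase w))) := by
      intro w
      rw [D.res_res]
      exact dif_pos _
    by_cases hv : τ.erase v ∈ 𝒳
    · rw [D.diff_apply hv, map_sum, Finset.smul_sum]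
      refine Finset.sum_congr rfl fun w _ => ?_
      rw [hg, map_zsmul, mul_smul]
    · rw [D.diff_apply_of_notMem hv, map_zero, smul_zero]
      refine (Finset.sum_eq_zero fun w _ => ?_).symm
      rw [hg, hm, map_zero, map_zero, smul_zero]
      intro hw
      exact hv (h𝒳.out hw hτ ⟨Finset.erase_subset _ _, Finset.erase_subset _ _⟩)
  rw [D.diff_apply hτ, Finset.sum_congr rfl h1, Finset.sum_sigma']
  refine Finset.sum_involution (fun x _ => ⟨x.2, x.1⟩) ?_ ?_ ?_ ?_
  · rintro ⟨v, w⟩ hx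
    simp only [Finset.mem_sigma, Finset.mem_erase] at hx
    rw [sgn_mul_sgn_erase hx.1 hx.2.2 (Ne.symm hx.2.1), Finset.erase_right_comm, neg_smul,
      neg_add_cancel]
  · rintro ⟨v, w⟩ hx _ he
    simp only [Finset.mem_sigma, Finset.mem_erase] at hx
    rw [Sigma.mk.injEq] at he
    exact hx.2.1 he.1
  · rintro ⟨v, w⟩ hx
    simp only [Finset.mem_sigma, Finset.mem_erase] at hx ⊢
    exact ⟨hx.2.2, Ne.symm hx.2.1, hx.1⟩
  · rintro ⟨v, w⟩ _
    rfl

open Classical in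
/-- The restriction of a cochain to the family `𝒵`. -/
def cut : (∀ σ, C σ) →ₗ[A] ∀ σ, C σ :=
  LinearMap.pi fun τ => if τ ∈ 𝒵 then LinearMap.proj τ else 0

variable {𝒵}

theorem cut_apply {τ : Finset V} (h : τ ∈ 𝒵) (m : ∀ σ, C σ) : cut (A := A) 𝒵 m τ = m τ := by
  simp [cut, h]

theorem cut_apply_of_notMem {τ : Finset V} (h : τ ∉ 𝒵) (m : ∀ σ, C σ) :
    cut (A := A) 𝒵 m τ = 0 := by
  simp [cut, h]

theorem cut_mem_term {p : ℤ} {m : ∀ σ, C σ} (hm : m ∈ term (A := A) 𝒳 p) :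
    cut (A := A) 𝒵 m ∈ term (A := A) 𝒵 p := by
  intro σ hσ
  by_cases h : σ ∈ 𝒵
  · rw [cut_apply h]
    exact hm σ fun h' => hσ ⟨h, h'.2⟩
  · exact cut_apply_of_notMem h m

theorem term_mono (h : 𝒴 ⊆ 𝒳) (p : ℤ) : term (A := A) (C := C) 𝒴 p ≤ term 𝒳 p :=
  fun _ hm σ hσ => hm σ fun h' => hσ ⟨h h'.1, h'.2⟩

variable (h𝒴𝒳 : 𝒴 ⊆ 𝒳) (hup : ∀ σ ∈ 𝒴, ∀ τ ∈ 𝒳, σ ⊆ τ → τ ∈ 𝒴)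

-- Restriction to 𝒳 \ 𝒴 is a cochain map because a set outside the upper family 𝒴 has no subset in
-- 𝒴.
include hup in
theorem cut_diff {p : ℤ} {m : ∀ σ, C σ} (hm : m ∈ term (A := A) 𝒳 p) :
    cut (A := A) (𝒳 \ 𝒴) (D.diff 𝒳 m) = D.diff (𝒳 \ 𝒴) (cut (A := A) (𝒳 \ 𝒴) m) := by
  funext τ
  by_cases h : τ ∈ 𝒳 \ 𝒴
  · rw [cut_apply h, D.diff_apply h, D.diff_apply h.1]
    refine Finset.sum_congr rfl fun v _ => ?_
    congr 2
    by_cases h' : τ.erase v ∈ 𝒳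
    · have h1 : τ.erase v ∈ 𝒳 \ 𝒴 :=
        ⟨h', fun h'' => h.2 (hup _ h'' _ h.1 (Finset.erase_subset _ _))⟩
      rw [cut_apply h1]
    · rw [cut_apply_of_notMem (fun h'' => h' h''.1), eq_zero_of_mem_term hm h']
  · rw [cut_apply_of_notMem h, D.diff_apply_of_notMem h]

include h𝒴𝒳 hup in
theorem diff_eq_of_mem_term {p : ℤ} {m : ∀ σ, C σ} (hm : m ∈ term (A := A) 𝒴 p) :
    D.diff 𝒳 m = D.diff 𝒴 m := by
  funext τ
  by_cases h : τ ∈ 𝒴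
  · rw [D.diff_apply h, D.diff_apply (h𝒴𝒳 h)]
  · rw [D.diff_apply_of_notMem h]
    by_cases h' : τ ∈ 𝒳
    · rw [D.diff_apply h']
      refine Finset.sum_eq_zero fun v _ => ?_
      rw [eq_zero_of_mem_term hm, map_zero, smul_zero]
      exact fun h'' => h (hup _ h'' _ h' (Finset.erase_subset _ _))
    · exact D.diff_apply_of_notMem h' m

include h𝒴𝒳 in
theorem mem_term_of_cut_eq_zero {p : ℤ} {m : ∀ σ, C σ} (hm : m ∈ term (A := A) 𝒳 p)
    (h : cut (A := A) (𝒳 \ 𝒴) m = 0) : m ∈ term (A := A) 𝒴 p := by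
  intro σ hσ
  by_cases h1 : σ ∈ 𝒳
  · by_cases h2 : σ ∈ 𝒴
    · exact hm σ fun h' => hσ ⟨h2, h'.2⟩
    · rw [← cut_apply (A := A) (show σ ∈ 𝒳 \ 𝒴 from ⟨h1, h2⟩) m, h]
      rfl
  · exact eq_zero_of_mem_term hm h1

theorem cut_eq_self {p : ℤ} {m : ∀ σ, C σ} (hm : m ∈ term (A := A) 𝒵 p) :
    cut (A := A) 𝒵 m = m := by
  funext σ
  by_cases h : σ ∈ 𝒵
  · exact cut_apply h m
  · rw [cut_apply_of_notMem h, eq_zero_of_mem_term hm h]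

theorem cut_eq_zero {p : ℤ} {m : ∀ σ, C σ} (hm : m ∈ term (A := A) 𝒴 p) :
    cut (A := A) (𝒳 \ 𝒴) m = 0 := by
  funext σ
  by_cases h : σ ∈ 𝒳 \ 𝒴
  · rw [cut_apply h]
    exact eq_zero_of_mem_term hm h.2
  · exact cut_apply_of_notMem h m

theorem diff_diff_of_mem_term (h𝒳 : 𝒳.OrdConnected) {p : ℤ} {m : ∀ σ, C σ}
    (hm : m ∈ term (A := A) 𝒳 p) : D.diff 𝒳 (D.diff 𝒳 m) = 0 :=
  D.diff_diff h𝒳 m fun _ hσ => eq_zero_of_mem_term hm hσ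

include h𝒴𝒳 hup in
/-- If the part of the complex on an upper subfamily is exact, it may be dropped. -/
def cohEquivDiff (h𝒳 : 𝒳.OrdConnected) (hac : D.Acyclic 𝒴) (p : ℤ) :
    D.Coh 𝒳 p ≃ₗ[A] D.Coh (𝒳 \ 𝒴) p := by
  have hsub : 𝒳 \ 𝒴 ⊆ 𝒳 := fun _ h => h.1
  -- Cochains on 𝒴 form a subcomplex whose quotient is the complex on 𝒳 \ 𝒴. The three goals are the
  -- diagram chases of the long exact sequence, with `hac` supplying primitives on 𝒴.
  refine subquotEquiv (cut (A := A) (𝒳 \ 𝒴)) ?_ ?_ ?_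
  · rintro z ⟨hz, hd⟩
    refine ⟨cut_mem_term hz, ?_⟩
    rw [SetLike.mem_coe, LinearMap.mem_ker, ← D.cut_diff hup hz, LinearMap.mem_ker.1 hd, map_zero]
  · rintro z ⟨hz, hd⟩
    refine ⟨?_, ?_⟩
    · rintro ⟨w, hw, h⟩
      have hw' := term_mono hsub _ hw
      have h0 := D.cut_diff hup hw'
      rw [cut_eq_self hw, h] at h0
      have h1 : z - D.diff 𝒳 w ∈ term (A := A) 𝒳 p := by
        refine Submodule.sub_mem _ hz ?_
        have := D.diff_mem_term' (𝒳 := 𝒳) hw'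
        rwa [sub_add_cancel] at this
      have h2 := mem_term_of_cut_eq_zero h𝒴𝒳 h1 (by rw [map_sub, h0, sub_self])
      obtain ⟨w', hw'', h3⟩ := hac p ⟨h2, by
        rw [SetLike.mem_coe, LinearMap.mem_ker, ← D.diff_eq_of_mem_term h𝒴𝒳 hup h2, map_sub,
          LinearMap.mem_ker.1 hd, D.diff_diff_of_mem_term h𝒳 hw', sub_zero]⟩
      refine ⟨w + w', Submodule.add_mem _ hw' (term_mono h𝒴𝒳 _ hw''), ?_⟩
      rw [map_add, D.diff_eq_of_mem_term h𝒴𝒳 hup hw'', h3]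
      abel
    · rintro ⟨w, hw, rfl⟩
      exact ⟨_, cut_mem_term hw, (D.cut_diff hup hw).symm⟩
  · rintro z ⟨hz, hd⟩
    have hz' := term_mono hsub _ hz
    have h0 := D.cut_diff hup hz'
    rw [cut_eq_self hz, LinearMap.mem_ker.1 hd] at h0
    have h1 := mem_term_of_cut_eq_zero h𝒴𝒳 (D.diff_mem_term' (𝒳 := 𝒳) hz') h0
    obtain ⟨w, hw, h2⟩ := hac (p + 1) ⟨h1, by
      rw [SetLike.mem_coe, LinearMap.mem_ker, ← D.diff_eq_of_mem_term h𝒴𝒳 hup h1,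
        D.diff_diff_of_mem_term h𝒳 hz']⟩
    rw [add_sub_cancel_right] at hw
    refine ⟨z - w, ⟨Submodule.sub_mem _ hz' (term_mono h𝒴𝒳 _ hw), ?_⟩, ?_⟩
    · rw [SetLike.mem_coe, LinearMap.mem_ker, map_sub, D.diff_eq_of_mem_term h𝒴𝒳 hup hw, h2, sub_self]
    · rw [map_sub, cut_eq_self hz, cut_eq_zero hw, sub_zero, sub_self]
      exact Submodule.zero_mem _

include h𝒴𝒳 hup in
/-- If the part of the complex off an upper subfamily is exact, it may be dropped. -/
def cohEquivUpper (h𝒳 : 𝒳.OrdConnected) (hac : D.Acyclic (𝒳 \ 𝒴)) (p : ℤ) :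
    D.Coh 𝒴 p ≃ₗ[A] D.Coh 𝒳 p := by
  have hsub : 𝒳 \ 𝒴 ⊆ 𝒳 := fun _ h => h.1
  -- A cochain whose restriction off 𝒴 is a cocycle can be moved into 𝒴 by subtracting a coboundary.
  have key : ∀ (q : ℤ) (m : ∀ σ, C σ), m ∈ term (A := A) 𝒳 q →
      cut (A := A) (𝒳 \ 𝒴) (D.diff 𝒳 m) = 0 →
      ∃ w ∈ term (A := A) 𝒳 (q - 1), m - D.diff 𝒳 w ∈ term (A := A) 𝒴 q := by
    intro q m hm h
    obtain ⟨w, hw, h1⟩ := hac q ⟨cut_mem_term (𝒵 := 𝒳 \ 𝒴) hm, by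
      rw [SetLike.mem_coe, LinearMap.mem_ker, ← D.cut_diff hup hm, h]⟩
    have hw' := term_mono hsub _ hw
    refine ⟨w, hw', mem_term_of_cut_eq_zero h𝒴𝒳 (Submodule.sub_mem _ hm ?_) ?_⟩
    · have := D.diff_mem_term' (𝒳 := 𝒳) hw'
      rwa [sub_add_cancel] at this
    · rw [map_sub, D.cut_diff hup hw', cut_eq_self hw, h1, sub_self]
  refine subquotEquiv LinearMap.id ?_ ?_ ?_
  · rintro z ⟨hz, hd⟩
    refine ⟨term_mono h𝒴𝒳 _ hz, ?_⟩
    rwa [SetLike.mem_coe, LinearMap.mem_ker, LinearMap.id_apply, D.diff_eq_of_mem_term h𝒴𝒳 hup hz]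
  · rintro z ⟨hz, hd⟩
    refine ⟨?_, ?_⟩
    · rintro ⟨w, hw, h⟩
      rw [LinearMap.id_apply] at h
      obtain ⟨w', hw', h1⟩ := key _ w hw (by rw [h, cut_eq_zero hz])
      refine ⟨_, h1, ?_⟩
      rw [← D.diff_eq_of_mem_term h𝒴𝒳 hup h1, map_sub, D.diff_diff_of_mem_term h𝒳 hw', sub_zero, h]
    · rintro ⟨w, hw, h⟩
      refine ⟨w, term_mono h𝒴𝒳 _ hw, ?_⟩
      rw [D.diff_eq_of_mem_term h𝒴𝒳 hup hw, h, LinearMap.id_apply]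
  · rintro z ⟨hz, hd⟩
    obtain ⟨w, hw, h1⟩ := key p z hz (by rw [LinearMap.mem_ker.1 hd, map_zero])
    refine ⟨_, ⟨h1, ?_⟩, w, hw, ?_⟩
    · rw [SetLike.mem_coe, LinearMap.mem_ker, ← D.diff_eq_of_mem_term h𝒴𝒳 hup h1, map_sub,
        D.diff_diff_of_mem_term h𝒳 hw, LinearMap.mem_ker.1 hd, sub_zero]
    · rw [LinearMap.id_apply, sub_sub_cancel]

end CoeffSystem

/-! ### Reindexing along order embeddings -/

section Embedding

open CoeffSystem

variable {A : Type*} [Ring A] {V W : Type*} [LinearOrder V] [LinearOrder W]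
  {C : Finset V → Type*} [∀ σ, AddCommGroup (C σ)] [∀ σ, Module A (C σ)] (D : CoeffSystem A C)
  {C' : Finset W → Type*} [∀ σ, AddCommGroup (C' σ)] [∀ σ, Module A (C' σ)]
  (D' : CoeffSystem A C') (e : W ↪o V) (ψ : ∀ σ, C' σ ≃ₗ[A] C (σ.map e.toEmbedding))
  (hψ : ∀ {σ τ : Finset W} (h : σ ⊆ τ) (x : C' σ),
    ψ τ (D'.res h x) = D.res (Finset.map_subset_map.2 h) (ψ σ x))
  (𝒳' : Set (Finset W))

/-- The pullback of cochains along an order embedding. -/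
def pull : (∀ σ, C σ) →ₗ[A] ∀ σ, C' σ :=
  LinearMap.pi fun σ => (ψ σ).symm.toLinearMap.comp (LinearMap.proj (σ.map e.toEmbedding))

/-- The pushforward of cochains along an order embedding. -/
def push (m : ∀ σ, C' σ) (τ : Finset V) : C τ := open Classical in
  if τ ∈ Finset.map e.toEmbedding '' 𝒳' then
    D.res (show (τ.preimage e e.injective.injOn).map e.toEmbedding ⊆ τ by
      intro a ha
      obtain ⟨b, hb, rfl⟩ := Finset.mem_map.1 ha
      exact Finset.mem_preimage.1 hb) (ψ _ (m (τ.preimage e e.injective.injOn)))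
  else 0

theorem pull_apply (m : ∀ σ, C σ) (σ : Finset W) :
    pull e ψ m σ = (ψ σ).symm (m (σ.map e.toEmbedding)) := rfl

theorem push_map_apply (m : ∀ σ, C' σ) {σ : Finset W} (hσ : σ ∈ 𝒳') :
    push D e ψ 𝒳' m (σ.map e.toEmbedding) = ψ σ (m σ) := by
  have key : ∀ ρ, ρ = σ → ∀ h : ρ.map e.toEmbedding ⊆ σ.map e.toEmbedding,
      D.res h (ψ ρ (m ρ)) = ψ σ (m σ) := by
    rintro ρ rfl h
    exact D.res_self h _
  rw [push, if_pos ⟨σ, hσ, rfl⟩]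
  refine key _ ?_ _
  ext a
  simp

theorem pull_push (m : ∀ σ, C' σ) (hm : ∀ σ, σ ∉ 𝒳' → m σ = 0) :
    pull e ψ (push D e ψ 𝒳' m) = m := by
  funext σ
  rw [pull_apply]
  by_cases h : σ ∈ 𝒳'
  · rw [push_map_apply D e ψ 𝒳' m h, LinearEquiv.symm_apply_apply]
  · rw [push, if_neg, map_zero, hm σ h]
    rintro ⟨ρ, hρ, h'⟩
    rw [Finset.map_inj] at h'
    exact h (h' ▸ hρ)

theorem push_mem_term (m : ∀ σ, C' σ) {p : ℤ} (hm : m ∈ term (A := A) 𝒳' p) :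
    push D e ψ 𝒳' m ∈ term (A := A) (Finset.map e.toEmbedding '' 𝒳') p := by
  intro τ hτ
  by_cases h : τ ∈ Finset.map e.toEmbedding '' 𝒳'
  · obtain ⟨σ, hσ, rfl⟩ := h
    rw [push_map_apply D e ψ 𝒳' m hσ, hm, map_zero]
    rintro ⟨-, h⟩
    exact hτ ⟨⟨σ, hσ, rfl⟩, by rwa [Finset.card_map]⟩
  · rw [push, if_neg h]

theorem pull_mem_term (m : ∀ σ, C σ) {p : ℤ}
    (hm : m ∈ term (A := A) (Finset.map e.toEmbedding '' 𝒳') p) :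
    pull e ψ m ∈ term (A := A) 𝒳' p := by
  intro σ hσ
  rw [pull_apply, hm, map_zero]
  rintro ⟨⟨ρ, hρ, h⟩, h'⟩
  rw [Finset.map_inj] at h
  rw [Finset.card_map] at h'
  exact hσ ⟨h ▸ hρ, h'⟩

include hψ in
theorem pull_diff (m : ∀ σ, C σ) :
    pull e ψ (D.diff (Finset.map e.toEmbedding '' 𝒳') m) = D'.diff 𝒳' (pull e ψ m) := by
  funext σ
  rw [pull_apply]
  by_cases h : σ ∈ 𝒳'
  · have h1 : σ.map e.toEmbedding ∈ Finset.map e.toEmbedding '' 𝒳' := ⟨σ, h, rfl⟩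
    rw [D.diff_apply h1, D'.diff_apply h, LinearEquiv.symm_apply_eq, map_sum,
      Finset.sum_map]
    refine Finset.sum_congr rfl fun v _ => ?_
    rw [map_zsmul, hψ, pull_apply, LinearEquiv.apply_symm_apply]
    congr 1
    · exact sgn_map e σ v
    · exact D.res_congr (by rw [Finset.map_erase]) _ _ m
  · rw [D'.diff_apply_of_notMem h, D.diff_apply_of_notMem, map_zero]
    rintro ⟨ρ, hρ, h'⟩
    rw [Finset.map_inj] at h'
    exact h (h' ▸ hρ)

theorem eq_of_pull_eq {p : ℤ} {m m' : ∀ σ, C σ}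
    (hm : m ∈ term (A := A) (Finset.map e.toEmbedding '' 𝒳') p)
    (hm' : m' ∈ term (A := A) (Finset.map e.toEmbedding '' 𝒳') p)
    (h : pull e ψ m = pull e ψ m') : m = m' := by
  funext τ
  by_cases hτ : τ ∈ Finset.map e.toEmbedding '' 𝒳'
  · obtain ⟨σ, hσ, rfl⟩ := hτ
    have h1 := congrFun h σ
    rw [pull_apply, pull_apply] at h1
    exact (ψ σ).symm.injective h1
  · rw [eq_zero_of_mem_term hm hτ, eq_zero_of_mem_term hm' hτ]

include hψ in
/-- The cohomology of a family is invariant under order embeddings. -/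
def cohEquivMap (p : ℤ) : D.Coh (Finset.map e.toEmbedding '' 𝒳') p ≃ₗ[A] D'.Coh 𝒳' p := by
  refine subquotEquiv (pull e ψ) ?_ ?_ ?_
  · rintro z ⟨hz, hd⟩
    refine ⟨pull_mem_term e ψ 𝒳' z hz, ?_⟩
    rw [SetLike.mem_coe, LinearMap.mem_ker, ← pull_diff D D' e ψ hψ, LinearMap.mem_ker.1 hd, map_zero]
  · rintro z ⟨hz, hd⟩
    refine ⟨?_, ?_⟩
    · rintro ⟨w, hw, h⟩
      refine ⟨_, push_mem_term D e ψ 𝒳' w hw, ?_⟩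
      refine eq_of_pull_eq e ψ 𝒳' ?_ hz ?_ (p := p)
      · have := D.diff_mem_term' (𝒳 := Finset.map e.toEmbedding '' 𝒳')
          (push_mem_term D e ψ 𝒳' w hw)
        rwa [sub_add_cancel] at this
      · rw [pull_diff D D' e ψ hψ,
          pull_push D e ψ 𝒳' w fun σ hσ => eq_zero_of_mem_term hw hσ, h]
    · rintro ⟨w, hw, rfl⟩
      exact ⟨_, pull_mem_term e ψ 𝒳' w hw, (pull_diff D D' e ψ hψ 𝒳' w).symm⟩
  · rintro z ⟨hz, hd⟩
    have h1 := pull_push D e ψ 𝒳' z fun σ hσ => eq_zero_of_mem_term hz hσ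
    refine ⟨_, ⟨push_mem_term D e ψ 𝒳' z hz, ?_⟩, ?_⟩
    · refine eq_of_pull_eq e ψ 𝒳' (D.diff_mem_term' (push_mem_term D e ψ 𝒳' z hz))
        (Submodule.zero_mem _) ?_
      rw [pull_diff D D' e ψ hψ, h1, LinearMap.mem_ker.1 hd, map_zero]
    · rw [h1, sub_self]
      exact Submodule.zero_mem _

end Embedding

end CharCycle

namespace CharCycle

universe u v w

open CoeffSystem

/-! ### The Čech complex does not depend on the generators -/

section Lift

variable {A : Type*} [Ring A] {V : Type*} [LinearOrder V] {C : Finset V → Type*}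
  [∀ σ, AddCommGroup (C σ)] [∀ σ, Module A (C σ)] (D : CoeffSystem A C)
  {μ : ∀ σ, C σ →+ C σ}
  (hres : ∀ {σ τ : Finset V} (h : σ ⊆ τ) (x : C σ), D.res h (μ σ x) = μ τ (D.res h x))

include hres in
/-- If the values of `μ z` on the sets that contain `j` lift along the removal of `j`, then
`μ z` is a coboundary. -/
theorem exists_diff_eq_of_lift {𝒴 : Set (Finset V)} {j : V}
    (hins : ∀ τ ∈ 𝒴, insert j τ ∈ 𝒴) (hera : ∀ τ ∈ 𝒴, τ.erase j ∈ 𝒴)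
    (hinj : ∀ τ ∈ 𝒴, j ∉ τ → Function.Injective (D.res (Finset.subset_insert j τ)))
    {q : ℤ} {z : ∀ σ, C σ} (hz : z ∈ D.cocyc 𝒴 q) {a : ∀ σ, C σ}
    (ha : ∀ σ, j ∉ σ → ∀ (τ : Finset V) (h : σ ⊆ τ) (h' : insert j σ ⊆ τ),
      D.res h (a σ) = μ τ (D.res h' (z (insert j σ)))) :
    ∃ w ∈ term (A := A) 𝒴 (q - 1), D.diff 𝒴 w = fun σ => μ σ (z σ) := by
  classical
  obtain ⟨hzt, hzd⟩ := hz
  -- A contracting homotopy in direction `j`, with the chosen lifts in place of the values of z on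
  -- sets that contain `j`.
  let w : ∀ σ, C σ := fun σ =>
    if σ ∈ 𝒴 ∧ (σ.card : ℤ) = q - 1 ∧ j ∉ σ then sgn (insert j σ) j • a σ else 0
  refine ⟨w, ?_, ?_⟩
  · intro σ hσ
    exact if_neg fun h => hσ ⟨h.1, h.2.1⟩
  funext τ
  by_cases hτ : τ ∈ 𝒴
  swap
  · rw [D.diff_apply_of_notMem hτ, eq_zero_of_mem_term hzt hτ, map_zero]
  by_cases hcard : (τ.card : ℤ) = q
  swap
  · rw [hzt τ fun h => hcard h.2, map_zero, D.diff_apply hτ]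
    refine Finset.sum_eq_zero fun v hv => ?_
    have h1 := Finset.card_erase_add_one hv
    have h2 : w (τ.erase v) = 0 := if_neg fun h => hcard (by omega)
    rw [h2, map_zero, smul_zero]
  rw [D.diff_apply hτ]
  -- If j ∈ τ, only the removal of `j` contributes, since `w` lives on sets without `j`. If j ∉ τ,
  -- the equality is tested after the injective restriction to τ ∪ {j}, where it becomes the cocycle
  -- condition for z.
  by_cases hjτ : j ∈ τ
  · rw [Finset.sum_eq_single j]
    · have h1 := hera τ hτ
      have h2 := Finset.card_erase_add_one hjτ
      have h3 : w (τ.erase j) = sgn (insert j (τ.erase j)) j • a (τ.erase j) :=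
        if_pos ⟨h1, by omega, by simp⟩
      have h4 : insert j (τ.erase j) = τ := Finset.insert_erase hjτ
      rw [h3, map_zsmul, ha _ (by simp) _ _ h4.le,
        D.res_congr h4 _ subset_rfl, D.res_self, smul_smul, h4,
        sgn_mul_self, one_smul]
    · intro v hv hvj
      have h2 : w (τ.erase v) = 0 :=
        if_neg fun h => h.2.2 (Finset.mem_erase.2 ⟨Ne.symm hvj, hjτ⟩)
      rw [h2, map_zero, smul_zero]
    · intro h
      exact absurd hjτ h
  · set τ' := insert j τ with hτ'
    have hττ' : τ ⊆ τ' := Finset.subset_insert j τ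
    have hτ'J : τ' ∈ 𝒴 := hins τ hτ
    apply hinj τ hτ hjτ
    rw [map_sum]
    let G : Finset V → C τ' := fun σ =>
      if h : σ ⊆ τ' then D.res h (z σ) else 0
    have hG : ∀ {σ : Finset V} (h : σ ⊆ τ'), D.res h (z σ) = G σ :=
      fun {σ} h => by simp only [G, dif_pos h]
    have herase : ∀ v ∈ τ, τ'.erase v = insert j (τ.erase v) := fun v hv =>
      Finset.erase_insert_of_ne fun h => hjτ (h ▸ hv)
    have hjerase : τ'.erase j = τ := Finset.erase_insert hjτ
    have hcoc : ∑ v ∈ τ, sgn τ' v • G (τ'.erase v) = -(sgn τ' j • G τ) := by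
      have h1 : D.diff (𝒴) z τ' = 0 := by
        rw [LinearMap.mem_ker.1 hzd]
        rfl
      rw [D.diff_apply hτ'J, Finset.sum_insert hjτ] at h1
      rw [eq_neg_iff_add_eq_zero, add_comm, ← h1, hG, hjerase]
      congr 1
      exact Finset.sum_congr rfl fun v _ => by rw [hG]
    have hw : ∀ v ∈ τ, D.res hττ' (sgn τ v • D.res
        (τ.erase_subset v) (w (τ.erase v))) =
        (sgn τ v * sgn (τ'.erase v) j) • μ τ' (G (τ'.erase v)) := by
      intro v hv
      have hjv : j ∉ τ.erase v := fun h => hjτ (Finset.mem_of_mem_erase h)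
      have h5 := Finset.card_erase_add_one hv
      by_cases hvp : τ.erase v ∈ 𝒴
      · have h3 : w (τ.erase v) = sgn (insert j (τ.erase v)) j • a (τ.erase v) :=
          if_pos ⟨hvp, by omega, hjv⟩
        rw [map_zsmul, D.res_res, h3, map_zsmul, smul_smul, herase v hv,
          ha _ hjv τ' _ (Finset.insert_subset_insert j (Finset.erase_subset _ _)), hG]
      · have h3 : w (τ.erase v) = 0 := if_neg fun h => hvp h.1
        have h4 : z (τ'.erase v) = 0 := by
          refine eq_zero_of_mem_term hzt fun h => hvp ?_
          have h6 := hera _ h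
          rwa [herase v hv, Finset.erase_insert hjv] at h6
        rw [h3, ← hG (Finset.erase_subset _ _), h4, map_zero, smul_zero, map_zero, map_zero,
          map_zero, smul_zero]
    rw [Finset.sum_congr rfl hw, hres, hG]
    have hs : ∀ v ∈ τ, (sgn τ v * sgn (τ'.erase v) j) • μ τ' (G (τ'.erase v)) =
        (-sgn τ' j) • μ τ' (sgn τ' v • G (τ'.erase v)) := by
      intro v hv
      rw [map_zsmul, smul_smul]
      congr 1
      have h6 := sgn_mul_sgn_erase (hττ' hv) (Finset.mem_insert_self j τ)
        (fun h => hjτ (h ▸ hv))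
      rw [hjerase] at h6
      have h7 := sgn_mul_self τ' v
      have h8 := sgn_mul_self τ' j
      calc sgn τ v * sgn (τ'.erase v) j
          = sgn τ v * (sgn τ' v * sgn τ' v) * sgn (τ'.erase v) j := by rw [h7, mul_one]
        _ = sgn τ v * sgn τ' v * (sgn τ' v * sgn (τ'.erase v) j) := by ring
        _ = -sgn τ' j * sgn τ' v * (sgn τ v * sgn τ v) := by rw [h6]; ring
        _ = -sgn τ' j * sgn τ' v := by rw [sgn_mul_self, mul_one]
    rw [Finset.sum_congr rfl hs, ← Finset.smul_sum, ← map_sum, hcoc, map_neg, smul_neg,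
      neg_smul, neg_neg, map_zsmul, smul_smul, sgn_mul_self, one_smul]

end Lift

/-! ### Transition maps between localizations -/

section LocRes

variable {k : Type u} [Field k] {n : ℕ} {g h l : MvPolynomial (Fin n) k}

theorem locRes_self (hg : g ∣ g) (a : Localization.Away g) : locRes hg a = a := by
  have : locRes hg = RingHom.id _ := by
    apply IsLocalization.ringHom_ext (Submonoid.powers g)
    exact RingHom.ext fun s => locRes_algebraMap hg s
  rw [this, RingHom.id_apply]

theorem locRes_locRes (h₁ : g ∣ h) (h₂ : h ∣ l) (a : Localization.Away g) :
    locRes h₂ (locRes h₁ a) = locRes (h₁.trans h₂) a := by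
  have : (locRes h₂).comp (locRes h₁) = locRes (h₁.trans h₂) := by
    apply IsLocalization.ringHom_ext (Submonoid.powers g)
    refine RingHom.ext fun s => ?_
    simp only [RingHom.comp_apply, locRes_algebraMap]
  exact DFunLike.congr_fun this a

theorem locRes_polynomial_smul (h₁ : g ∣ h) (s : MvPolynomial (Fin n) k)
    (a : Localization.Away g) : locRes h₁ (s • a) = s • locRes h₁ a := by
  rw [Algebra.smul_def, Algebra.smul_def, map_mul, locRes_algebraMap]

theorem exists_pow_smul_eq_algebraMap (a : Localization.Away g) :
    ∃ (N : ℕ) (s : MvPolynomial (Fin n) k), g ^ N • a = algebraMap _ _ s := by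
  obtain ⟨⟨s, y⟩, hy⟩ := IsLocalization.surj (Submonoid.powers g) a
  obtain ⟨N, hN⟩ := y.2
  refine ⟨N, s, ?_⟩
  rw [← hy, Algebra.smul_def, mul_comm]
  congr 2

theorem smul_injective_of_dvd (h₁ : h ∣ g) (N : ℕ) {a b : Localization.Away g}
    (hab : h ^ N • a = h ^ N • b) : a = b := by
  rw [Algebra.smul_def, Algebra.smul_def, map_pow] at hab
  exact ((isUnit_of_dvd h₁).pow N).mul_left_cancel hab

/-- A numerator that vanishes in S_h is zero because S is a domain. For h = 0 this argument fails,
and the hypothesis makes S_g the zero ring. -/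
theorem locRes_injective (h₁ : g ∣ h) (h0 : h = 0 → g = 0) : Function.Injective (locRes h₁) := by
  rw [injective_iff_map_eq_zero]
  intro a ha
  by_cases hg : g = 0
  · refine smul_injective_of_dvd (dvd_refl g) 1 ?_
    rw [smul_zero, Algebra.smul_def, map_pow, pow_one,
      (congrArg (algebraMap _ (Localization.Away g)) hg).trans (map_zero _), zero_mul]
  obtain ⟨N, s, hs⟩ := exists_pow_smul_eq_algebraMap a
  have h2 : algebraMap _ (Localization.Away h) s = 0 := by
    rw [← locRes_algebraMap h₁, ← hs, locRes_polynomial_smul, ha, smul_zero]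
  have h3 : s = 0 := by
    refine IsLocalization.injective (Localization.Away h) (M := Submonoid.powers h) ?_
      (h2.trans (map_zero _).symm)
    exact powers_le_nonZeroDivisors_of_noZeroDivisors fun h => hg (h0 h)
  refine smul_injective_of_dvd (dvd_refl g) N ?_
  rw [hs, h3, map_zero, smul_zero]

/-- An element of `S_{gh}` becomes an element of `S_g` after multiplication by a power of `h`. -/
theorem exists_locRes_eq_pow_smul (h₁ : g ∣ l) (h₂ : l ∣ h * g)
    (y : Localization.Away l) :
    ∃ N : ℕ, ∃ a : Localization.Away g, locRes h₁ a = h ^ N • y := by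
  obtain ⟨N, s, hs⟩ := exists_pow_smul_eq_algebraMap y
  obtain ⟨c, hc⟩ := h₂
  -- With h g = l c and l^N y = s, the fraction c^N s / g^N maps to h^N y: multiplied by g^N, both
  -- become c^N l^N y.
  refine ⟨N, IsLocalization.mk' (Localization.Away g) (c ^ N * s)
    (⟨g ^ N, N, rfl⟩ : Submonoid.powers g), ?_⟩
  refine smul_injective_of_dvd h₁ N ?_
  rw [← locRes_polynomial_smul]
  have h4 : g ^ N • IsLocalization.mk' (Localization.Away g) (c ^ N * s)
      (⟨g ^ N, N, rfl⟩ : Submonoid.powers g) = algebraMap _ _ (c ^ N * s) := by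
    rw [Algebra.smul_def, mul_comm]
    exact IsLocalization.mk'_spec _ _ _
  rw [h4, locRes_algebraMap, map_mul, ← hs, ← Algebra.smul_def, smul_smul, smul_smul, ← mul_pow,
    ← mul_pow, mul_comm g h, hc, mul_comm c l]

end LocRes

/-! ### Čech cohomology under the addition of redundant generators -/

section System

variable {k : Type u} [Field k] {n r : ℕ} (f : Fin r → MvPolynomial (Fin n) k)

/-- The localizations of `S` at the products of the `f_j`. -/
def cechSystem : CoeffSystem (Weyl k n)
    (fun σ : Finset (Fin r) => Localization.Away (∏ j ∈ σ, f j)) where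
  res h := locResLinear (Finset.prod_dvd_prod_of_subset _ _ f h)
  res_self h x := locRes_self (Finset.prod_dvd_prod_of_subset _ _ f h) x
  res_res h h' x := locRes_locRes (Finset.prod_dvd_prod_of_subset _ _ f h)
    (Finset.prod_dvd_prod_of_subset _ _ f h') x

theorem cechSystem_res {σ τ : Finset (Fin r)} (h : σ ⊆ τ)
    (x : Localization.Away (∏ j ∈ σ, f j)) : (cechSystem f).res h x =
      locRes (Finset.prod_dvd_prod_of_subset _ _ f h) x := rfl

theorem cechSystem_diff : (cechSystem f).diff Set.univ = cechD f := by
  refine LinearMap.ext fun m => funext fun τ => ?_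
  rw [(cechSystem f).diff_apply (Set.mem_univ τ)]
  simp only [cechD, LinearMap.pi_apply, LinearMap.sum_apply]
  rfl

theorem term_univ_eq_cechTerm (i : ℕ) :
    term (A := Weyl k n) (C := fun σ : Finset (Fin r) => Localization.Away (∏ j ∈ σ, f j))
      Set.univ i = cechTerm f i := by
  ext m
  simp [term, cechTerm]

theorem term_univ_of_neg (p : ℤ) (hp : p < 0) :
    term (A := Weyl k n) (C := fun σ : Finset (Fin r) => Localization.Away (∏ j ∈ σ, f j))
      Set.univ p = ⊥ := by
  rw [eq_bot_iff]
  intro m hm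
  rw [Submodule.mem_bot]
  funext σ
  exact hm σ fun h => by omega

/-- Local cohomology as the cohomology of the system of localizations. -/
def localCohomologyEquiv (i : ℕ) :
    LocalCohomology f i ≃ₗ[Weyl k n] (cechSystem f).Coh Set.univ i := by
  refine subquotEquiv LinearMap.id ?_ ?_ ?_
  · intro z hz
    rw [cocyc, term_univ_eq_cechTerm, cechSystem_diff]
    exact hz
  · intro z _
    rw [cobd, cechSystem_diff]
    -- In degree 0 the coboundaries of the system come from degree -1, where there are no cochains.
    cases i with
    | zero =>
      rw [term_univ_of_neg f _ (by simp), Submodule.map_bot]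
      rfl
    | succ i =>
      rw [Nat.cast_succ, add_sub_cancel_right, term_univ_eq_cechTerm]
      rfl
  · intro z hz
    rw [cocyc, term_univ_eq_cechTerm, cechSystem_diff] at hz
    exact ⟨z, hz, by simp⟩

theorem cechSystem_diff_smul (𝒳 : Set (Finset (Fin r))) (s : MvPolynomial (Fin n) k)
    (m : CechTotal f) : (cechSystem f).diff 𝒳 (s • m) = s • (cechSystem f).diff 𝒳 m := by
  funext τ
  by_cases h : τ ∈ 𝒳
  · rw [Pi.smul_apply, (cechSystem f).diff_apply h, (cechSystem f).diff_apply h, Finset.smul_sum]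
    refine Finset.sum_congr rfl fun v _ => ?_
    rw [smul_comm, Pi.smul_apply, cechSystem_res, cechSystem_res, locRes_polynomial_smul]
  · rw [Pi.smul_apply, (cechSystem f).diff_apply_of_notMem h,
      (cechSystem f).diff_apply_of_notMem h, smul_zero]

variable {f}

/-- The sets between `{p}` and `J ∪ {p}`. -/
def starFamily (J : Finset (Fin r)) (p : Fin r) : Set (Finset (Fin r)) :=
  {σ | σ ⊆ insert p J ∧ p ∈ σ}

theorem exists_uniform_lift {j : Fin r} (z : CechTotal f) :
    ∃ (N : ℕ) (a : CechTotal f), ∀ σ, j ∉ σ → ∀ (τ : Finset (Fin r)) (h : σ ⊆ τ)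
      (h' : insert j σ ⊆ τ), (cechSystem f).res h (a σ) =
        f j ^ N • (cechSystem f).res h' (z (insert j σ)) := by
  have h1 : ∀ σ : Finset (Fin r), ∃ N : ℕ, ∃ a : Localization.Away (∏ i ∈ σ, f i), j ∉ σ →
      locRes (Finset.prod_dvd_prod_of_subset _ _ f (Finset.subset_insert j σ)) a =
        f j ^ N • z (insert j σ) := by
    intro σ
    by_cases hj : j ∈ σ
    · exact ⟨0, 0, fun h => absurd hj h⟩
    · obtain ⟨N, a, h⟩ := exists_locRes_eq_pow_smul
        (Finset.prod_dvd_prod_of_subset _ _ f (Finset.subset_insert j σ))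
        (Finset.prod_insert hj).dvd (z (insert j σ))
      exact ⟨N, a, fun _ => h⟩
  choose N a h1 using h1
  let N₀ := Finset.univ.sup N
  refine ⟨N₀, fun σ => f j ^ (N₀ - N σ) • a σ, fun σ hσ τ h h' => ?_⟩
  have hN : N₀ - N σ + N σ = N₀ := Nat.sub_add_cancel (Finset.le_sup (Finset.mem_univ σ))
  rw [← (cechSystem f).res_res (Finset.subset_insert j σ) h']
  rw [cechSystem_res, cechSystem_res, cechSystem_res, locRes_polynomial_smul, h1 σ hσ, smul_smul,
    ← pow_add, hN, locRes_polynomial_smul]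

/-- This is the Čech complex of the f_j with j ∈ J over S localized at f_p, where these f_j generate
the unit ideal because f_p is a combination of them. Concretely, some power of each f_j annihilates
a cohomology class, hence so does a power of f_p, and f_p acts invertibly. -/
theorem starFamily_acyclic {J : Finset (Fin r)} {p : Fin r} (hp : p ∉ J)
    (hpJ : f p ∈ Ideal.span (f '' J)) : (cechSystem f).Acyclic (starFamily J p) := by
  classical
  intro q z hz
  -- The annihilator of the class of `z`.
  let I : Ideal (MvPolynomial (Fin n) k) :=
    { carrier := {s | ∃ w ∈ term (A := Weyl k n) (starFamily J p) (q - 1),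
        (cechSystem f).diff (starFamily J p) w = s • z}
      zero_mem' := ⟨0, Submodule.zero_mem _, by rw [map_zero, zero_smul]⟩
      add_mem' := by
        rintro s t ⟨w, hw, h⟩ ⟨w', hw', h'⟩
        exact ⟨w + w', Submodule.add_mem _ hw hw', by rw [map_add, h, h', add_smul]⟩
      smul_mem' := by
        rintro c s ⟨w, hw, h⟩
        refine ⟨c • w, fun σ hσ => by rw [Pi.smul_apply, hw σ hσ, smul_zero], ?_⟩
        exact (cechSystem_diff_smul f _ c w).trans (by rw [h, smul_assoc]) }
  have hrad : f p ∈ I.radical := by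
    refine (Ideal.span_le.2 ?_ : Ideal.span (f '' J) ≤ I.radical) hpJ
    rintro _ ⟨j, hj, rfl⟩
    by_cases hj0 : f j = 0
    · rw [hj0]
      exact Ideal.zero_mem _
    have hjp : j ≠ p := fun h => hp (h ▸ hj)
    obtain ⟨N, a, ha⟩ := exists_uniform_lift (f := f) (j := j) z
    refine ⟨N, exists_diff_eq_of_lift (cechSystem f)
      (μ := fun σ => DistribSMul.toAddMonoidHom (Localization.Away (∏ i ∈ σ, f i)) (f j ^ N))
      (fun h x => locRes_polynomial_smul (Finset.prod_dvd_prod_of_subset _ _ f h) _ x)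
      ?_ ?_ ?_ hz ha⟩
    · exact fun τ hτ => ⟨Finset.insert_subset (Finset.mem_insert_of_mem hj) hτ.1,
        Finset.mem_insert_of_mem hτ.2⟩
    · exact fun τ hτ => ⟨(Finset.erase_subset _ _).trans hτ.1,
        Finset.mem_erase.2 ⟨Ne.symm hjp, hτ.2⟩⟩
    · intro τ _ hjτ
      refine locRes_injective (Finset.prod_dvd_prod_of_subset _ _ f (Finset.subset_insert j τ)) ?_
      intro h
      rw [Finset.prod_insert hjτ] at h
      exact (mul_eq_zero.1 h).resolve_left hj0
  obtain ⟨N, w, hw, hwz⟩ := hrad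
  -- Every set of the family contains `p`, so f_p^N can be divided out on all its terms; off the
  -- family `Ring.inverse` multiplies a zero value.
  let w' : CechTotal f := fun σ => Ring.inverse (algebraMap _ _ (f p ^ N)) * w σ
  have hw' : w' ∈ term (A := Weyl k n) (starFamily J p) (q - 1) := by
    intro σ hσ
    change _ * w σ = 0
    rw [hw σ hσ, mul_zero]
  have hww' : f p ^ N • w' = w := by
    funext σ
    by_cases hσ : σ ∈ starFamily J p
    · rw [Pi.smul_apply, Algebra.smul_def]
      change _ * (_ * w σ) = w σ
      rw [← mul_assoc, Ring.mul_inverse_cancel, one_mul]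
      rw [map_pow]
      exact (isUnit_of_dvd (Finset.dvd_prod_of_mem f hσ.2)).pow N
    · rw [Pi.smul_apply, eq_zero_of_mem_term hw' hσ, eq_zero_of_mem_term hw hσ, smul_zero]
  refine ⟨w', hw', ?_⟩
  have h1 := cechSystem_diff_smul f (starFamily J p) (f p ^ N) w'
  rw [hww', hwz] at h1
  funext σ
  by_cases hσ : σ ∈ starFamily J p
  · exact smul_injective_of_dvd (Finset.dvd_prod_of_mem f hσ.2) N (congrFun h1 σ).symm
  · rw [(cechSystem f).diff_apply_of_notMem hσ, eq_zero_of_mem_term hz.1 hσ]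

/-- The family of all subsets of `J`. -/
def subsetFamily (J : Finset (Fin r)) : Set (Finset (Fin r)) := {σ | σ ⊆ J}

/-- The subsets of J ∪ {p} that contain p form an upper subfamily, which is acyclic and may be
dropped. -/
theorem nonempty_coh_insert {J : Finset (Fin r)} {p : Fin r} (hp : p ∉ J)
    (hpJ : f p ∈ Ideal.span (f '' J)) (q : ℤ) :
    Nonempty ((cechSystem f).Coh (subsetFamily (insert p J)) q ≃ₗ[Weyl k n]
      (cechSystem f).Coh (subsetFamily J) q) := by
  have h1 : subsetFamily (insert p J) \ starFamily J p = subsetFamily J := by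
    ext σ
    refine ⟨fun h => ?_, fun h => ⟨h.trans (Finset.subset_insert p J), fun h' => hp (h h'.2)⟩⟩
    exact (Finset.subset_insert_iff_of_notMem fun hps => h.2 ⟨h.1, hps⟩).1 h.1
  rw [← h1]
  have h2 : (subsetFamily (insert p J)).OrdConnected := ⟨fun σ _ τ hτ ρ hρ => hρ.2.trans hτ⟩
  exact ⟨(cechSystem f).cohEquivDiff (𝒴 := starFamily J p) (fun σ h => h.1)
    (fun σ hσ τ hτ h => ⟨hτ, h hσ.2⟩) h2 (starFamily_acyclic hp hpJ) q⟩

theorem nonempty_coh_union (J K : Finset (Fin r)) (hK : ∀ p ∈ K, f p ∈ Ideal.span (f '' J))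
    (q : ℤ) : Nonempty ((cechSystem f).Coh (subsetFamily (J ∪ K)) q ≃ₗ[Weyl k n]
      (cechSystem f).Coh (subsetFamily J) q) := by
  induction K using Finset.induction_on with
  | empty =>
    rw [Finset.union_empty]
    exact ⟨LinearEquiv.refl _ _⟩
  | insert p K _ ih =>
    obtain ⟨e⟩ := ih fun p hp => hK p (Finset.mem_insert_of_mem hp)
    rw [Finset.union_insert]
    by_cases hp : p ∈ J ∪ K
    · rw [Finset.insert_eq_of_mem hp]
      exact ⟨e⟩
    · obtain ⟨e'⟩ := nonempty_coh_insert hp (Ideal.span_mono (Set.image_mono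
        (by exact_mod_cast Finset.subset_union_left)) (hK p (Finset.mem_insert_self p K))) q
      exact ⟨e'.trans e⟩

/-- The canonical isomorphism of localizations at associated elements. -/
def locEquiv {g h : MvPolynomial (Fin n) k} (h₁ : g ∣ h) (h₂ : h ∣ g) :
    Localization.Away g ≃ₗ[Weyl k n] Localization.Away h :=
  LinearEquiv.ofLinearMap (locResLinear h₁) (locResLinear h₂)
    (LinearMap.ext fun a => (locRes_locRes h₂ h₁ a).trans (locRes_self _ a))
    (LinearMap.ext fun a => (locRes_locRes h₁ h₂ a).trans (locRes_self _ a))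

/-- Local cohomology of a subfamily of generators. -/
theorem nonempty_localCohomology_embedding {r' : ℕ} (e : Fin r' ↪o Fin r)
    (he : ∀ p, f p ∈ Ideal.span (Set.range fun j => f (e j))) (i : ℕ) :
    Nonempty (LocalCohomology f i ≃ₗ[Weyl k n] LocalCohomology (fun j => f (e j)) i) := by
  let J : Finset (Fin r) := Finset.univ.map e.toEmbedding
  have hJ : f '' J = Set.range fun j => f (e j) := by
    ext s
    simp [J]
  obtain ⟨e₁⟩ := nonempty_coh_union (f := f) J Finset.univ (fun p _ => hJ ▸ he p) i
  have h1 : subsetFamily (J ∪ Finset.univ) = Set.univ := by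
    exact Set.eq_univ_of_forall fun σ a _ => Finset.mem_union_right _ (Finset.mem_univ a)
  have h2 : subsetFamily J = Finset.map e.toEmbedding '' Set.univ := by
    ext σ
    simp [subsetFamily, J, Finset.subset_map_iff, eq_comm]
  rw [h1, h2] at e₁
  have hdvd : ∀ σ : Finset (Fin r'), ∏ j ∈ σ, f (e j) = ∏ j ∈ σ.map e.toEmbedding, f j := fun σ =>
    (Finset.prod_map σ e.toEmbedding f).symm
  let ψ : ∀ σ : Finset (Fin r'), Localization.Away (∏ j ∈ σ, f (e j)) ≃ₗ[Weyl k n]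
      Localization.Away (∏ j ∈ σ.map e.toEmbedding, f j) := fun σ =>
    locEquiv (hdvd σ).dvd (hdvd σ).symm.dvd
  have e₂ := cohEquivMap (cechSystem f) (cechSystem fun j => f (e j)) e ψ (by
    intro σ τ h x
    exact (locRes_locRes (Finset.prod_dvd_prod_of_subset _ _ _ h) (hdvd τ).dvd x).trans
      (locRes_locRes (hdvd σ).dvd (Finset.prod_dvd_prod_of_subset _ _ f
        (Finset.map_subset_map.2 h)) x).symm) Set.univ i
  exact ⟨(localCohomologyEquiv f i).trans (e₁.trans (e₂.trans (localCohomologyEquiv _ i).symm))⟩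

end System

section Independence

variable {k : Type u} [Field k] {n r s : ℕ} (f : Fin r → MvPolynomial (Fin n) k)
  (g : Fin s → MvPolynomial (Fin n) k)

/-- Local cohomology depends only on the ideal. -/
theorem nonempty_localCohomology_of_span_eq
    (h : Ideal.span (Set.range f) = Ideal.span (Set.range g)) (i : ℕ) :
    Nonempty (LocalCohomology f i ≃ₗ[Weyl k n] LocalCohomology g i) := by
  -- Both systems of generators are compared with their concatenation, in which each generates the
  -- same ideal as the whole.
  have hf : (fun j => Fin.append f g (Fin.castAddOrderEmb s j)) = f :=
    funext fun j => Fin.append_left f g j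
  have hg : (fun j => Fin.append f g (Fin.natAddOrderEmb r j)) = g :=
    funext fun j => Fin.append_right f g j
  have hmem : ∀ p, Fin.append f g p ∈ Ideal.span (Set.range f) := by
    intro p
    refine Fin.addCases (fun j => ?_) (fun j => ?_) p
    · rw [Fin.append_left]
      exact Ideal.subset_span ⟨j, rfl⟩
    · rw [Fin.append_right, h]
      exact Ideal.subset_span ⟨j, rfl⟩
  obtain ⟨e₁⟩ := nonempty_localCohomology_embedding (f := Fin.append f g) (Fin.castAddOrderEmb s)
    (by rw [hf]; exact hmem) i
  obtain ⟨e₂⟩ := nonempty_localCohomology_embedding (f := Fin.append f g) (Fin.natAddOrderEmb r)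
    (by rw [hg, ← h]; exact hmem) i
  rw [hf] at e₁
  rw [hg] at e₂
  exact ⟨e₁.symm.trans e₂⟩

end Independence

end CharCycle

namespace CharCycle

universe u v w

open CoeffSystem

/-! ### Constant coefficients -/

/-- Cohomology of equal families. -/
def cohCongr {A : Type*} [Ring A] {V : Type*} [LinearOrder V] {C : Finset V → Type*}
    [∀ σ, AddCommGroup (C σ)] [∀ σ, Module A (C σ)] (D : CoeffSystem A C)
    {𝒳 𝒴 : Set (Finset V)} (h : 𝒳 = 𝒴) (p : ℤ) : D.Coh 𝒳 p ≃ₗ[A] D.Coh 𝒴 p :=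
  h ▸ LinearEquiv.refl A _

section Const

variable (k : Type u) [Field k] (V : Type*) [LinearOrder V]

/-- The constant system. -/
def constSystem : CoeffSystem k (fun _ : Finset V => k) where
  res _ := LinearMap.id
  res_self _ _ := rfl
  res_res _ _ _ := rfl

variable {k V}

theorem constSystem_diff_apply {𝒳 : Set (Finset V)} {τ : Finset V} (h : τ ∈ 𝒳)
    (m : Finset V → k) :
    (constSystem k V).diff 𝒳 m τ = ∑ v ∈ τ, sgn τ v • m (τ.erase v) :=
  (constSystem k V).diff_apply h m

/-- A family on which one can consistently add or remove an element of `P`, chosen by the part of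
a set off `P`, is acyclic. -/
theorem constSystem_acyclic_of_toggle {𝒳 : Set (Finset V)} (h𝒳 : 𝒳.OrdConnected) (P : Finset V)
    (u : Finset V → V) (hu : ∀ τ ∈ 𝒳, u (τ \ P) ∈ P)
    (hins : ∀ τ ∈ 𝒳, insert (u (τ \ P)) τ ∈ 𝒳) (hera : ∀ τ ∈ 𝒳, τ.erase (u (τ \ P)) ∈ 𝒳) :
    (constSystem k V).Acyclic 𝒳 := by
  classical
  set D := constSystem k V
  intro q
  -- Filtration by the number of elements off P: a cocycle that vanishes on sets with fewer than p
  -- of them is corrected by a coboundary so as to vanish also on those with exactly p. Once p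
  -- exceeds q nothing is left.
  have key : ∀ (d : ℕ) (p : ℤ), q - p < d → ∀ z ∈ D.cocyc 𝒳 q,
      (∀ τ, (((τ \ P).card : ℕ) : ℤ) < p → z τ = 0) → z ∈ D.cobd 𝒳 q := by
    intro d
    induction d with
    | zero =>
      intro p hp z hz hzp
      have : z = 0 := by
        funext τ
        by_cases h : (τ.card : ℤ) = q
        · refine hzp τ ?_
          have := Finset.card_le_card (Finset.sdiff_subset (s := τ) (t := P))
          push_cast at hp
          omega
        · exact hz.1 τ fun h' => h h'.2
      rw [this]
      exact Submodule.zero_mem _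
    | succ d ih =>
      intro p hp z hz hzp
      obtain ⟨hzt, hzd⟩ := hz
      -- Toggling u(σ \ P) would be a contracting homotopy if every removal kept the choice of u.
      -- Removal of elements of P does; removal of other elements leads to a smaller count off P,
      -- where `z` vanishes.
      let w : Finset V → k := fun σ =>
        if σ ∈ 𝒳 ∧ (σ.card : ℤ) = q - 1 ∧ u (σ \ P) ∉ σ then
          sgn (insert (u (σ \ P)) σ) (u (σ \ P)) • z (insert (u (σ \ P)) σ) else 0
      have hwt : w ∈ term (A := k) 𝒳 (q - 1) := fun σ hσ => if_neg fun h => hσ ⟨h.1, h.2.1⟩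
      have hdw : D.diff 𝒳 w ∈ term (A := k) 𝒳 q := by
        have := D.diff_mem_term' (𝒳 := 𝒳) hwt
        rwa [sub_add_cancel] at this
      have hcard : ∀ (v : V) (τ : Finset V), v ∈ τ → v ∉ P →
          (((τ.erase v) \ P).card : ℕ) + 1 = (τ \ P).card := fun v τ hv hvP => by
        rw [Finset.erase_sdiff_comm]
        exact Finset.card_erase_add_one (Finset.mem_sdiff.2 ⟨hv, hvP⟩)
      have hw0 : ∀ (v : V) (τ : Finset V), v ∈ τ → v ∉ P → ((τ \ P).card : ℤ) ≤ p →
          w (τ.erase v) = 0 := by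
        intro v τ hv hvP hτp
        by_cases h : τ.erase v ∈ 𝒳
        · have h1 := hcard v τ hv hvP
          have h2 := hu _ h
          have h3 : z (insert (u (τ.erase v \ P)) (τ.erase v)) = 0 := by
            refine hzp _ ?_
            rw [Finset.insert_sdiff_of_mem _ h2]
            omega
          simp only [w, h3, smul_zero, ite_self]
        · exact if_neg fun h' => h h'.1
      have hsd : ∀ (v : V) (τ : Finset V), v ∈ P → τ.erase v \ P = τ \ P := fun v τ hv => by
        ext a
        simp only [Finset.mem_sdiff, Finset.mem_erase]
        exact ⟨fun h => ⟨h.1.2, h.2⟩, fun h => ⟨⟨fun h' => h.2 (h' ▸ hv), h.1⟩, h.2⟩⟩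
      have hmain : ∀ τ ∈ 𝒳, ((τ \ P).card : ℤ) ≤ p → (τ.card : ℤ) = q →
          D.diff 𝒳 w τ = z τ := by
        intro τ hτ hτp hτq
        rw [constSystem_diff_apply hτ]
        set j := u (τ \ P) with hj
        have hjP : j ∈ P := hu τ hτ
        by_cases hjτ : j ∈ τ
        · rw [Finset.sum_eq_single j]
          · have h1 := hera τ hτ
            have h2 := Finset.card_erase_add_one hjτ
            have h3 := hsd j τ hjP
            have h4 : w (τ.erase j) = sgn (insert j (τ.erase j)) j • z (insert j (τ.erase j)) := by
              have : w (τ.erase j) = _ := if_pos ⟨h1, by omega, by rw [h3]; simp [← hj]⟩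
              rw [this, h3]
            rw [h4, Finset.insert_erase hjτ, smul_smul, sgn_mul_self, one_smul]
          · intro v hv hvj
            by_cases hvP : v ∈ P
            · have h2 : w (τ.erase v) = 0 := by
                refine if_neg fun h => h.2.2 ?_
                rw [hsd v τ hvP]
                exact Finset.mem_erase.2 ⟨Ne.symm hvj, hjτ⟩
              rw [h2, smul_zero]
            · rw [hw0 v τ hv hvP hτp, smul_zero]
          · intro h
            exact absurd hjτ h
        · set τ' := insert j τ with hτ'
          have hτ'𝒳 : τ' ∈ 𝒳 := hins τ hτ
          have hsd' : τ' \ P = τ \ P := Finset.insert_sdiff_of_mem _ hjP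
          have herase : ∀ v ∈ τ, τ'.erase v = insert j (τ.erase v) := fun v hv =>
            Finset.erase_insert_of_ne fun h => hjτ (h ▸ hv)
          have hjerase : τ'.erase j = τ := Finset.erase_insert hjτ
          have hcoc : ∑ v ∈ τ, sgn τ' v • z (τ'.erase v) = -(sgn τ' j • z τ) := by
            have h1 : D.diff 𝒳 z τ' = 0 := by
              rw [LinearMap.mem_ker.1 hzd]
              rfl
            rw [constSystem_diff_apply hτ'𝒳, Finset.sum_insert hjτ, hjerase] at h1
            rw [eq_neg_iff_add_eq_zero, add_comm, ← h1]
          have hw : ∀ v ∈ τ, sgn τ v • w (τ.erase v) =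
              (-sgn τ' j) • sgn τ' v • z (τ'.erase v) := by
            intro v hv
            by_cases hvP : v ∈ P
            · have h1 := hsd v τ hvP
              have hjv : j ∉ τ.erase v := fun h => hjτ (Finset.mem_of_mem_erase h)
              have h5 := Finset.card_erase_add_one hv
              by_cases hv𝒳 : τ.erase v ∈ 𝒳
              · have h3 : w (τ.erase v) = sgn (τ'.erase v) j • z (τ'.erase v) := by
                  have : w (τ.erase v) = _ := if_pos ⟨hv𝒳, by omega, by rw [h1]; exact hjv⟩
                  rw [this, h1, ← hj, herase v hv]
                rw [h3, smul_smul, smul_smul]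
                congr 1
                have h6 := sgn_mul_sgn_erase (Finset.mem_insert_of_mem hv)
                  (Finset.mem_insert_self j τ) (fun h => hjτ (h ▸ hv))
                rw [← hτ', hjerase] at h6
                have h7 := sgn_mul_self τ' v
                calc sgn τ v * sgn (τ'.erase v) j
                    = sgn τ v * (sgn τ' v * sgn τ' v) * sgn (τ'.erase v) j := by rw [h7, mul_one]
                  _ = sgn τ v * sgn τ' v * (sgn τ' v * sgn (τ'.erase v) j) := by ring
                  _ = -sgn τ' j * sgn τ' v * (sgn τ v * sgn τ v) := by rw [h6]; ring
                  _ = -sgn τ' j * sgn τ' v := by rw [sgn_mul_self, mul_one]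
              · have h3 : w (τ.erase v) = 0 := if_neg fun h => hv𝒳 h.1
                have h4 : z (τ'.erase v) = 0 := by
                  refine eq_zero_of_mem_term hzt fun h => hv𝒳 ?_
                  have h6 := hera _ h
                  rwa [hsd v τ' hvP, hsd', ← hj, herase v hv, Finset.erase_insert hjv] at h6
                rw [h3, h4, smul_zero, smul_zero, smul_zero]
            · have h3 : z (τ'.erase v) = 0 := by
                refine hzp _ ?_
                have := hcard v τ' (Finset.mem_insert_of_mem hv) hvP
                rw [hsd'] at this
                omega
              rw [hw0 v τ hv hvP hτp, h3, smul_zero, smul_zero, smul_zero]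
          rw [Finset.sum_congr rfl hw, ← Finset.smul_sum, hcoc, smul_neg, neg_smul, neg_neg,
            smul_smul, sgn_mul_self, one_smul]
      have hz' : z - D.diff 𝒳 w ∈ D.cobd 𝒳 q := by
        refine ih (p + 1) (by push_cast at hp; omega) _
          ⟨Submodule.sub_mem _ hzt hdw, ?_⟩ fun τ hτp => ?_
        · rw [SetLike.mem_coe, LinearMap.mem_ker, map_sub, LinearMap.mem_ker.1 hzd,
            D.diff_diff_of_mem_term h𝒳 hwt, sub_zero]
        · rw [Pi.sub_apply, sub_eq_zero]
          by_cases h : τ ∈ 𝒳 ∧ (τ.card : ℤ) = q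
          · exact (hmain τ h.1 (by omega) h.2).symm
          · rw [hzt τ h, hdw τ h]
      have := Submodule.add_mem _ hz' (Submodule.mem_map_of_mem hwt : D.diff 𝒳 w ∈ D.cobd 𝒳 q)
      rwa [sub_add_cancel] at this
  intro z hz
  -- At p = 0 the vanishing condition is empty; `toNat` also covers negative q, where no steps are
  -- needed.
  exact key (q + 1).toNat 0 (by omega) z hz fun τ h => by omega

end Const

/-! ### Independent and dominating sets in a bipartite graph -/

section Dominating

variable (k : Type u) [Field k] {V : Type*} [LinearOrder V] (P Q : Finset V) (adj : V → V → Prop)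

/-- The subsets of `P ∪ Q` without an edge between `P` and `Q`. -/
def independentFamily : Set (Finset V) :=
  {τ | τ ⊆ P ∪ Q ∧ ∀ a ∈ τ, a ∈ P → ∀ b ∈ τ, b ∈ Q → ¬ adj a b}

/-- The subsets of `Q` that meet the neighbourhood of every element of `P`. -/
def dominatingFamily : Set (Finset V) := {τ | τ ⊆ Q ∧ ∀ a ∈ P, ∃ b ∈ τ, adj a b}

theorem independentFamily_flip :
    independentFamily Q P (fun a b => adj b a) = independentFamily P Q adj := by
  ext τ
  simp only [independentFamily, Set.mem_ofPred_eq, Finset.union_comm Q P]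
  exact and_congr_right fun _ => ⟨fun h a ha haP b hb hbQ => h b hb hbQ a ha haP,
    fun h a ha haP b hb hbQ => h b hb hbQ a ha haP⟩

variable {P Q}

variable {adj}

theorem independentFamily_ordConnected : (independentFamily P Q adj).OrdConnected :=
  ⟨fun _ _ _ hτ _ hρ => ⟨hρ.2.trans hτ.1, fun a ha haP b hb => hτ.2 a (hρ.2 ha) haP b (hρ.2 hb)⟩⟩

theorem dominatingFamily_subset (hPQ : Disjoint P Q) :
    dominatingFamily P Q adj ⊆ independentFamily P Q adj := fun _ hτ =>
  ⟨hτ.1.trans Finset.subset_union_right,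
    fun _ ha haP _ _ _ => absurd (hτ.1 ha) (Finset.disjoint_left.1 hPQ haP)⟩

/-- An element of P in τ would have a neighbour in the dominating set σ ⊆ τ, against independence.
-/
theorem dominatingFamily_upper : ∀ σ ∈ dominatingFamily P Q adj,
    ∀ τ ∈ independentFamily P Q adj, σ ⊆ τ → τ ∈ dominatingFamily P Q adj := by
  intro σ hσ τ hτ h
  refine ⟨fun a ha => ?_, fun a ha => ?_⟩
  · refine (Finset.mem_union.1 (hτ.1 ha)).resolve_left fun haP => ?_
    obtain ⟨b, hb, hab⟩ := hσ.2 a haP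
    exact hτ.2 a ha haP b (h hb) (hσ.1 hb) hab
  · obtain ⟨b, hb, hab⟩ := hσ.2 a ha
    exact ⟨b, h hb, hab⟩

/-- If an independent τ is not a dominating subset of Q, some a ∈ P has no neighbour in τ \ P: any
element of τ ∩ P, or else an undominated one. Such an a can be chosen from τ \ P alone, so adding or
removing it is a consistent toggle. -/
theorem acyclic_independent_sdiff_dominating (hPQ : Disjoint P Q) :
    (constSystem k V).Acyclic (independentFamily P Q adj \ dominatingFamily P Q adj) := by
  classical
  have hex : ∀ τ ∈ independentFamily P Q adj \ dominatingFamily P Q adj,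
      ∃ a ∈ P, ∀ b ∈ τ \ P, ¬ adj a b := by
    rintro τ ⟨hτ, hτ'⟩
    by_contra! hcon
    refine hτ' ⟨fun a ha => ?_, fun a ha => ?_⟩
    · refine (Finset.mem_union.1 (hτ.1 ha)).resolve_left fun haP => ?_
      obtain ⟨b, hb, hab⟩ := hcon a haP
      rw [Finset.mem_sdiff] at hb
      exact hτ.2 a ha haP b hb.1 ((Finset.mem_union.1 (hτ.1 hb.1)).resolve_left hb.2) hab
    · obtain ⟨b, hb, hab⟩ := hcon a ha
      exact ⟨b, (Finset.mem_sdiff.1 hb).1, hab⟩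
  rcases isEmpty_or_nonempty V with hV | hV
  · intro q z hz
    have : z = 0 := funext fun τ => eq_zero_of_mem_term hz.1 fun h =>
      hV.elim (hex τ h).choose
    rw [this]
    exact Submodule.zero_mem _
  let u : Finset V → V := fun B =>
    if h : ∃ a ∈ P, ∀ b ∈ B, ¬ adj a b then h.choose else hV.some
  have hu : ∀ τ ∈ independentFamily P Q adj \ dominatingFamily P Q adj,
      u (τ \ P) ∈ P ∧ ∀ b ∈ τ \ P, ¬ adj (u (τ \ P)) b := fun τ hτ => by
    simp only [u, dif_pos (hex τ hτ)]
    exact (hex τ hτ).choose_spec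
  refine constSystem_acyclic_of_toggle ⟨fun σ hσ τ hτ ρ hρ => ?_⟩ P u (fun τ hτ => (hu τ hτ).1)
    (fun τ hτ => ?_) (fun τ hτ => ?_)
  · exact ⟨independentFamily_ordConnected.out hσ.1 hτ.1 hρ,
      fun h => hτ.2 (dominatingFamily_upper _ h _ hτ.1 hρ.2)⟩
  · obtain ⟨h1, h2⟩ := hu τ hτ
    have h3 : ∀ b ∈ insert (u (τ \ P)) τ, b ∈ Q → b ∈ τ := fun b hb hbQ =>
      (Finset.mem_insert.1 hb).resolve_left fun h =>
        Finset.disjoint_left.1 hPQ h1 (h ▸ hbQ)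
    refine ⟨⟨Finset.insert_subset (Finset.mem_union_left _ h1) hτ.1.1,
      fun a ha haP b hb hbQ => ?_⟩, fun h => ?_⟩
    · rcases Finset.mem_insert.1 ha with rfl | ha
      · exact h2 b (Finset.mem_sdiff.2 ⟨h3 b hb hbQ, fun h => Finset.disjoint_left.1 hPQ h hbQ⟩)
      · exact hτ.1.2 a ha haP b (h3 b hb hbQ) hbQ
    · exact Finset.disjoint_left.1 hPQ h1 (h.1 (Finset.mem_insert_self _ _))
  · obtain ⟨h1, h2⟩ := hu τ hτ
    refine ⟨independentFamily_ordConnected.out (x := ∅) ⟨by simp, by simp⟩ hτ.1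
      ⟨by simp, Finset.erase_subset _ _⟩, fun h => ?_⟩
    obtain ⟨b, hb, hab⟩ := h.2 _ h1
    exact h2 b (Finset.mem_sdiff.2 ⟨Finset.mem_of_mem_erase hb,
      fun h' => Finset.disjoint_left.1 hPQ h' (h.1 hb)⟩) hab

/-- The two dominating families of a bipartite graph have the same cohomology. -/
def cohDominatingEquiv (hPQ : Disjoint P Q) (p : ℤ) :
    (constSystem k V).Coh (dominatingFamily P Q adj) p ≃ₗ[k]
      (constSystem k V).Coh (dominatingFamily Q P fun a b => adj b a) p :=
  ((constSystem k V).cohEquivUpper (dominatingFamily_subset hPQ) dominatingFamily_upper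
    independentFamily_ordConnected (acyclic_independent_sdiff_dominating k hPQ) p).trans
  (((constSystem k V).cohEquivUpper (dominatingFamily_subset hPQ.symm) dominatingFamily_upper
    independentFamily_ordConnected (acyclic_independent_sdiff_dominating k hPQ.symm) p).trans
    (cohCongr _ (independentFamily_flip P Q adj) p)).symm

end Dominating

/-! ### Covers and transversals of a family of sets -/

section Bipartite

variable (k : Type u) [Field k] {s n : ℕ} (G : Fin s → Finset (Fin n)) (U : Finset (Fin n))

/-- The index sets `σ` such that `U` is covered by the `G_j` with `j ∈ σ`. -/
def coverFamily : Set (Finset (Fin s)) := {σ | ∀ v ∈ U, ∃ j ∈ σ, v ∈ G j}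

/-- The subsets of `U` that meet every `G_j`. -/
def transversalFamily : Set (Finset (Fin n)) := {W | W ⊆ U ∧ ∀ j, ∃ v ∈ W, v ∈ G j}

theorem castAdd_ne_natAdd (j : Fin s) (v : Fin n) : Fin.castAdd n j ≠ Fin.natAdd s v := by
  intro h
  have := congrArg Fin.val h
  simp at this
  omega

/-- The incidence graph on `Fin s ⊔ Fin n`. -/
def incidence (a b : Fin (s + n)) : Prop :=
  ∃ v j, a = Fin.natAdd s v ∧ b = Fin.castAdd n j ∧ v ∈ G j

theorem incidence_iff (v : Fin n) (j : Fin s) :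
    incidence G (Fin.natAdd s v) (Fin.castAdd n j) ↔ v ∈ G j := by
  refine ⟨?_, fun h => ⟨v, j, rfl, rfl, h⟩⟩
  rintro ⟨v', j', h, hj, hv⟩
  rw [Fin.natAdd_inj] at h
  rw [Fin.castAdd_inj] at hj
  rwa [h, hj]

/-- The vertices of the incidence graph that come from `Fin s`. -/
def leftPart (s n : ℕ) : Finset (Fin (s + n)) :=
  Finset.univ.map (Fin.castAddOrderEmb n : Fin s ↪o Fin (s + n)).toEmbedding

variable (s) in
/-- The vertices of the incidence graph that come from `U`. -/
def rightPart : Finset (Fin (s + n)) :=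
  U.map (Fin.natAddOrderEmb s : Fin n ↪o Fin (s + n)).toEmbedding

theorem disjoint_rightPart : Disjoint (rightPart s U) (leftPart s n) := by
  rw [Finset.disjoint_left]
  intro a ha ha'
  obtain ⟨v, _, rfl⟩ := Finset.mem_map.1 ha
  obtain ⟨j, _, h⟩ := Finset.mem_map.1 ha'
  exact castAdd_ne_natAdd j v h

theorem dominatingFamily_right : dominatingFamily (rightPart s U) (leftPart s n) (incidence G) =
    Finset.map (Fin.castAddOrderEmb n : Fin s ↪o Fin (s + n)).toEmbedding '' coverFamily G U := by
  ext τ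
  constructor
  · rintro ⟨h1, h2⟩
    obtain ⟨σ, -, rfl⟩ := Finset.subset_map_iff.1 h1
    refine ⟨σ, fun v hv => ?_, rfl⟩
    obtain ⟨b, hb, hab⟩ := h2 (Fin.natAdd s v) (Finset.mem_map.2 ⟨v, hv, rfl⟩)
    obtain ⟨j, hj, rfl⟩ := Finset.mem_map.1 hb
    exact ⟨j, hj, (incidence_iff G v j).1 hab⟩
  · rintro ⟨σ, hσ, rfl⟩
    refine ⟨Finset.map_subset_map.2 (Finset.subset_univ _), fun a ha => ?_⟩
    obtain ⟨v, hv, rfl⟩ := Finset.mem_map.1 ha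
    obtain ⟨j, hj, hvj⟩ := hσ v hv
    exact ⟨Fin.castAdd n j, Finset.mem_map.2 ⟨j, hj, rfl⟩, (incidence_iff G v j).2 hvj⟩

theorem dominatingFamily_left :
    dominatingFamily (leftPart s n) (rightPart s U) (fun a b => incidence G b a) =
      Finset.map (Fin.natAddOrderEmb s : Fin n ↪o Fin (s + n)).toEmbedding ''
        transversalFamily G U := by
  ext τ
  constructor
  · rintro ⟨h1, h2⟩
    obtain ⟨W, hW, rfl⟩ := Finset.subset_map_iff.1 h1
    refine ⟨W, ⟨hW, fun j => ?_⟩, rfl⟩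
    obtain ⟨b, hb, hab⟩ := h2 (Fin.castAdd n j) (Finset.mem_map.2 ⟨j, Finset.mem_univ j, rfl⟩)
    obtain ⟨v, hv, rfl⟩ := Finset.mem_map.1 hb
    exact ⟨v, hv, (incidence_iff G v j).1 hab⟩
  · rintro ⟨W, hW, rfl⟩
    refine ⟨Finset.map_subset_map.2 hW.1, fun a ha => ?_⟩
    obtain ⟨j, -, rfl⟩ := Finset.mem_map.1 ha
    obtain ⟨v, hv, hvj⟩ := hW.2 j
    exact ⟨Fin.natAdd s v, Finset.mem_map.2 ⟨v, hv, rfl⟩, (incidence_iff G v j).2 hvj⟩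

/-- Covers and transversals have the same cohomology. -/
def cohCoverEquiv (p : ℤ) : (constSystem k (Fin s)).Coh (coverFamily G U) p ≃ₗ[k]
    (constSystem k (Fin n)).Coh (transversalFamily G U) p :=
  (cohEquivMap (constSystem k (Fin (s + n))) (constSystem k (Fin s)) (Fin.castAddOrderEmb n)
    (fun _ => LinearEquiv.refl k k) (fun _ _ => rfl) (coverFamily G U) p).symm.trans
  ((cohCongr _ (dominatingFamily_right G U).symm p).trans
  ((cohDominatingEquiv k (disjoint_rightPart U) p).trans
  ((cohCongr _ (dominatingFamily_left G U) p).trans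
  (cohEquivMap (constSystem k (Fin (s + n))) (constSystem k (Fin n)) (Fin.natAddOrderEmb s)
    (fun _ => LinearEquiv.refl k k) (fun _ _ => rfl) (transversalFamily G U) p))))

end Bipartite

/-! ### Complementation and Alexander duality -/

section Duality

variable (k : Type u) [Field k] {n : ℕ} (U : Finset (Fin n))

/-- The sign that turns the simplicial boundary into the coboundary of the complements. -/
def dualSign (W : Finset (Fin n)) : k := ∏ v ∈ W, (-1) ^ (U.filter (· < v)).card

theorem dualSign_mul_self (W : Finset (Fin n)) : dualSign k U W * dualSign k U W = 1 := by
  rw [dualSign, ← Finset.prod_mul_distrib]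
  refine Finset.prod_eq_one fun v _ => ?_
  rw [← pow_add, ← two_mul, pow_mul]
  simp

-- The elements of U before v split into those in W and those in U \ W. The first count gives the
-- coboundary sign, and the second cancels the boundary sign at the complement.
variable {U} in
theorem dualSign_erase {W : Finset (Fin n)} (hW : W ⊆ U) {v : Fin n} (hv : v ∈ W) :
    dualSign k U W * (-1) ^ ((U \ W).filter (· < v)).card =
      (sgn W v : k) * dualSign k U (W.erase v) := by
  have h1 : dualSign k U W = (-1) ^ (U.filter (· < v)).card * dualSign k U (W.erase v) :=
    (Finset.mul_prod_erase W _ hv).symm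
  have h2 : (U.filter (· < v)).card = ((U \ W).filter (· < v)).card + (W.filter (· < v)).card := by
    rw [← Finset.card_union_of_disjoint]
    · rw [← Finset.filter_union, Finset.sdiff_union_of_subset hW]
    · exact Finset.disjoint_filter_filter Finset.sdiff_disjoint
  have h3 : ((-1 : k) ^ ((U \ W).filter (· < v)).card) * (-1) ^ ((U \ W).filter (· < v)).card = 1 := by
    rw [← pow_add, ← two_mul, pow_mul]
    simp
  rw [h1, h2, pow_add, sgn]
  push_cast
  linear_combination ((-1) ^ (W.filter (· < v)).card * dualSign k U (W.erase v)) * h3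

/-- Complementation in `U`, with signs. -/
def dualize : (Finset (Fin n) → k) →ₗ[k] (Finset (Fin n) → k) where
  toFun c W := if W ⊆ U then dualSign k U W * c (U \ W) else 0
  map_add' a b := by
    funext W
    simp only [Pi.add_apply]
    split_ifs
    · ring
    · simp
  map_smul' r a := by
    funext W
    simp only [Pi.smul_apply, smul_eq_mul, RingHom.id_apply]
    split_ifs
    · ring
    · simp

variable {U}

theorem dualize_apply {W : Finset (Fin n)} (hW : W ⊆ U) (c : Finset (Fin n) → k) :
    dualize k U c W = dualSign k U W * c (U \ W) := if_pos hW

theorem dualize_apply_of_not {W : Finset (Fin n)} (hW : ¬ W ⊆ U) (c : Finset (Fin n) → k) :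
    dualize k U c W = 0 := if_neg hW

variable (U) in
/-- The inverse of `dualize`. -/
def undualize (m : Finset (Fin n) → k) (L : Finset (Fin n)) : k :=
  if L ⊆ U then dualSign k U (U \ L) * m (U \ L) else 0

theorem dualize_undualize {m : Finset (Fin n) → k} (hm : ∀ W, ¬ W ⊆ U → m W = 0) :
    dualize k U (undualize k U m) = m := by
  funext W
  by_cases hW : W ⊆ U
  · rw [dualize_apply k hW, undualize, if_pos Finset.sdiff_subset, Finset.sdiff_sdiff_eq_self hW,
      ← mul_assoc, dualSign_mul_self, one_mul]
  · rw [dualize_apply_of_not k hW, hm W hW]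

theorem dualize_injective {c c' : Finset (Fin n) → k} (hc : ∀ L, ¬ L ⊆ U → c L = 0)
    (hc' : ∀ L, ¬ L ⊆ U → c' L = 0) (h : dualize k U c = dualize k U c') : c = c' := by
  funext L
  by_cases hL : L ⊆ U
  · have h1 := congrFun h (U \ L)
    rw [dualize_apply k Finset.sdiff_subset, dualize_apply k Finset.sdiff_subset,
      Finset.sdiff_sdiff_eq_self hL] at h1
    have h2 := dualSign_mul_self k U (U \ L)
    calc c L = dualSign k U (U \ L) * dualSign k U (U \ L) * c L := by rw [h2, one_mul]
      _ = dualSign k U (U \ L) * dualSign k U (U \ L) * c' L := by rw [mul_assoc, h1, mul_assoc]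
      _ = c' L := by rw [h2, one_mul]
  · rw [hc L hL, hc' L hL]

/-- The complements in `U` of the members of a family. -/
def dualFamily (U : Finset (Fin n)) (Λ : Set (Finset (Fin n))) : Set (Finset (Fin n)) :=
  {W | W ⊆ U ∧ U \ W ∈ Λ}

variable {Λ : Set (Finset (Fin n))} (hΛ : IsLowerSet Λ) (hΛU : ∀ L ∈ Λ, L ⊆ U)

-- Removing v from W is adding v to U \ W. Terms with v outside U vanish because the members of Λ
-- lie in U; if U \ W is not in Λ, both sides vanish because Λ is closed under subsets.
include hΛ hΛU in
theorem diff_dualize {c : Finset (Fin n) → k} (hc : ∀ L, L ∉ Λ → c L = 0) :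
    (constSystem k (Fin n)).diff (dualFamily U Λ) (dualize k U c) =
      dualize k U (boundary k n c) := by
  classical
  funext W
  by_cases hW : W ⊆ U
  swap
  · rw [dualize_apply_of_not k hW, CoeffSystem.diff_apply_of_notMem _ fun h => hW h.1]
  have hbd : boundary k n c (U \ W) =
      ∑ v ∈ (U \ W)ᶜ, (-1) ^ ((U \ W).filter (· < v)).card * c (insert v (U \ W)) := rfl
  rw [dualize_apply k hW, hbd]
  by_cases hWΛ : U \ W ∈ Λ
  swap
  · rw [CoeffSystem.diff_apply_of_notMem _ fun h => hWΛ h.2, Finset.sum_eq_zero, mul_zero]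
    intro v _
    rw [hc, mul_zero]
    exact fun h => hWΛ (hΛ (Finset.subset_insert _ _) h)
  rw [constSystem_diff_apply (𝒳 := dualFamily U Λ) ⟨hW, hWΛ⟩, Finset.mul_sum]
  have hsub : W ⊆ (U \ W)ᶜ := fun v hv => by simp [hv]
  rw [← Finset.sum_subset hsub]
  · refine Finset.sum_congr rfl fun v hv => ?_
    have h1 : U \ W.erase v = insert v (U \ W) := by
      ext a
      by_cases ha : a = v
      · subst ha
        simp [hW hv]
      · simp [ha]
    rw [dualize_apply k ((Finset.erase_subset _ _).trans hW), h1, zsmul_eq_mul, ← mul_assoc,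
      ← mul_assoc, dualSign_erase k hW hv]
  · intro v _ hv'
    rw [hc, mul_zero, mul_zero]
    intro h
    have h1 : v ∈ U := hΛU _ h (Finset.mem_insert_self _ _)
    have h2 : v ∉ U \ W := by simpa using ‹v ∈ (U \ W)ᶜ›
    exact h2 (Finset.mem_sdiff.2 ⟨h1, hv'⟩)

include hΛU in
theorem dualize_mem_term {c : Finset (Fin n) → k} {j p : ℤ} (hjp : j + 1 + p = U.card)
    (hc : c ∈ chains k Λ j) : dualize k U c ∈ term (A := k) (dualFamily U Λ) p := by
  intro W hW
  by_cases hWU : W ⊆ U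
  · rw [dualize_apply k hWU, hc, mul_zero]
    rintro ⟨h1, h2⟩
    refine hW ⟨⟨hWU, h1⟩, ?_⟩
    have := Finset.card_sdiff_add_card_eq_card hWU
    omega
  · exact dualize_apply_of_not k hWU c

theorem undualize_mem_chains {m : Finset (Fin n) → k} {j p : ℤ} (hjp : j + 1 + p = U.card)
    (hm : m ∈ term (A := k) (dualFamily U Λ) p) : undualize k U m ∈ chains k Λ j := by
  intro L hL
  by_cases hLU : L ⊆ U
  · rw [undualize, if_pos hLU, hm, mul_zero]
    rintro ⟨⟨h0, h1⟩, h2⟩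
    rw [Finset.sdiff_sdiff_eq_self hLU] at h1
    refine hL ⟨h1, ?_⟩
    have := Finset.card_sdiff_add_card_eq_card hLU
    omega
  · exact if_neg hLU

include hΛ hΛU in
/-- Combinatorial Alexander duality. -/
def homologyDualEquiv {j p : ℤ} (hjp : j + 1 + p = U.card) :
    ReducedHomology k Λ j ≃ₗ[k] (constSystem k (Fin n)).Coh (dualFamily U Λ) p := by
  have hsupp : ∀ {j : ℤ} {c : Finset (Fin n) → k}, c ∈ chains k Λ j → ∀ L, L ∉ Λ → c L = 0 :=
    fun hc L hL => hc L fun h => hL h.1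
  have hsuppU : ∀ {j : ℤ} {c : Finset (Fin n) → k}, c ∈ chains k Λ j → ∀ L, ¬ L ⊆ U → c L = 0 :=
    fun hc L hL => hsupp hc L fun h => hL (hΛU L h)
  have hbdU : ∀ {c : Finset (Fin n) → k}, (∀ L, L ∉ Λ → c L = 0) →
      ∀ L, ¬ L ⊆ U → boundary k n c L = 0 := by
    intro c hc L hL
    refine Finset.sum_eq_zero fun v _ => ?_
    rw [hc, mul_zero]
    exact fun h => hL ((Finset.subset_insert _ _).trans (hΛU _ h))
  have hterm : ∀ {p : ℤ} {m : Finset (Fin n) → k}, m ∈ term (A := k) (dualFamily U Λ) p →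
      dualize k U (undualize k U m) = m := fun hm =>
    dualize_undualize k fun W hW => eq_zero_of_mem_term hm fun h => hW h.1
  refine subquotEquiv (dualize k U) ?_ ?_ ?_
  · rintro c ⟨hc, hd⟩
    refine ⟨dualize_mem_term k hΛU hjp hc, ?_⟩
    rw [SetLike.mem_coe, LinearMap.mem_ker, diff_dualize k hΛ hΛU (hsupp hc),
      LinearMap.mem_ker.1 hd, map_zero]
  · rintro c ⟨hc, hd⟩
    refine ⟨?_, ?_⟩
    · rintro ⟨w, hw, h⟩
      have hw' : undualize k U w ∈ chains k Λ (j + 1) :=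
        undualize_mem_chains k (by omega) hw
      refine ⟨_, hw', dualize_injective k (hbdU (hsupp hw')) (hsuppU hc) ?_⟩
      rw [← diff_dualize k hΛ hΛU (hsupp hw'), hterm hw, h]
    · rintro ⟨w, hw, rfl⟩
      exact ⟨_, dualize_mem_term k hΛU (by omega) hw, diff_dualize k hΛ hΛU (hsupp hw)⟩
  · rintro z ⟨hz, hd⟩
    have hz' : undualize k U z ∈ chains k Λ j := undualize_mem_chains k hjp hz
    refine ⟨_, ⟨hz', ?_⟩, ?_⟩
    · refine dualize_injective k (hbdU (hsupp hz')) (fun _ _ => rfl) ?_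
      rw [← diff_dualize k hΛ hΛU (hsupp hz'), hterm hz, LinearMap.mem_ker.1 hd, map_zero]
    · rw [hterm hz, sub_self]
      exact Submodule.zero_mem _

end Duality

/-! ### Transversals of the nonfaces and the link -/

section Link

variable (k : Type u) [Field k] {s n : ℕ} {Δ : Set (Finset (Fin n))} (hΔ : IsLowerSet Δ)
  (G : Fin s → Finset (Fin n)) (hG : Set.range G = Δᶜ) (F : Finset (Fin n))

-- W meets every nonface exactly when its complement contains none, that is, when the complement is
-- a face. For W disjoint from F that complement is the union of F and the complement of W within
-- that of F.
include hΔ hG in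
theorem transversalFamily_eq_dualFamily :
    transversalFamily G Fᶜ = dualFamily Fᶜ (link Δ F) := by
  ext W
  refine and_congr_right fun hW => ?_
  have hWF : F ∪ Fᶜ \ W = Wᶜ := by
    ext a
    by_cases ha : a ∈ F
    · have : a ∉ W := fun h => by simpa [ha] using hW h
      simp [ha, this]
    · simp [ha]
  have hdisj : Disjoint (Fᶜ \ W) F := by
    rw [Finset.disjoint_left]
    intro a ha
    simp at ha
    exact ha.1
  constructor
  · intro h
    refine ⟨hdisj, ?_⟩
    rw [hWF]
    by_contra hcon
    obtain ⟨j, hj⟩ : Wᶜ ∈ Set.range G := by rw [hG]; exact hcon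
    obtain ⟨v, hv, hvj⟩ := h j
    rw [hj, Finset.mem_compl] at hvj
    exact hvj hv
  · intro h j
    by_contra! hcon
    have h1 : G j ∈ Δᶜ := by rw [← hG]; exact ⟨j, rfl⟩
    refine h1 (hΔ (fun v hv => ?_ : G j ≤ F ∪ Fᶜ \ W) h.2)
    rw [hWF, Finset.mem_compl]
    exact fun hv' => hcon v hv' hv

include hΔ in
theorem isLowerSet_link : IsLowerSet (link Δ F) := fun _ _ h hL =>
  ⟨hL.1.mono_left h, hΔ (Finset.union_subset_union_right h) hL.2⟩

include hΔ hG in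
/-- The covers of the complement of `F` by nonfaces compute the homology of the link of `F`. -/
def cohCoverLinkEquiv (i : ℕ) : (constSystem k (Fin s)).Coh (coverFamily G Fᶜ) i ≃ₗ[k]
    ReducedHomology k (link Δ F) ((n : ℤ) - (i : ℤ) - (F.card : ℤ) - 1) :=
  (cohCoverEquiv k G Fᶜ i).trans
    ((cohCongr _ (transversalFamily_eq_dualFamily hΔ G hG F) i).trans
    (homologyDualEquiv k (isLowerSet_link hΔ F)
      (fun L hL a ha => Finset.mem_compl.2 (Finset.disjoint_left.1 hL.1 ha)) (by
        have := Finset.card_add_card_compl F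
        rw [Fintype.card_fin] at this
        omega)).symm)

end Link

end CharCycle

namespace CharCycle

universe u v w

open CoeffSystem

/-! ### Weights of monomial localizations -/

section MonomialLocalization

variable {k : Type u} [Field k] {n : ℕ} {g : MvPolynomial (Fin n) k}

theorem mem_wt_localization {a : Fin n → ℤ} {m : Localization.Away g} :
    m ∈ wt k n (Localization.Away g) a ↔
      ∀ i, algebraMap (MvPolynomial (Fin n) k) _ (MvPolynomial.X i) * locDeriv g i m = (a i : k) • m := by
  simp only [mem_wt, weylGen_inl_smul, weylGen_inr_smul]

theorem mul_mem_wt {a b : Fin n → ℤ} {m m' : Localization.Away g}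
    (hm : m ∈ wt k n (Localization.Away g) a) (hm' : m' ∈ wt k n (Localization.Away g) b) :
    m * m' ∈ wt k n (Localization.Away g) (a + b) := by
  rw [mem_wt_localization] at *
  intro i
  rw [Derivation.leibniz, smul_eq_mul, smul_eq_mul, mul_add, mul_left_comm, hm' i,
    mul_left_comm _ m', hm i, mul_smul_comm, mul_smul_comm, mul_comm m' m, ← add_smul,
    Pi.add_apply, Int.cast_add, add_comm]

/-- Differentiate m · m⁻¹ = 1. For a nonunit the default value 0 of `Ring.inverse` has every weight.
-/
theorem ringInverse_mem_wt {a : Fin n → ℤ} {m : Localization.Away g}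
    (hm : m ∈ wt k n (Localization.Away g) a) :
    Ring.inverse m ∈ wt k n (Localization.Away g) (-a) := by
  by_cases hu : IsUnit m
  · rw [mem_wt_localization] at *
    intro i
    have h1 : m * Ring.inverse m = 1 := Ring.mul_inverse_cancel m hu
    have h2 := congrArg (locDeriv g i) h1
    rw [Derivation.map_one_eq_zero, Derivation.leibniz, smul_eq_mul, smul_eq_mul] at h2
    apply hu.mul_left_cancel
    have h3 : m * locDeriv g i (Ring.inverse m) = -(Ring.inverse m * locDeriv g i m) :=
      eq_neg_of_add_eq_zero_left h2
    rw [mul_left_comm, h3, mul_neg, mul_left_comm, hm i, mul_smul_comm, mul_smul_comm,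
      mul_comm (Ring.inverse m) m, ← neg_smul, Pi.neg_apply, Int.cast_neg]
  · rw [Ring.inverse_non_unit m hu]
    exact Submodule.zero_mem _

theorem algebraMap_monomial_mem_wt (b : Fin n →₀ ℕ) (c : k) :
    algebraMap _ _ (MvPolynomial.monomial b c) ∈
      wt k n (Localization.Away g) (fun i => (b i : ℤ)) := by
  rw [mem_wt_localization]
  intro i
  rw [locDeriv_algebraMap, ← map_mul, MvPolynomial.X_mul_pderiv_monomial, map_nsmul,
    Int.cast_natCast, Nat.cast_smul_eq_nsmul]

theorem coeff_X_mul_pderiv (i : Fin n) (s : MvPolynomial (Fin n) k) (d : Fin n →₀ ℕ) :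
    MvPolynomial.coeff d (MvPolynomial.X i * MvPolynomial.pderiv i s) =
      d i * MvPolynomial.coeff d s := by
  induction s using MvPolynomial.induction_on' with
  | monomial b c =>
    rw [MvPolynomial.X_mul_pderiv_monomial, MvPolynomial.coeff_smul, MvPolynomial.coeff_monomial,
      nsmul_eq_mul]
    split_ifs with h
    · rw [h]
    · simp
  | add p q hp hq => rw [map_add, mul_add, MvPolynomial.coeff_add, hp, hq, MvPolynomial.coeff_add,
      mul_add]

theorem algebraMap_localization_injective (hg : g ≠ 0) :
    Function.Injective (algebraMap (MvPolynomial (Fin n) k) (Localization.Away g)) :=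
  IsLocalization.injective (Localization.Away g) (M := Submonoid.powers g)
    (powers_le_nonZeroDivisors_of_noZeroDivisors hg)

variable {b : Fin n →₀ ℕ} (hb : g = MvPolynomial.monomial b 1)

-- Some g^N m is a polynomial, so m is a sum of monomials divided by g^N, which is a monomial and an
-- invertible weight vector.
include hb in
theorem isWeight_localization : IsWeight k n (Localization.Away g) := by
  refine isWeight_of_forall fun m => ?_
  obtain ⟨N, s, hs⟩ := exists_pow_smul_eq_algebraMap m
  set y : Localization.Away g := algebraMap _ _ (g ^ N) with hy
  have hyu : IsUnit y := by
    rw [hy, map_pow]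
    exact (IsLocalization.Away.algebraMap_isUnit g).pow N
  have hyw : ∃ a, y ∈ wt k n (Localization.Away g) a := by
    have h : g ^ N = MvPolynomial.monomial (N • b) 1 := by
      rw [hb, MvPolynomial.monomial_pow, one_pow]
    rw [hy, h]
    exact ⟨_, algebraMap_monomial_mem_wt _ _⟩
  obtain ⟨a, ha⟩ := hyw
  have hm : m = Ring.inverse y * algebraMap _ _ s := by
    rw [← hs, Algebra.smul_def, ← hy, Ring.inverse_mul_cancel_left _ _ hyu]
  rw [hm, s.as_sum, map_sum, Finset.mul_sum]
  exact Submodule.sum_mem _ fun d _ => Submodule.mem_iSup_of_mem _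
    (mul_mem_wt (ringInverse_mem_wt ha) (algebraMap_monomial_mem_wt _ _))

include hb in
theorem ne_zero_of_eq_monomial : g ≠ 0 := by
  rw [hb, Ne, MvPolynomial.monomial_eq_zero]
  exact one_ne_zero

-- Multiplication by g^N yields a polynomial of the same weight as the monomial g^N, and in
-- characteristic 0 only scalar multiples of that monomial have this weight.
include hb in
theorem exists_eq_smul_one_of_mem_wt_zero [CharZero k] {m : Localization.Away g}
    (hm : m ∈ wt k n (Localization.Away g) 0) : ∃ c : k, m = c • 1 := by
  obtain ⟨N, s, hs⟩ := exists_pow_smul_eq_algebraMap m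
  have h : g ^ N = MvPolynomial.monomial (N • b) 1 := by
    rw [hb, MvPolynomial.monomial_pow, one_pow]
  have hsw : algebraMap _ _ s ∈ wt k n (Localization.Away g) (fun i => ((N • b) i : ℤ)) := by
    rw [← hs, Algebra.smul_def, h]
    have := mul_mem_wt (algebraMap_monomial_mem_wt (g := g) (N • b) (1 : k)) hm
    rwa [add_zero] at this
  rw [mem_wt_localization] at hsw
  have hcoeff : ∀ d, d ≠ N • b → MvPolynomial.coeff d s = 0 := by
    intro d hd
    obtain ⟨i, hi⟩ : ∃ i, d i ≠ (N • b) i := by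
      by_contra! hcon
      exact hd (Finsupp.ext hcon)
    have h1 := hsw i
    rw [locDeriv_algebraMap, ← map_mul, Int.cast_natCast, Nat.cast_smul_eq_nsmul, ← map_nsmul] at h1
    have h2 := congrArg (MvPolynomial.coeff d)
      (algebraMap_localization_injective (ne_zero_of_eq_monomial hb) h1)
    rw [coeff_X_mul_pderiv, MvPolynomial.coeff_smul, nsmul_eq_mul, ← sub_eq_zero, ← sub_mul] at h2
    refine (mul_eq_zero.1 h2).resolve_left ?_
    rw [sub_eq_zero]
    exact_mod_cast hi
  have hs' : s = MvPolynomial.C (MvPolynomial.coeff (N • b) s) * g ^ N := by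
    rw [h, MvPolynomial.C_mul_monomial, mul_one]
    ext d
    rw [MvPolynomial.coeff_monomial]
    split_ifs with hd
    · rw [hd]
    · exact hcoeff d (Ne.symm hd)
  refine ⟨MvPolynomial.coeff (N • b) s, smul_injective_of_dvd (dvd_refl g) N ?_⟩
  rw [hs, ← algebraMap_smul (MvPolynomial (Fin n) k) _ (1 : Localization.Away g), smul_smul,
    MvPolynomial.algebraMap_eq, Algebra.smul_def, mul_one, mul_comm (g ^ N), ← hs']

end MonomialLocalization

/-! ### Generators of the weight spaces `eps F` -/

section Generator

variable {k : Type u} [Field k] {n : ℕ} (g : MvPolynomial (Fin n) k) (F : Finset (Fin n))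

/-- The inverse in `S_g` of the product of the variables off `F`; it is zero if that product is
not invertible. -/
def epsGen : Localization.Away g :=
  Ring.inverse (algebraMap (MvPolynomial (Fin n) k) _ (∏ i ∈ Fᶜ, MvPolynomial.X i))

theorem prod_X_eq_monomial (U : Finset (Fin n)) :
    (∏ i ∈ U, MvPolynomial.X i : MvPolynomial (Fin n) k) =
      MvPolynomial.monomial (∑ i ∈ U, Finsupp.single i 1) 1 :=
  (MvPolynomial.monomial_sum_one U _).symm

theorem algebraMap_prod_X_mem_wt : algebraMap (MvPolynomial (Fin n) k) _ (∏ i ∈ Fᶜ, MvPolynomial.X i) ∈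
    wt k n (Localization.Away g) (-eps F) := by
  rw [prod_X_eq_monomial]
  convert algebraMap_monomial_mem_wt (k := k) (g := g) _ _ using 2
  funext i
  by_cases hi : i ∈ F <;> simp [eps, hi, Finsupp.finsetSum_apply, Finsupp.single_apply]

theorem epsGen_mem_wt : epsGen g F ∈ wt k n (Localization.Away g) (eps F) := by
  have := ringInverse_mem_wt (algebraMap_prod_X_mem_wt g F)
  rwa [neg_neg] at this

variable {g}

/-- The product of m with the variables off F has weight 0, hence is a constant c. If that product
of variables is not a unit, then c = 0, since otherwise c⁻¹ m would invert it, and m = 0 in a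
domain. -/
theorem exists_eq_smul_epsGen [CharZero k] {b : Fin n →₀ ℕ} (hb : g = MvPolynomial.monomial b 1)
    {m : Localization.Away g} (hm : m ∈ wt k n (Localization.Away g) (eps F)) :
    ∃ c : k, m = c • epsGen g F := by
  have h1 := mul_mem_wt (algebraMap_prod_X_mem_wt g F) hm
  rw [neg_add_cancel] at h1
  obtain ⟨c, hc⟩ := exists_eq_smul_one_of_mem_wt_zero hb h1
  refine ⟨c, ?_⟩
  rw [epsGen]
  set t : Localization.Away g := algebraMap (MvPolynomial (Fin n) k) _ (∏ i ∈ Fᶜ, MvPolynomial.X i) with ht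
  by_cases hu : IsUnit t
  · rw [← Ring.inverse_mul_cancel_left _ m hu, hc, mul_smul_comm, mul_one]
  · have hc0 : c = 0 := by
      by_contra hc0
      refine hu (IsUnit.of_mul_eq_one (c⁻¹ • m) ?_)
      rw [mul_smul_comm, hc, smul_smul, inv_mul_cancel₀ hc0, one_smul]
    have hg := ne_zero_of_eq_monomial hb
    have : IsDomain (Localization.Away g) := IsLocalization.isDomain_localization
      (powers_le_nonZeroDivisors_of_noZeroDivisors hg)
    rw [hc0, zero_smul] at hc ⊢
    refine (mul_eq_zero.1 hc).resolve_left fun h => ?_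
    have h2 := algebraMap_localization_injective hg (h.trans (map_zero _).symm)
    rw [Finset.prod_eq_zero_iff] at h2
    obtain ⟨i, _, hi⟩ := h2
    exact MvPolynomial.X_ne_zero i hi

end Generator

/-! ### The part of weight `eps F` of the monomial Čech complex -/

section MonomialCech

variable {k : Type u} [Field k] {n s : ℕ} (G : Fin s → Finset (Fin n)) (F : Finset (Fin n))

variable (k) in
/-- The squarefree monomials `x^{G_j}`. -/
def monomialGen (j : Fin s) : MvPolynomial (Fin n) k := ∏ i ∈ G j, MvPolynomial.X i

theorem prod_monomialGen (σ : Finset (Fin s)) :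
    ∃ b, ∏ j ∈ σ, monomialGen k G j = MvPolynomial.monomial b 1 := by
  simp only [monomialGen, prod_X_eq_monomial]
  exact ⟨_, (MvPolynomial.monomial_sum_one σ _).symm⟩

/-- An inverse of x_v makes x_v divide a power of the inverted monomial. Being prime, x_v then
divides one of the x^{G_j}, that is, v lies in G_j. -/
theorem isUnit_prod_X_iff (σ : Finset (Fin s)) :
    IsUnit (algebraMap (MvPolynomial (Fin n) k) (Localization.Away (∏ j ∈ σ, monomialGen k G j))
      (∏ i ∈ Fᶜ, MvPolynomial.X i)) ↔ σ ∈ coverFamily G Fᶜ := by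
  obtain ⟨b, hb⟩ := prod_monomialGen (k := k) G σ
  constructor
  · intro h v hv
    have h1 := isUnit_of_dvd_unit (map_dvd _ (Finset.dvd_prod_of_mem
      (fun i => (MvPolynomial.X i : MvPolynomial (Fin n) k)) hv)) h
    obtain ⟨m, hm⟩ := h1.exists_right_inv
    obtain ⟨N, p, hp⟩ := exists_pow_smul_eq_algebraMap m
    have h2 : MvPolynomial.X v * p = (∏ j ∈ σ, monomialGen k G j) ^ N := by
      refine algebraMap_localization_injective (ne_zero_of_eq_monomial hb) ?_
      rw [map_mul, ← hp, mul_smul_comm, hm, Algebra.smul_def, mul_one]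
    have hprime : Prime (MvPolynomial.X v : MvPolynomial (Fin n) k) := MvPolynomial.X_prime
    have h3 := hprime.dvd_of_dvd_pow (Dvd.intro _ h2)
    obtain ⟨j, hj, h4⟩ := (hprime.dvd_finsetProd_iff _).1 h3
    obtain ⟨w, hw, h5⟩ := (hprime.dvd_finsetProd_iff _).1 h4
    rw [MvPolynomial.X_dvd_X] at h5
    exact ⟨j, hj, h5 ▸ hw⟩
  · intro h
    rw [map_prod]
    refine IsUnit.prod_iff.2 fun v hv => ?_
    obtain ⟨j, hj, hvj⟩ := h v hv
    exact isUnit_of_dvd ((Finset.dvd_prod_of_mem _ hvj).trans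
      (Finset.dvd_prod_of_mem (monomialGen k G) hj))

theorem locRes_epsGen {σ τ : Finset (Fin s)} (h : σ ⊆ τ) (hσ : σ ∈ coverFamily G Fᶜ) :
    locRes (Finset.prod_dvd_prod_of_subset _ _ (monomialGen k G) h)
      (epsGen (∏ j ∈ σ, monomialGen k G j) F) = epsGen (∏ j ∈ τ, monomialGen k G j) F := by
  have hu := (isUnit_prod_X_iff (k := k) G F σ).2 hσ
  have hu' := (isUnit_prod_X_iff (k := k) G F τ).2 fun v hv => by
    obtain ⟨j, hj, hvj⟩ := hσ v hv
    exact ⟨j, h hj, hvj⟩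
  apply hu'.mul_left_cancel
  rw [epsGen, epsGen, Ring.mul_inverse_cancel _ hu',
    ← locRes_algebraMap (Finset.prod_dvd_prod_of_subset _ _ (monomialGen k G) h), ← map_mul,
    Ring.mul_inverse_cancel _ hu, map_one]

theorem epsGen_eq_zero {σ : Finset (Fin s)} (hσ : σ ∉ coverFamily G Fᶜ) :
    epsGen (∏ j ∈ σ, monomialGen k G j) F = 0 :=
  Ring.inverse_non_unit _ fun h => hσ ((isUnit_prod_X_iff G F σ).1 h)

theorem epsGen_ne_zero {σ : Finset (Fin s)} (hσ : σ ∈ coverFamily G Fᶜ) :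
    epsGen (∏ j ∈ σ, monomialGen k G j) F ≠ 0 := by
  obtain ⟨b, hb⟩ := prod_monomialGen (k := k) G σ
  have : Nontrivial (Localization.Away (∏ j ∈ σ, monomialGen k G j)) :=
    (algebraMap_localization_injective (ne_zero_of_eq_monomial hb)).nontrivial
  exact ((isUnit_prod_X_iff G F σ).2 hσ).ringInverse.ne_zero

/-- The cochains of weight `eps F`, from cochains with constant coefficients. -/
def epsCochain : (Finset (Fin s) → k) →ₗ[k] CechTotal (monomialGen k G) where
  toFun c σ := c σ • epsGen (∏ j ∈ σ, monomialGen k G j) F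
  map_add' _ _ := funext fun _ => add_smul _ _ _
  map_smul' _ _ := funext fun _ => mul_smul _ _ _

theorem epsCochain_apply (c : Finset (Fin s) → k) (σ : Finset (Fin s)) :
    epsCochain G F c σ = c σ • epsGen (∏ j ∈ σ, monomialGen k G j) F := rfl

theorem epsCochain_injective {c c' : Finset (Fin s) → k}
    (hc : ∀ σ, σ ∉ coverFamily G Fᶜ → c σ = 0) (hc' : ∀ σ, σ ∉ coverFamily G Fᶜ → c' σ = 0)
    (h : epsCochain G F c = epsCochain G F c') : c = c' := by
  funext σ
  by_cases hσ : σ ∈ coverFamily G Fᶜ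
  · have h1 := congrFun h σ
    rw [epsCochain_apply, epsCochain_apply, ← sub_eq_zero, ← sub_smul] at h1
    exact sub_eq_zero.1 ((smul_eq_zero.1 h1).resolve_right (epsGen_ne_zero G F hσ))
  · rw [hc σ hσ, hc' σ hσ]

/-- The transition maps match the chosen generators on covers. Off the covers both sides vanish,
because a subset of a noncover is a noncover. -/
theorem diff_epsCochain {c : Finset (Fin s) → k} (hc : ∀ σ, σ ∉ coverFamily G Fᶜ → c σ = 0) :
    (cechSystem (monomialGen k G)).diff Set.univ (epsCochain G F c) =
      epsCochain G F ((constSystem k (Fin s)).diff (coverFamily G Fᶜ) c) := by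
  funext τ
  rw [CoeffSystem.diff_apply _ (Set.mem_univ τ), epsCochain_apply]
  by_cases hτ : τ ∈ coverFamily G Fᶜ
  · rw [constSystem_diff_apply hτ, Finset.sum_smul]
    refine Finset.sum_congr rfl fun v _ => ?_
    rw [epsCochain_apply, smul_assoc, cechSystem_res, locRes_smul]
    by_cases hv : τ.erase v ∈ coverFamily G Fᶜ
    · rw [locRes_epsGen G F (τ.erase_subset v) hv]
    · rw [hc _ hv, zero_smul, zero_smul]
  · rw [epsGen_eq_zero G F hτ, smul_zero]
    refine Finset.sum_eq_zero fun v _ => ?_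
    rw [epsCochain_apply, epsGen_eq_zero, smul_zero, map_zero, zsmul_zero]
    intro h
    refine hτ fun v hv => ?_
    obtain ⟨j, hj, hvj⟩ := h v hv
    exact ⟨j, Finset.mem_of_mem_erase hj, hvj⟩

theorem epsCochain_mem_term {c : Finset (Fin s) → k} {p : ℤ}
    (hc : c ∈ term (A := k) (coverFamily G Fᶜ) p) :
    epsCochain G F c ∈ term (A := Weyl k n)
      (C := fun σ => Localization.Away (∏ j ∈ σ, monomialGen k G j)) Set.univ p := by
  intro σ hσ
  rw [epsCochain_apply, hc, zero_smul]
  exact fun h => hσ ⟨Set.mem_univ σ, h.2⟩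

theorem epsCochain_mem_wt (c : Finset (Fin s) → k) :
    epsCochain G F c ∈ wt k n (CechTotal (monomialGen k G)) (eps F) := by
  rw [mem_wt]
  intro i
  funext σ
  exact Submodule.smul_mem _ (c σ) (epsGen_mem_wt _ F) i

theorem exists_epsCochain_eq [CharZero k] {m : CechTotal (monomialGen k G)} {p : ℤ}
    (hm : m ∈ wt k n (CechTotal (monomialGen k G)) (eps F))
    (hmt : m ∈ term (A := Weyl k n)
      (C := fun σ => Localization.Away (∏ j ∈ σ, monomialGen k G j)) Set.univ p) :
    ∃ c ∈ term (A := k) (coverFamily G Fᶜ) p, epsCochain G F c = m := by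
  classical
  have h1 : ∀ σ, ∃ c : k, m σ = c • epsGen (∏ j ∈ σ, monomialGen k G j) F := by
    intro σ
    obtain ⟨b, hb⟩ := prod_monomialGen (k := k) G σ
    exact exists_eq_smul_epsGen F hb fun i => congrFun (hm i) σ
  choose c hc using h1
  refine ⟨fun σ => if σ ∈ coverFamily G Fᶜ ∧ (σ.card : ℤ) = p then c σ else 0,
    fun σ hσ => if_neg hσ, ?_⟩
  funext σ
  rw [epsCochain_apply]
  by_cases h : σ ∈ coverFamily G Fᶜ
  · by_cases h' : (σ.card : ℤ) = p
    · simp only [h, h', and_self, if_true, hc σ]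
    · rw [if_neg fun h'' => h' h''.2, zero_smul, hmt σ fun h'' => h' h''.2]
  · rw [hc σ, epsGen_eq_zero G F h, smul_zero, smul_zero]

end MonomialCech

theorem IsWeight.pi {k : Type u} [Field k] {n : ℕ} {ι : Type*} [Finite ι] {M : ι → Type*}
    [∀ i, AddCommGroup (M i)] [∀ i, Module k (M i)] [∀ i, Module (Weyl k n) (M i)]
    [∀ i, IsScalarTower k (Weyl k n) (M i)] (h : ∀ i, IsWeight k n (M i)) :
    IsWeight k n (∀ i, M i) := by
  classical
  cases nonempty_fintype ι
  refine isWeight_of_forall fun m => ?_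
  have hm : m = ∑ i, LinearMap.single (Weyl k n) M i (m i) :=
    (LinearMap.sum_single_apply M m).symm
  rw [hm]
  refine Submodule.sum_mem _ fun i _ => ?_
  obtain ⟨f, hf, hfm⟩ := (h i).exists_finsupp (m i)
  rw [← hfm, Finsupp.sum, map_sum]
  exact Submodule.sum_mem _ fun a _ => Submodule.mem_iSup_of_mem a (map_mem_wt _ (hf a))

/-! ### Weight spaces of Čech cohomology -/

section WeightSpaces

variable {k : Type u} [Field k] [CharZero k] {n s : ℕ} (G : Fin s → Finset (Fin n))
  (F : Finset (Fin n)) (p : ℤ)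

theorem isWeight_cechTotal : IsWeight k n (CechTotal (monomialGen k G)) :=
  IsWeight.pi fun σ => isWeight_localization (prod_monomialGen G σ).choose_spec

theorem isWeight_coh : IsWeight k n ((cechSystem (monomialGen k G)).Coh Set.univ p) :=
  ((isWeight_cechTotal G).submodule _).of_surjective (Submodule.mkQ _) (Submodule.mkQ_surjective _)

theorem epsCochain_mem_cocyc {c : Finset (Fin s) → k}
    (hc : c ∈ (constSystem k (Fin s)).cocyc (coverFamily G Fᶜ) p) :
    epsCochain G F c ∈ (cechSystem (monomialGen k G)).cocyc Set.univ p := by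
  refine ⟨epsCochain_mem_term G F hc.1, ?_⟩
  rw [SetLike.mem_coe, LinearMap.mem_ker,
    diff_epsCochain G F fun σ hσ => eq_zero_of_mem_term hc.1 hσ, LinearMap.mem_ker.1 hc.2, map_zero]

/-- The cohomology classes of weight `eps F`. -/
def epsClass : (constSystem k (Fin s)).cocyc (coverFamily G Fᶜ) p →ₗ[k]
    (cechSystem (monomialGen k G)).Coh Set.univ p where
  toFun c := Submodule.Quotient.mk ⟨epsCochain G F c, epsCochain_mem_cocyc G F p c.2⟩
  map_add' a b := by
    rw [← Submodule.Quotient.mk_add]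
    congr 1
    exact Subtype.ext (map_add (epsCochain G F) _ _)
  map_smul' r a := by
    rw [RingHom.id_apply, ← Submodule.Quotient.mk_smul]
    congr 1
    exact Subtype.ext (map_smul (epsCochain G F) _ _)

/-- A primitive of a coboundary of weight `eps F` need not have that weight, but the cochains of
degree p - 1 form a weight module, so it can be replaced by one that does and therefore comes from
constant coefficients. -/
theorem ker_epsClass : LinearMap.ker (epsClass (k := k) G F p) =
    ((constSystem k (Fin s)).cobd (coverFamily G Fᶜ) p).submoduleOf
      ((constSystem k (Fin s)).cocyc (coverFamily G Fᶜ) p) := by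
  ext ⟨c, hc⟩
  have hsupp : ∀ {q : ℤ} {c : Finset (Fin s) → k}, c ∈ term (A := k) (coverFamily G Fᶜ) q →
      ∀ σ, σ ∉ coverFamily G Fᶜ → c σ = 0 := fun hc σ hσ => eq_zero_of_mem_term hc hσ
  rw [LinearMap.mem_ker]
  refine (Submodule.Quotient.mk_eq_zero _).trans ?_
  change epsCochain G F c ∈ (cechSystem (monomialGen k G)).cobd Set.univ p ↔
    c ∈ (constSystem k (Fin s)).cobd (coverFamily G Fᶜ) p
  constructor
  · rintro ⟨y, hy, h⟩
    let T : Submodule (Weyl k n) (CechTotal (monomialGen k G)) := term Set.univ (p - 1)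
    let φ : T →ₗ[Weyl k n] CechTotal (monomialGen k G) :=
      ((cechSystem (monomialGen k G)).diff Set.univ).comp T.subtype
    obtain ⟨y₀, hy₀, h'⟩ := ((isWeight_cechTotal G).submodule T).exists_wt_map_eq φ
      (a := eps F) (m := ⟨y, hy⟩) (by
        change (cechSystem (monomialGen k G)).diff Set.univ y ∈ _
        rw [h]
        exact epsCochain_mem_wt G F c)
    obtain ⟨w, hw, hwy⟩ := exists_epsCochain_eq G F (map_mem_wt T.subtype hy₀) y₀.2
    refine ⟨w, hw, epsCochain_injective G F (fun σ hσ => CoeffSystem.diff_apply_of_notMem _ hσ _)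
      (hsupp hc.1) ?_⟩
    rw [← diff_epsCochain G F (hsupp hw), hwy]
    exact h'.trans h
  · rintro ⟨w, hw, rfl⟩
    exact ⟨_, epsCochain_mem_term G F hw, diff_epsCochain G F (hsupp hw)⟩

/-- A class of weight `eps F` is represented by a cocycle of this weight, since the cocycles form a
weight module; such a cocycle comes from constant coefficients. -/
theorem range_epsClass : LinearMap.range (epsClass (k := k) G F p) =
    wt k n ((cechSystem (monomialGen k G)).Coh Set.univ p) (eps F) := by
  refine le_antisymm ?_ fun y hy => ?_
  · rintro _ ⟨c, rfl⟩
    refine map_mem_wt (Submodule.mkQ _) (mem_wt_of_injective (Submodule.subtype _)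
      (Submodule.subtype_injective _) ?_)
    exact epsCochain_mem_wt G F (c : Finset (Fin s) → k)
  · obtain ⟨z, rfl⟩ := Submodule.mkQ_surjective _ y
    obtain ⟨z₀, hz₀, h⟩ := ((isWeight_cechTotal G).submodule _).exists_wt_map_eq _ hy
    rw [← h]
    obtain ⟨c, hc, hcz⟩ := exists_epsCochain_eq G F (map_mem_wt (Submodule.subtype _) hz₀) z₀.2.1
    have hsupp : ∀ σ, σ ∉ coverFamily G Fᶜ → c σ = 0 := fun σ hσ => eq_zero_of_mem_term hc hσ
    refine ⟨⟨c, hc, ?_⟩, ?_⟩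
    · refine epsCochain_injective G F (fun σ hσ => CoeffSystem.diff_apply_of_notMem _ hσ _)
        (fun _ _ => rfl) ?_
      rw [← diff_epsCochain G F hsupp, hcz, map_zero]
      exact LinearMap.mem_ker.1 z₀.2.2
    · exact congrArg (Submodule.mkQ _) (Subtype.ext hcz)

/-- The weight space of weight `eps F` as the cohomology of the covers of the complement of `F`. -/
def cohCoverWtEquiv : (constSystem k (Fin s)).Coh (coverFamily G Fᶜ) p ≃ₗ[k]
    wt k n ((cechSystem (monomialGen k G)).Coh Set.univ p) (eps F) :=
  (Submodule.quotEquivOfEq _ _ (ker_epsClass G F p).symm).trans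
    ((epsClass G F p).quotKerEquivRange.trans (LinearEquiv.ofEq _ _ (range_epsClass G F p)))

end WeightSpaces

end CharCycle

namespace CharCycle

universe u v w

open CoeffSystem

/-! ### Local cohomology at Stanley-Reisner ideals -/

/-- Weight spaces of isomorphic modules. -/
def wtEquiv {k : Type u} [Field k] {n : ℕ} {M : Type v} [AddCommGroup M] [Module k M]
    [Module (Weyl k n) M] [IsScalarTower k (Weyl k n) M] {M' : Type w} [AddCommGroup M']
    [Module k M'] [Module (Weyl k n) M'] [IsScalarTower k (Weyl k n) M']
    (e : M ≃ₗ[Weyl k n] M') (a : Fin n → ℤ) : wt k n M a ≃ₗ[k] wt k n M' a :=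
  LinearEquiv.ofSubmodules (e.restrictScalars k) _ _ (by
    ext m'
    refine ⟨?_, fun h => ⟨e.symm m', map_mem_wt e.symm.toLinearMap h, e.apply_symm_apply m'⟩⟩
    rintro ⟨m, hm, rfl⟩
    exact map_mem_wt e.toLinearMap hm)

section StanleyReisner

variable (k : Type u) [Field k] {n : ℕ}

theorem span_monomialGen {s : ℕ} {Δ : Set (Finset (Fin n))} {G : Fin s → Finset (Fin n)}
    (hG : Set.range G = Δᶜ) :
    Ideal.span (Set.range (monomialGen k G)) = stanleyReisnerIdeal k Δ := by
  rw [stanleyReisnerIdeal]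
  congr 1
  ext p
  constructor
  · rintro ⟨j, rfl⟩
    exact ⟨G j, (hG ▸ Set.mem_range_self j : G j ∈ Δᶜ), rfl⟩
  · rintro ⟨T, hT, rfl⟩
    obtain ⟨j, rfl⟩ : T ∈ Set.range G := hG ▸ hT
    exact ⟨j, rfl⟩

theorem exists_enumeration_compl (Δ : Set (Finset (Fin n))) :
    ∃ (s : ℕ) (G : Fin s → Finset (Fin n)), Set.range G = Δᶜ := by
  obtain ⟨s, G, -, hG⟩ := Δᶜ.toFinite.fin_param
  exact ⟨s, G, hG⟩

variable {k}

/-- All nonfaces serve as generators, not only the minimal ones, so that a set is a face exactly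
when it is not among the G_j. -/
theorem isWeight_and_wt_localCohomology [CharZero k] {Δ : Set (Finset (Fin n))}
    (hΔ : IsLowerSet Δ) {r : ℕ} (f : Fin r → MvPolynomial (Fin n) k)
    (hf : Ideal.span (Set.range f) = stanleyReisnerIdeal k Δ) (i : ℕ) :
    IsWeight k n (LocalCohomology f i) ∧ ∀ F : Finset (Fin n),
      Nonempty (wt k n (LocalCohomology f i) (eps F) ≃ₗ[k]
        ReducedHomology k (link Δ F) ((n : ℤ) - (i : ℤ) - (F.card : ℤ) - 1)) := by
  obtain ⟨s, G, hG⟩ := exists_enumeration_compl Δ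
  obtain ⟨e⟩ := nonempty_localCohomology_of_span_eq f (monomialGen k G)
    (hf.trans (span_monomialGen k hG).symm) i
  have e' := e.trans (localCohomologyEquiv (monomialGen k G) i)
  refine ⟨(isWeight_coh G i).of_surjective e'.symm.toLinearMap e'.symm.surjective, fun F => ⟨?_⟩⟩
  exact (wtEquiv e' (eps F)).trans
    ((cohCoverWtEquiv G F i).symm.trans (cohCoverLinkEquiv k hΔ G hG F i))

end StanleyReisner

end CharCycle

end

theorem corollary5p8 {k : Type*} [Field k] [CharZero k] {n : ℕ}
    (Δ : Set (Finset (Fin n))) (hne : Δ.Nonempty) (hΔ : IsLowerSet Δ)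
    {r : ℕ} (f : Fin r → MvPolynomial (Fin n) k)
    (hf : Ideal.span (Set.range f) = CharCycle.stanleyReisnerIdeal k Δ) (i : ℕ) :
    Module.Finite (CharCycle.Weyl k n) (CharCycle.LocalCohomology f i) ∧
    (∃ Γ : CharCycle.WeylFiltration k n (CharCycle.LocalCohomology f i), Γ.IsGood) ∧
    ∀ Γ : CharCycle.WeylFiltration k n (CharCycle.LocalCohomology f i), Γ.IsGood →
      (∀ Q ∈ Γ.SS, ∃ F : Finset (Fin n), Q = CharCycle.qIdeal k F) ∧
      ∀ F : Finset (Fin n), Γ.multiplicity (CharCycle.qIdeal k F) =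
        (Module.finrank k (CharCycle.ReducedHomology k (CharCycle.link Δ F)
          ((n : ℤ) - (i : ℤ) - (F.card : ℤ) - 1)) : ℕ∞) := by
  obtain ⟨hw, e⟩ := CharCycle.isWeight_and_wt_localCohomology hΔ f hf i
  -- The homology is a subquotient of the functions on a finite power set, hence finite-dimensional,
  -- and the weight space inherits this.
  have hfin : ∀ F, Module.Finite k
      (CharCycle.wt k n (CharCycle.LocalCohomology f i) (CharCycle.eps F)) :=
    fun F => Module.Finite.equiv (e F).some.symm
  have hM := hw.finite hfin
  refine ⟨hM, CharCycle.WeylFiltration.exists_isGood, fun Γ hΓ => ⟨fun Q hQ => ?_, fun F => ?_⟩⟩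
  · exact hw.exists_eq_qIdeal hfin hΓ hQ
  · rw [hw.multiplicity_qIdeal hfin hΓ F, (e F).some.finrank_eq]
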